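/- Throughout, a face of a polytope may be empty ($\dim\emptyset=-1$) or the whole polytope, $\mathcal V(P)$ is the vertex set of $P$, $f_i(P)$ is the number of $i$-dimensional faces of $P$, and two polytopes are combinatorially equivalent if their face lattices are isomorphic. Let $P\subset\mathbb R^n$ be an $n$-dimensional polytope with a special $k$-simplex $\Sigma$, i.e. $\Sigma$ is a $k$-simplex spanned by $k+1$ vertices of $P$ and every facet of $P$ contains exactly $k$ of these vertices. Let $V$ be the linear subspace parallel to $\operatorname{aff}\Sigma$, let the basis polytope $Q\subset\mathbb R^n/V$ be the image of $P$ under the quotient map, and let $\mathcal A$ be the affine hull of the union of all faces of $P$ that contain no vertex of $\Sigma$. Choose a linear complement $W$ of $V$ in $\mathbb R^n$ and a point $p$ in the relative interior of $\mathcal A\cap\Sigma$. Let the vertex projection $\phi$ be the projection of $\mathbb R^n$ onto $p+W$ along $V$ (it places a copy of $Q$ in $p+W$), and put $$P'=\operatorname{conv}\bigl(\phi(\mathcal V(P)\setminus\mathcal V(\Sigma))\cup\mathcal V(\Sigma)\bigr).$$ $P$ is called meek if $\dim Q=\dim\mathcal A$, and wild if $\dim Q<\dim\mathcal A$ and $P$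 is not combinatorially equivalent to the polytope $P'$ (for any choice of $W$ and $p$). Suppose that $P$ is wild. Then, for every choice of $W$ and $p$ as above, $P'$ is an $n$-dimensional polytope, $\Sigma$ is a special simplex of $P'$, $P'$ is meek and has the same basis polytope $Q$ as $P$, and $$f_0(P)=f_0(P'),\qquad f_i(P)<f_i(P')\ \text{ for } i\in\{n-2,n-1\},\qquad f_i(P)\le f_i(P')\ \text{ for all other } i .$$ Moreover, let $\Sigma\oplus Q$ be the direct sum $\{(\lambda_1v,\lambda_2w): v\in T,\ w\in Q-q,\ \lambda_1,\lambda_2\ge 0,\ \lambda_1+\lambda_2\le 1\}$, where $T\subset\mathbb R^k$ is any $k$-simplex with the origin in its interior and $q$ is any interior point of $Q$. Then $$f_0(P')=f_0(\Sigma\oplus Q),\qquad f_i(P')\le f_i(\Sigma\oplus Q)\ \text{ for all } i,$$ and the $f$-vector of $\Sigma\oplus Q$ is given explicitly by $$f_j(\Sigma\oplus Q)=\sum_{\substack{-1\le r\le \dim Q-1,\ -1\le l\le k-1\\ r+l=j-1}} f_r(Q)\binom{k+1}{l+1}\qquad(0\le j\le n-1).$$ -/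

import Mathlib

noncomputable section

namespace SpecialSimplex

/-- Euclidean space `ℝⁿ`. -/
abbrev EucSp (n : ℕ) : Type := EuclideanSpace ℝ (Fin n)

section Polytopes

variable {E : Type*} [AddCommGroup E] [Module ℝ E]

/-- A polytope: the convex hull of finitely many points. -/
def IsPolytope (P : Set E) : Prop :=
  ∃ s : Set E, s.Finite ∧ P = convexHull ℝ s

open Classical in
/-- The dimension of (the affine hull of) a set, with `dim ∅ = -1`. -/
def dim (F : Set E) : ℤ :=
  if F = ∅ then -1 else (Module.finrank ℝ (vectorSpan ℝ F) : ℤ)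

/-- The vertex set `V(P)` of a polytope. -/
def vertices (P : Set E) : Set E := P.extremePoints ℝ

variable [TopologicalSpace E]

/-- The faces of a polytope `P`, the empty face and `P` itself included: the sets of the points of
`P` at which a linear functional attains its maximum over `P`, and `∅`. -/
def faces (P : Set E) : Set (Set E) := {F | IsExposed ℝ P F}

/-- The facets of `P`: the faces of codimension one. -/
def facets (P : Set E) : Set (Set E) := {F | F ∈ faces P ∧ dim F = dim P - 1}

/-- The entry `f_i(P)` of the `f`-vector: the number of `i`-dimensional faces of `P`. -/
def fVec (P : Set E) (i : ℤ) : ℕ := {F | F ∈ faces P ∧ dim F = i}.ncard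

/-- Two polytopes are combinatorially equivalent if their face lattices (ordered by inclusion)
are isomorphic. -/
def CombEquiv (P P' : Set E) : Prop :=
  Nonempty ({F // F ∈ faces P} ≃o {F // F ∈ faces P'})

end Polytopes

/-- The direct sum `P₁ ⊕ P₂` of two polytopes. -/
def directSum {E₁ E₂ : Type*} [AddCommGroup E₁] [Module ℝ E₁] [AddCommGroup E₂] [Module ℝ E₂]
    (P₁ : Set E₁) (P₂ : Set E₂) : Set (E₁ × E₂) :=
  {z | ∃ v ∈ P₁, ∃ w ∈ P₂, ∃ a b : ℝ, 0 ≤ a ∧ 0 ≤ b ∧ a + b ≤ 1 ∧ z = (a • v, b • w)}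

variable {n k : ℕ}

/-- The vertex set `V(Σ)` of a simplex `Σ`. -/
def simplexVertices (σ : Affine.Simplex ℝ (EucSp n) k) : Set (EucSp n) := Set.range σ.points

/-- The simplex `Σ` as a convex body. -/
def simplexBody (σ : Affine.Simplex ℝ (EucSp n) k) : Set (EucSp n) :=
  convexHull ℝ (simplexVertices σ)

/-- The linear subspace parallel to the affine hull of `Σ`. -/
def simplexDir (σ : Affine.Simplex ℝ (EucSp n) k) : Submodule ℝ (EucSp n) :=
  vectorSpan ℝ (simplexVertices σ)

/-- `Σ` is a special `k`-simplex of `P`: it is spanned by `k + 1` vertices of `P`, and every facet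
of `P` contains exactly `k` of these. -/
def IsSpecialSimplex (P : Set (EucSp n)) (σ : Affine.Simplex ℝ (EucSp n) k) : Prop :=
  simplexVertices σ ⊆ vertices P ∧ ∀ F ∈ facets P, (simplexVertices σ ∩ F).ncard = k

/-- The basis polytope `Q`: the image of `P` under the linear projection whose kernel is the
linear subspace parallel to the affine hull of `Σ`. -/
def basisPolytope (P : Set (EucSp n)) (σ : Affine.Simplex ℝ (EucSp n) k) :
    Set (EucSp n ⧸ simplexDir σ) :=
  (simplexDir σ).mkQ '' P

/-- The subcomplex `F(P) \ V(Σ)` of all faces of `P` that contain no vertex of `Σ`. -/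
def residualComplex (P : Set (EucSp n)) (σ : Affine.Simplex ℝ (EucSp n) k) :
    Set (Set (EucSp n)) :=
  {F | F ∈ faces P ∧ Disjoint F (simplexVertices σ)}

/-- The affine basis space of `F(P) \ V(Σ)`: the affine hull of the union of its faces. -/
def residualSpan (P : Set (EucSp n)) (σ : Affine.Simplex ℝ (EucSp n) k) :
    AffineSubspace ℝ (EucSp n) :=
  affineSpan ℝ (⋃₀ residualComplex P σ)

/-- `P` is meek (with respect to `Σ`): `Q` has the dimension of the affine basis space of
`F(P) \ V(Σ)`. -/
def IsMeek (P : Set (EucSp n)) (σ : Affine.Simplex ℝ (EucSp n) k) : Prop :=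
  dim (basisPolytope P σ) = dim (residualSpan P σ : Set (EucSp n))

/-- A way of placing a copy of the basis polytope `Q` in `ℝⁿ`: the copy lies in the affine
subspace `p + W`, where the linear subspace `W` is complementary to the direction of `Σ` and `p`,
the point where the copy meets `Σ`, is a relative interior point of the intersection of `Σ` with
the affine basis space of `F(P) \ V(Σ)`. -/
structure Placement (P : Set (EucSp n)) (σ : Affine.Simplex ℝ (EucSp n) k) where
  /-- The direction of the affine subspace that carries the copy of `Q`. -/
  W : Submodule ℝ (EucSp n)
  isCompl : IsCompl W (simplexDir σ)
  /-- The point in which that affine subspace meets `Σ`. -/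
  p : EucSp n
  mem : p ∈ intrinsicInterior ℝ ((residualSpan P σ : Set (EucSp n)) ∩ simplexBody σ)

/-- The vertex projection `φ` on the vertices outside `Σ`: the affine projection of `ℝⁿ` onto
`p + W` along the direction of `Σ`. -/
def vertexProjection {P : Set (EucSp n)} {σ : Affine.Simplex ℝ (EucSp n) k}
    (c : Placement P σ) (v : EucSp n) : EucSp n :=
  c.p + c.W.projection (simplexDir σ) c.isCompl (v - c.p)

/-- The polytope `P' = conv (φ(V(P) \ V(Σ)) ∪ V(Σ))`. -/
def projectedPolytope {P : Set (EucSp n)} {σ : Affine.Simplex ℝ (EucSp n) k}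
    (c : Placement P σ) : Set (EucSp n) :=
  convexHull ℝ (vertexProjection c '' (vertices P \ simplexVertices σ) ∪ simplexVertices σ)

/-- `P` is wild (with respect to `Σ`): the dimension of `Q` is smaller than that of the affine
basis space of `F(P) \ V(Σ)`, and `P` is not combinatorially equivalent to the meek polytope
`conv (V(Q) ∪ V(Σ))` (`Q` being placed in `ℝⁿ`). -/
def IsWild (P : Set (EucSp n)) (σ : Affine.Simplex ℝ (EucSp n) k) : Prop :=
  dim (basisPolytope P σ) < dim (residualSpan P σ : Set (EucSp n)) ∧
    ∀ c : Placement P σ, ¬ CombEquiv P (projectedPolytope c)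

end SpecialSimplex

end

open SpecialSimplex

/-! Let `c_i` be the barycentric coordinates of `Σ`, extended to `ℝⁿ` along `W`, and let `y` be the
coordinate in `Y = ℝⁿ/V`. A facet of `P` misses exactly one vertex of `Σ`, say the `i`-th; scaled to
be `1` there, its inequality reads `c_i ≥ g_ij(y)` with `g_ij` linear. So `P` is the set `c_i ≥
g_i(y)` for all `i`, where `g_i = max_j g_ij` (`exists_eq_fanPoly`), and `Q` is, up to translation,
the set `∑ g_i ≤ 1`. Each `g_i` has a fan of domains of linearity.

A nonempty face of such a polyhedron amounts to a pair: the set `I` of the indices with `c_i =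
g_i(y)`, and a cone of the common refinement of the fans of the `g_i`, `i ∈ I`. All pairs occur
except for `I` full with the cone `{0}`, which stands for the empty face. The face has the dimension
of the cone plus `k - |I|`, so `f_j` is the sum over `I` of the numbers of cones of dimension `j - k
+ |I|` (`fVec_fanPoly`).

If `r` are the barycentric coordinates of `p`, then `P'` arises by replacing `g_i` with `r_i ∑ g_l`;
`Σ ⊕ Q` has the same form, with all coefficients positive and the gauge of `Q - q` in place of `∑
g_l`. As soon as `I` contains an `i` with `r_i > 0`, it sees in `P'` the fan of cones over the faces
of `Q`, which is the common refinement of all fans of `P`. Every cone of a coarser fan lifts to a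
cone of the same dimension in a refinement (`exists_arg_eq_flat_eq`), so the `f`-vectors compare
term by term. That `p` is a relative interior point ensures that `r_i = 0` only for linear `g_i`
(`Placement.co_pos`), where both fans are trivial. For `f_0` only the terms with `|I| ≥ k` count,
and they agree.

If the fan of `g_i` were the full refinement whenever `r_i > 0`, the face lattices of `P` and `P'`
would be isomorphic. A wild `P` thus has some `i` with `r_i > 0` and a strictly coarser fan, and the
term `I = {i}` loses a maximal cone and a wall (`exists_wall`); these count in `f_{n-1}` and
`f_{n-2}`. -/

noncomputable section

namespace SpecialSimplex

open Set Filter Topology Module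

/-! ### Faces of polyhedra in terms of tight constraints. -/

section HPolyhedra

variable {E : Type*} [AddCommGroup E] [Module ℝ E] {K : Type*}

/-- The polyhedron on which all members of a family of affine functions are nonnegative. -/
def hPoly (a : K → E →ᵃ[ℝ] ℝ) : Set E := {x | ∀ k, 0 ≤ a k x}

/-- The set of constraints that are tight at a point. -/
def act (a : K → E →ᵃ[ℝ] ℝ) (x : E) : Set K := {k | a k x = 0}

/-- The points of the polyhedron at which all constraints in `A` are tight. -/
def hFace (a : K → E →ᵃ[ℝ] ℝ) (A : Set K) : Set E := {x | x ∈ hPoly a ∧ A ⊆ act a x}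

/-- The directions along which all constraints in `A` are constant. -/
def lin (a : K → E →ᵃ[ℝ] ℝ) (A : Set K) : Submodule ℝ E where
  carrier := {w | ∀ k ∈ A, (a k).linear w = 0}
  add_mem' := fun hu hv k hk => by rw [map_add, hu k hk, hv k hk, add_zero]
  zero_mem' := fun k _ => map_zero _
  smul_mem' := fun c u hu k hk => by rw [map_smul, hu k hk, smul_zero]

theorem affine_add_smul (f : E →ᵃ[ℝ] ℝ) (x w : E) (t : ℝ) :
    f (x + t • w) = f x + t * f.linear w := by
  have := f.map_vadd x (t • w)
  simp only [vadd_eq_add, map_smul, smul_eq_mul] at this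
  rw [add_comm x, this, add_comm]

theorem affine_sub (f : E →ᵃ[ℝ] ℝ) (x y : E) : f.linear (x - y) = f x - f y := by
  have := f.linearMap_vsub x y
  simpa using this

theorem eventually_pos_add_mul {c : ℝ} (hc : 0 < c) (d : ℝ) :
    ∀ᶠ t in 𝓝[>] (0 : ℝ), 0 < c + t * d := by
  have h : Tendsto (fun t : ℝ => c + t * d) (𝓝 0) (𝓝 (c + 0 * d)) :=
    (Continuous.tendsto (by fun_prop) 0)
  rw [zero_mul, add_zero] at h
  exact (h.eventually (lt_mem_nhds hc)).filter_mono nhdsWithin_le_nhds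

variable {a : K → E →ᵃ[ℝ] ℝ}

theorem eventually_mem_hPoly [Finite K] {x w : E} (hx : x ∈ hPoly a)
    (hw : ∀ k ∈ act a x, 0 ≤ (a k).linear w) :
    ∀ᶠ t in 𝓝[>] (0 : ℝ), x + t • w ∈ hPoly a := by
  have : ∀ k, ∀ᶠ t in 𝓝[>] (0 : ℝ), 0 ≤ a k (x + t • w) := by
    intro k
    by_cases hk : k ∈ act a x
    · filter_upwards [self_mem_nhdsWithin] with t ht
      rw [affine_add_smul, show a k x = 0 from hk, zero_add]
      exact mul_nonneg (le_of_lt ht) (hw k hk)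
    · have h0 : 0 < a k x := lt_of_le_of_ne (hx k) (fun h => hk h.symm)
      filter_upwards [eventually_pos_add_mul h0 ((a k).linear w)] with t ht
      rw [affine_add_smul]
      exact ht.le
  exact (eventually_all.2 this)

theorem exists_pos_mem_hPoly [Finite K] {x w : E} (hx : x ∈ hPoly a)
    (hw : ∀ k ∈ act a x, 0 ≤ (a k).linear w) :
    ∃ t : ℝ, 0 < t ∧ x + t • w ∈ hPoly a := by
  obtain ⟨t, ht, h0⟩ := ((eventually_mem_hPoly hx hw).and self_mem_nhdsWithin).exists
  exact ⟨t, h0, ht⟩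

theorem convex_hPoly (a : K → E →ᵃ[ℝ] ℝ) : Convex ℝ (hPoly a) := by
  intro x hx y hy s t hs ht hst k
  rw [Convex.combo_affine_apply hst]
  exact add_nonneg (mul_nonneg hs (hx k)) (mul_nonneg ht (hy k))

theorem mem_hFace_act {x : E} (hx : x ∈ hPoly a) : x ∈ hFace a (act a x) := ⟨hx, subset_rfl⟩

theorem hFace_act_subset_iff {x z : E} (hx : x ∈ hPoly a) :
    hFace a (act a x) ⊆ hFace a (act a z) ↔ act a z ⊆ act a x :=
  ⟨fun h => (h (mem_hFace_act hx)).2, fun h _ hy => ⟨hy.1, h.trans hy.2⟩⟩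

theorem dim_eq_finrank {F : Set E} (h : F.Nonempty) :
    dim F = (finrank ℝ (vectorSpan ℝ F) : ℤ) := by
  rw [dim, if_neg h.ne_empty]

theorem dim_empty : dim (∅ : Set E) = -1 := by rw [dim, if_pos rfl]

/-- A direction along which the tight constraints are constant can be followed a little without
leaving the face, because slack constraints stay slack. -/
theorem dim_hFace_act [Finite K] {x : E} (hx : x ∈ hPoly a) :
    dim (hFace a (act a x)) = (finrank ℝ (lin a (act a x)) : ℤ) := by
  rw [dim_eq_finrank ⟨x, mem_hFace_act hx⟩]
  suffices h : vectorSpan ℝ (hFace a (act a x)) = lin a (act a x) by rw [h]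
  apply le_antisymm
  · rw [vectorSpan_def, Submodule.span_le]
    rintro _ ⟨y, hy, z, hz, rfl⟩ k hk
    change (a k).linear (y - z) = 0
    rw [affine_sub, show a k y = 0 from hy.2 hk, show a k z = 0 from hz.2 hk, sub_zero]
  · intro w hw
    obtain ⟨t, ht, hm⟩ := exists_pos_mem_hPoly hx (fun k hk => (hw k hk).ge)
    have h1 : x + t • w ∈ hFace a (act a x) := by
      refine ⟨hm, fun k hk => ?_⟩
      change a k _ = 0
      rw [affine_add_smul, hw k hk, show a k x = 0 from hk, mul_zero, add_zero]
    have h2 := vsub_mem_vectorSpan ℝ h1 (mem_hFace_act hx)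
    rw [vsub_eq_sub, add_sub_cancel_left] at h2
    exact (Submodule.smul_mem_iff _ ht.ne').1 h2

variable [TopologicalSpace E]

/-- Minus the sum of the constraints in `A` is, up to a constant, a linear functional; it is maximal
exactly where all of them vanish. -/
theorem hFace_mem_faces [Finite K] (hc : ∀ f : E →ₗ[ℝ] ℝ, Continuous f) (A : Set K) :
    hFace a A ∈ faces (hPoly a) := by
  classical
  have := Fintype.ofFinite K
  rintro ⟨x0, hx0⟩
  let f : E →ₗ[ℝ] ℝ := -∑ k ∈ A.toFinset, (a k).linear
  have key : ∀ x, f x = f x0 - ∑ k ∈ A.toFinset, a k x := by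
    intro x
    have : f x - f x0 = f (x - x0) := (map_sub f x x0).symm
    have h2 : f (x - x0) = - ∑ k ∈ A.toFinset, a k x := by
      simp only [f, LinearMap.neg_apply, LinearMap.sum_apply]
      congr 1
      refine Finset.sum_congr rfl fun k hk => ?_
      rw [affine_sub, show a k x0 = 0 from hx0.2 (by simpa using hk), sub_zero]
    linarith
  refine ⟨⟨f, hc f⟩, ?_⟩
  change _ = {x | x ∈ hPoly a ∧ ∀ y ∈ hPoly a, f y ≤ f x}
  ext x
  constructor
  · rintro ⟨hx, hA⟩
    refine ⟨hx, fun y hy => ?_⟩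
    rw [key x, key y, Finset.sum_eq_zero (s := A.toFinset) (f := fun k => a k x)
      (fun k hk => hA (by simpa using hk))]
    have := Finset.sum_nonneg (s := A.toFinset) (f := fun k => a k y) (fun k _ => hy k)
    linarith
  · rintro ⟨hx, hm⟩
    refine ⟨hx, fun k hk => ?_⟩
    have h1 := hm x0 hx0.1
    rw [key x] at h1
    have h2 := Finset.sum_nonneg (s := A.toFinset) (f := fun k => a k x) (fun k _ => hx k)
    have h3 := (Finset.sum_eq_zero_iff_of_nonneg (s := A.toFinset) (f := fun k => a k x)
      (fun k _ => hx k)).1 (by linarith) k (by simpa using hk)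
    exact h3

/-- A point `x` of `F` with minimal tight set works. Its midpoint with another point of `F` is tight
only where both are, which gives one inclusion. Conversely, the segment from a point `z` of `hFace a
(act a x)` to `x` can be prolonged beyond `x`, so a functional maximal at `x` cannot be smaller at
`z`. -/
theorem exists_eq_hFace_act [Finite K] {F : Set E} (hF : F ∈ faces (hPoly a)) (hne : F.Nonempty) :
    ∃ x ∈ F, x ∈ hPoly a ∧ F = hFace a (act a x) := by
  obtain ⟨l, hl⟩ := hF hne
  have hsub : F ⊆ hPoly a := fun x hx => by rw [hl] at hx; exact hx.1
  have hmax : ∀ x ∈ F, ∀ y ∈ hPoly a, l y ≤ l x := fun x hx => by rw [hl] at hx; exact hx.2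
  have hmem : ∀ x ∈ hPoly a, (∀ y ∈ hPoly a, l y ≤ l x) → x ∈ F := fun x hx h => by
    rw [hl]; exact ⟨hx, h⟩
  obtain ⟨A, ⟨⟨x, hx, rfl⟩, hmin⟩⟩ :=
    (Set.toFinite (act a '' F)).exists_minimal (hne.image _)
  refine ⟨x, hx, hsub hx, Subset.antisymm (fun z hz => ⟨hsub hz, ?_⟩) fun z hz => ?_⟩
  · have hmid : (1 / 2 : ℝ) • x + (1 / 2 : ℝ) • z ∈ F := by
      refine hmem _ (convex_hPoly a (hsub hx) (hsub hz) (by norm_num) (by norm_num) (by norm_num)) ?_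
      intro y hy
      have h1 := hmax x hx y hy
      have h2 := hmax z hz y hy
      simp only [map_add, map_smul, smul_eq_mul]
      linarith
    have hact : act a ((1 / 2 : ℝ) • x + (1 / 2 : ℝ) • z) ⊆ act a x ∩ act a z := by
      intro k hk
      have hk : a k _ = 0 := hk
      rw [Convex.combo_affine_apply (by norm_num), smul_eq_mul, smul_eq_mul] at hk
      have h1 := hsub hx k
      have h2 := hsub hz k
      exact ⟨show a k x = 0 by linarith, show a k z = 0 by linarith⟩
    exact (hmin ⟨_, hmid, rfl⟩ (hact.trans inter_subset_left)).trans (hact.trans inter_subset_right)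
  · obtain ⟨t, ht, hm⟩ := exists_pos_mem_hPoly (w := x - z) (hsub hx) (fun k hk => by
      rw [affine_sub, show a k x = 0 from hk, show a k z = 0 from hz.2 hk, sub_zero])
    have h1 := hmax x hx _ hm
    simp only [map_add, map_smul, smul_eq_mul, map_sub] at h1
    have h2 : l x ≤ l z := by nlinarith
    exact hmem z hz.1 fun y hy => (hmax x hx y hy).trans h2

theorem empty_mem_faces (P : Set E) : (∅ : Set E) ∈ faces P := fun h => absurd h (by simp)

theorem fVec_neg_one (P : Set E) : fVec P (-1) = 1 := by
  rw [fVec, Set.ncard_eq_one]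
  refine ⟨∅, ?_⟩
  ext F
  simp only [mem_ofPred_eq, mem_singleton_iff]
  constructor
  · rintro ⟨_, h⟩
    by_contra hne
    rw [dim, if_neg hne] at h
    omega
  · rintro rfl
    exact ⟨empty_mem_faces P, dim_empty⟩

theorem fVec_lt_neg_one (P : Set E) {j : ℤ} (hj : j < -1) : fVec P j = 0 := by
  rw [fVec]
  suffices h : {F | F ∈ faces P ∧ dim F = j} = ∅ by rw [h, Set.ncard_empty]
  ext F
  simp only [mem_ofPred_eq, mem_empty_iff_false, iff_false, not_and]
  intro _ h
  rw [dim] at h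
  split_ifs at h <;> omega

theorem fVec_hPoly [Finite K] (hc : ∀ f : E →ₗ[ℝ] ℝ, Continuous f) {j : ℤ} (hj : 0 ≤ j) :
    fVec (hPoly a) j =
      {A | ∃ x ∈ hPoly a, act a x = A ∧ (finrank ℝ (lin a A) : ℤ) = j}.ncard := by
  rw [fVec]
  symm
  refine Set.ncard_congr (fun A _ => hFace a A) ?_ ?_ ?_
  · rintro _ ⟨x, hx, rfl, hd⟩
    exact ⟨hFace_mem_faces hc _, (dim_hFace_act hx).trans hd⟩
  · rintro _ _ ⟨x, hx, rfl, -⟩ ⟨z, hz, rfl, -⟩ h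
    exact Subset.antisymm ((hFace_act_subset_iff hz).1 h.ge) ((hFace_act_subset_iff hx).1 h.le)
  · rintro F ⟨hF, hd⟩
    have hne : F.Nonempty := by
      by_contra h
      rw [not_nonempty_iff_eq_empty.1 h, dim_empty] at hd
      omega
    obtain ⟨x, -, hx, rfl⟩ := exists_eq_hFace_act hF hne
    exact ⟨act a x, ⟨x, hx, rfl, by rw [← dim_hFace_act hx, hd]⟩, rfl⟩

/-- Nonempty faces are ordered by reverse inclusion of tight sets. A relation between points is
enough to match faces, so no representative of a face has to be fixed. -/
theorem combEquiv_hPoly {K' : Type*} [Finite K] [Finite K'] {a' : K' → E →ᵃ[ℝ] ℝ}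
    (hc : ∀ f : E →ₗ[ℝ] ℝ, Continuous f) (R : E → E → Prop) (h1 : ∀ x ∈ hPoly a, ∃ x' ∈ hPoly a', R x x')
    (h2 : ∀ x' ∈ hPoly a', ∃ x ∈ hPoly a, R x x')
    (h3 : ∀ x ∈ hPoly a, ∀ x' ∈ hPoly a', ∀ z ∈ hPoly a, ∀ z' ∈ hPoly a', R x x' → R z z' →
      (act a x ⊆ act a z ↔ act a' x' ⊆ act a' z')) :
    CombEquiv (hPoly a) (hPoly a') := by
  let T : {F // F ∈ faces (hPoly a)} → {F // F ∈ faces (hPoly a')} → Prop := fun F F' =>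
    (F.1 = ∅ ∧ F'.1 = ∅) ∨ ∃ x ∈ hPoly a, ∃ x' ∈ hPoly a', R x x' ∧ F.1 = hFace a (act a x) ∧
      F'.1 = hFace a' (act a' x')
  have hne : ∀ {x}, x ∈ hPoly a → hFace a (act a x) ≠ ∅ := fun hx =>
    Nonempty.ne_empty ⟨_, mem_hFace_act hx⟩
  have hne' : ∀ {x}, x ∈ hPoly a' → hFace a' (act a' x) ≠ ∅ := fun hx =>
    Nonempty.ne_empty ⟨_, mem_hFace_act hx⟩
  have hT1 : ∀ F, ∃ F', T F F' := by
    rintro ⟨F, hF⟩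
    by_cases h : F.Nonempty
    · obtain ⟨x, -, hx, rfl⟩ := exists_eq_hFace_act hF h
      obtain ⟨x', hx', hR⟩ := h1 x hx
      exact ⟨⟨_, hFace_mem_faces hc (act a' x')⟩, Or.inr ⟨x, hx, x', hx', hR, rfl, rfl⟩⟩
    · exact ⟨⟨∅, empty_mem_faces _⟩, Or.inl ⟨not_nonempty_iff_eq_empty.1 h, rfl⟩⟩
  have hT2 : ∀ F', ∃ F, T F F' := by
    rintro ⟨F, hF⟩
    by_cases h : F.Nonempty
    · obtain ⟨x', -, hx', rfl⟩ := exists_eq_hFace_act hF h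
      obtain ⟨x, hx, hR⟩ := h2 x' hx'
      exact ⟨⟨_, hFace_mem_faces hc (act a x)⟩, Or.inr ⟨x, hx, x', hx', hR, rfl, rfl⟩⟩
    · exact ⟨⟨∅, empty_mem_faces _⟩, Or.inl ⟨rfl, not_nonempty_iff_eq_empty.1 h⟩⟩
  have hT3 : ∀ F F' G G', T F F' → T G G' → (F ≤ G ↔ F' ≤ G') := by
    rintro ⟨F, hF⟩ ⟨F', hF'⟩ ⟨G, hG⟩ ⟨G', hG'⟩ hFF hGG
    simp only [T] at hFF hGG
    rw [Subtype.mk_le_mk, Subtype.mk_le_mk]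
    rcases hFF with ⟨rfl, rfl⟩ | ⟨x, hx, x', hx', hR, rfl, rfl⟩
    · simp
    · rcases hGG with ⟨rfl, rfl⟩ | ⟨z, hz, z', hz', hR', rfl, rfl⟩
      · simp only [subset_empty_iff, hne hx, hne' hx']
      · rw [hFace_act_subset_iff hx, hFace_act_subset_iff hx']
        exact h3 z hz z' hz' x hx x' hx' hR' hR
  choose φ hφ using hT1
  have hφle : ∀ F G, φ F ≤ φ G ↔ F ≤ G := fun F G => (hT3 _ _ _ _ (hφ F) (hφ G)).symm
  have hφs : Function.Surjective φ := by
    intro F'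
    obtain ⟨F, hF⟩ := hT2 F'
    refine ⟨F, le_antisymm ?_ ?_⟩
    · exact (hT3 _ _ _ _ (hφ F) hF).1 le_rfl
    · exact (hT3 _ _ _ _ hF (hφ F)).1 le_rfl
  have hφi : Function.Injective φ := fun F G h =>
    le_antisymm ((hφle F G).1 h.le) ((hφle G F).1 h.ge)
  exact ⟨⟨Equiv.ofBijective φ ⟨hφi, hφs⟩, fun {F G} => hφle F G⟩⟩

end HPolyhedra

/-! ### Fans of families of linear functionals and their common refinements. -/

section Fans

variable {Y ι J : Type*} [AddCommGroup Y] [Module ℝ Y]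

/-- The members of the `i`-th family of linear functionals that are maximal at `y`. -/
def amax (g : ι → J → Y →ₗ[ℝ] ℝ) (i : ι) (y : Y) : Set J := {j | ∀ j', g i j' y ≤ g i j y}

/-- The maximal functionals at `y`, for all families with index in `I`. -/
def arg (g : ι → J → Y →ₗ[ℝ] ℝ) (I : Finset ι) (y : Y) : Set (ι × J) :=
  {s | s.1 ∈ I ∧ s.2 ∈ amax g s.1 y}

/-- The subspace on which functionals of `A` from the same family agree. -/
def flat (g : ι → J → Y →ₗ[ℝ] ℝ) (A : Set (ι × J)) : Submodule ℝ Y where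
  carrier := {u | ∀ i j j', (i, j) ∈ A → (i, j') ∈ A → g i j u = g i j' u}
  add_mem' := fun hu hv i j j' h h' => by rw [map_add, map_add, hu i j j' h h', hv i j j' h h']
  zero_mem' := fun i j j' _ _ => by rw [map_zero, map_zero]
  smul_mem' := fun c u hu i j j' h h' => by rw [map_smul, map_smul, hu i j j' h h']

/-- The cones of dimension `d` in the normal fan of the families with index in `I`. -/
def cells (g : ι → J → Y →ₗ[ℝ] ℝ) (I : Finset ι) (d : ℤ) : Set (Set (ι × J)) :=
  {A | ∃ y, A = arg g I y ∧ (finrank ℝ (flat g A) : ℤ) = d}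

variable {g : ι → J → Y →ₗ[ℝ] ℝ}

theorem flat_anti {A B : Set (ι × J)} (h : A ⊆ B) : flat g B ≤ flat g A :=
  fun _ hu i j j' hj hj' => hu i j j' (h hj) (h hj')

theorem amax_eq_of_mem {i : ι} {y : Y} {j j' : J} (hj : j ∈ amax g i y) (hj' : j' ∈ amax g i y) :
    g i j y = g i j' y := le_antisymm (hj' j) (hj j')

theorem mem_amax_of_le {i : ι} {y : Y} {j j' : J} (hj : j ∈ amax g i y) (h : g i j y ≤ g i j' y) :
    j' ∈ amax g i y := fun l => (hj l).trans h

theorem self_mem_flat (I : Finset ι) (y : Y) : y ∈ flat g (arg g I y) :=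
  fun _ _ _ h h' => amax_eq_of_mem h.2 h'.2

theorem amax_nonempty [Finite J] [Nonempty J] (g : ι → J → Y →ₗ[ℝ] ℝ) (i : ι) (y : Y) :
    (amax g i y).Nonempty := Finite.exists_max fun j => g i j y

theorem amax_smul {t : ℝ} (ht : 0 < t) (i : ι) (y : Y) : amax g i (t • y) = amax g i y := by
  ext j
  refine forall_congr' fun j' => ?_
  simp only [map_smul, smul_eq_mul]
  exact mul_le_mul_iff_right₀ ht

theorem arg_smul {t : ℝ} (ht : 0 < t) (I : Finset ι) (y : Y) : arg g I (t • y) = arg g I y := by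
  ext s; simp only [arg, amax_smul ht]

/-- The members of `amax g i y` that are maximal in the direction `w`. -/
def locMax (g : ι → J → Y →ₗ[ℝ] ℝ) (i : ι) (y w : Y) : Set J :=
  {j | j ∈ amax g i y ∧ ∀ j' ∈ amax g i y, g i j' w ≤ g i j w}

/-- For small `t`, functionals that are not maximal at `y` stay so, and among the maximal ones the
direction `w` breaks the ties. All perturbation arguments below rest on this. -/
theorem eventually_amax_add [Finite ι] [Finite J] (g : ι → J → Y →ₗ[ℝ] ℝ) (y w : Y) :
    ∀ᶠ t in 𝓝[>] (0 : ℝ), ∀ i, amax g i (y + t • w) = locMax g i y w := by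
  have h : ∀ i j j', ∀ᶠ t in 𝓝[>] (0 : ℝ), g i j' y < g i j y →
      g i j' (y + t • w) < g i j (y + t • w) := by
    intro i j j'
    by_cases hlt : g i j' y < g i j y
    · filter_upwards [eventually_pos_add_mul (sub_pos.2 hlt) (g i j w - g i j' w)] with t ht _
      simp only [map_add, map_smul, smul_eq_mul]
      linarith
    · exact Eventually.of_forall fun t h => absurd h hlt
  filter_upwards [eventually_all.2 fun i => eventually_all.2 fun j => eventually_all.2 (h i j),
    self_mem_nhdsWithin] with t ht (h0 : 0 < t) i
  have hval : ∀ j, g i j (y + t • w) = g i j y + t * g i j w := fun j => by simp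
  ext j
  constructor
  · intro hj
    have h1 : j ∈ amax g i y := by
      intro j'
      by_contra! hlt
      exact absurd (hj j') (not_le.2 (ht i j' j hlt))
    refine ⟨h1, fun j' hj' => ?_⟩
    have h2 := hj j'
    rw [hval, hval, amax_eq_of_mem h1 hj'] at h2
    exact le_of_mul_le_mul_left (by linarith) h0
  · rintro ⟨h1, h2⟩ j'
    by_cases hj' : j' ∈ amax g i y
    · rw [hval, hval, amax_eq_of_mem h1 hj']
      have := mul_le_mul_of_nonneg_left (h2 j' hj') h0.le
      linarith
    · refine (ht i j j' (lt_of_not_ge fun h => hj' (mem_amax_of_le h1 h))).le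

theorem locMax_subset (i : ι) (y w : Y) : locMax g i y w ⊆ amax g i y := fun _ h => h.1

theorem locMax_eq_amax {i : ι} {y w : Y}
    (h : ∀ j ∈ amax g i y, ∀ j' ∈ amax g i y, g i j w = g i j' w) :
    locMax g i y w = amax g i y :=
  Subset.antisymm (locMax_subset i y w) fun j hj => ⟨hj, fun j' hj' => (h j' hj' j hj).le⟩

/-- The part of `A` that belongs to the families with index in `I`. -/
def restr (I : Finset ι) (A : Set (ι × J)) : Set (ι × J) := {s | s.1 ∈ I ∧ s ∈ A}

variable [Fintype ι]

theorem restr_arg (I : Finset ι) (y : Y) : restr I (arg g Finset.univ y) = arg g I y := by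
  ext s; simp [restr, arg]

theorem arg_subset_univ (I : Finset ι) (y : Y) : arg g I y ⊆ arg g Finset.univ y :=
  fun _ hs => ⟨Finset.mem_univ _, hs.2⟩

/-- A generic point `z` of the cell of `y` works: one whose maximal sets, for all families together,
are minimal. A direction in the flat of the cell does not leave it, so by minimality it breaks no
tie of any other family either. -/
theorem exists_arg_eq_flat_eq [Finite J] (I : Finset ι) (y : Y) :
    ∃ z, arg g I z = arg g I y ∧ flat g (arg g Finset.univ z) = flat g (arg g I y) := by
  obtain ⟨A, ⟨⟨z, hz, rfl⟩, hmin⟩⟩ := (Set.toFinite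
    (arg g Finset.univ '' {z | arg g I z = arg g I y})).exists_minimal ⟨_, y, rfl, rfl⟩
  have hz : arg g I z = arg g I y := hz
  refine ⟨z, hz, le_antisymm ?_ fun u hu => ?_⟩
  · rw [← hz]; exact flat_anti (arg_subset_univ I z)
  rw [← hz] at hu
  obtain ⟨t, ht⟩ := (eventually_amax_add g z u).exists
  have h1 : arg g I (z + t • u) = arg g I z := by
    ext ⟨i, j⟩
    refine and_congr_right fun hi => ?_
    change i ∈ I at hi
    change j ∈ amax g i _ ↔ j ∈ amax g i z
    rw [ht i, locMax_eq_amax]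
    exact fun j hj j' hj' => hu i j j' ⟨hi, hj⟩ ⟨hi, hj'⟩
  have h2 : arg g Finset.univ z ⊆ arg g Finset.univ (z + t • u) := by
    refine hmin ⟨_, h1.trans hz, rfl⟩ ?_
    rintro ⟨i, j⟩ ⟨hi, hj⟩
    refine ⟨hi, ?_⟩
    change j ∈ amax g i _ at hj
    rw [ht i] at hj
    exact hj.1
  intro i j j' hj hj'
  have h3 := (h2 hj).2
  have h4 := (h2 hj').2
  change j ∈ amax g i _ at h3
  change j' ∈ amax g i _ at h4
  rw [ht i] at h3 h4
  exact le_antisymm (h4.2 j h3.1) (h3.2 j' h4.1)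

theorem cells_subset_image_restr [Finite J] (I : Finset ι) (d : ℤ) :
    cells g I d ⊆ restr I '' cells g Finset.univ d := by
  rintro _ ⟨y, rfl, hd⟩
  obtain ⟨z, h1, h2⟩ := exists_arg_eq_flat_eq (g := g) I y
  exact ⟨_, ⟨z, rfl, by rw [h2, hd]⟩, by rw [restr_arg, h1]⟩

theorem ncard_cells_le [Finite J] (I : Finset ι) (d : ℤ) :
    (cells g I d).ncard ≤ (cells g Finset.univ d).ncard :=
  (Set.ncard_le_ncard (cells_subset_image_restr I d) (Set.toFinite _)).trans
    (Set.ncard_image_le (Set.toFinite _))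

/-- Restriction maps the cells of the refinement onto those for `I`; the count drops if the cell of
`z` is dispensable. In the next two lemmas it is, because its restriction has the wrong dimension or
is shared by another cell. -/
theorem ncard_cells_lt_of_subset [Finite J] {I : Finset ι} {d : ℤ} {z : Y}
    (hz : (finrank ℝ (flat g (arg g Finset.univ z)) : ℤ) = d)
    (h : cells g I d ⊆ restr I '' (cells g Finset.univ d \ {arg g Finset.univ z})) :
    (cells g I d).ncard < (cells g Finset.univ d).ncard :=
  ((Set.ncard_le_ncard h (Set.toFinite _)).trans (Set.ncard_image_le (Set.toFinite _))).trans_lt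
    (Set.ncard_sdiff_singleton_lt_of_mem ⟨z, rfl, hz⟩ (Set.toFinite _))

theorem ncard_cells_lt_of_finrank_ne [Finite J] {I : Finset ι} {d : ℤ} {z : Y}
    (hz : (finrank ℝ (flat g (arg g Finset.univ z)) : ℤ) = d)
    (hI : (finrank ℝ (flat g (arg g I z)) : ℤ) ≠ d) :
    (cells g I d).ncard < (cells g Finset.univ d).ncard := by
  refine ncard_cells_lt_of_subset hz fun A hA => ?_
  obtain ⟨B, hB, rfl⟩ := cells_subset_image_restr I d hA
  refine ⟨B, ⟨hB, ?_⟩, rfl⟩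
  rintro rfl
  obtain ⟨y, -, hy⟩ := hA
  rw [restr_arg] at hy
  exact hI hy

theorem ncard_cells_lt_of_arg_ne [Finite J] {I : Finset ι} {d : ℤ} {z z' : Y}
    (hz : (finrank ℝ (flat g (arg g Finset.univ z)) : ℤ) = d)
    (hz' : (finrank ℝ (flat g (arg g Finset.univ z')) : ℤ) = d)
    (hI : arg g I z = arg g I z') (hne : arg g Finset.univ z ≠ arg g Finset.univ z') :
    (cells g I d).ncard < (cells g Finset.univ d).ncard := by
  refine ncard_cells_lt_of_subset hz fun A hA => ?_
  obtain ⟨B, hB, rfl⟩ := cells_subset_image_restr I d hA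
  by_cases h : B = arg g Finset.univ z
  · exact ⟨_, ⟨⟨z', rfl, hz'⟩, hne.symm⟩, by rw [h, restr_arg, restr_arg, hI]⟩
  · exact ⟨B, ⟨hB, h⟩, rfl⟩

omit [Fintype ι] in
-- Choose `w₁` outside the kernels of all nonzero differences. Then `w₀ + t • w₁` meets each kernel
-- for at most one `t`, hence none for small `t > 0`.
theorem exists_eventually_generic [Finite ι] [Finite J] (g : ι → J → Y →ₗ[ℝ] ℝ) (w₀ : Y) :
    ∃ w₁, ∀ᶠ t in 𝓝[>] (0 : ℝ), ∀ i j j',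
      g i j (w₀ + t • w₁) = g i j' (w₀ + t • w₁) → g i j = g i j' := by
  classical
  have := Fintype.ofFinite ι
  have := Fintype.ofFinite J
  let S : Finset (Subspace ℝ Y) := (Finset.univ.filter fun s : ι × J × J =>
    g s.1 s.2.1 ≠ g s.1 s.2.2).image fun s => LinearMap.ker (g s.1 s.2.1 - g s.1 s.2.2)
  have hS : ⊤ ∉ S := by
    intro h
    obtain ⟨s, hs, hk⟩ := Finset.mem_image.1 h
    exact (Finset.mem_filter.1 hs).2 (sub_eq_zero.1 (LinearMap.ker_eq_top.1 hk))
  obtain ⟨w₁, hw₁⟩ := (ne_univ_iff_exists_notMem _).1 (Subspace.biUnion_ne_univ_of_top_notMem hS)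
  have hgen : ∀ i j j', g i j ≠ g i j' → g i j w₁ - g i j' w₁ ≠ 0 := by
    intro i j j' hne h0
    refine hw₁ (mem_biUnion (x := LinearMap.ker (g i j - g i j')) ?_ ?_)
    · exact Finset.mem_image.2 ⟨(i, j, j'), Finset.mem_filter.2 ⟨Finset.mem_univ _, hne⟩, rfl⟩
    · exact LinearMap.mem_ker.2 h0
  refine ⟨w₁, eventually_all.2 fun i => eventually_all.2 fun j => eventually_all.2 fun j' => ?_⟩
  by_cases hne : g i j = g i j'
  · exact Eventually.of_forall fun _ _ => hne
  have hval : ∀ t : ℝ, g i j (w₀ + t • w₁) = g i j' (w₀ + t • w₁) →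
      (g i j w₀ - g i j' w₀) + t * (g i j w₁ - g i j' w₁) = 0 := fun t h => by
    simp only [map_add, map_smul, smul_eq_mul] at h
    linarith
  rcases lt_trichotomy (g i j w₀ - g i j' w₀) 0 with h | h | h
  · filter_upwards [eventually_pos_add_mul (neg_pos.2 h) (-(g i j w₁ - g i j' w₁))] with t ht he
    have := hval t he
    linarith
  · filter_upwards [self_mem_nhdsWithin] with t (ht : 0 < t) he
    have := hval t he
    rw [h, zero_add, mul_eq_zero] at this
    exact absurd this (not_or.2 ⟨ht.ne', hgen i j j' hne⟩)
  · filter_upwards [eventually_pos_add_mul h (g i j w₁ - g i j' w₁)] with t ht he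
    have := hval t he
    linarith

/-- Two points in the same cell for `i` but in different cells for `l` can be moved into the
interiors of different maximal cells, without leaving the same cell for `i`. -/
theorem exists_generic_pair [Finite J] [Nonempty J] {i l : ι} {y y' : Y} {j : J}
    (hi : amax g i y = amax g i y') (hj : j ∈ amax g l y) (hj' : j ∉ amax g l y') :
    ∃ a b, amax g i a = amax g i b ∧ arg g Finset.univ a ≠ arg g Finset.univ b ∧
      flat g (arg g Finset.univ a) = ⊤ ∧ flat g (arg g Finset.univ b) = ⊤ := by
  -- At `y'` the functional `j` is strictly below the maximal ones, so in directions near `-y'` it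
  -- beats all of them. Both points are moved in the same such direction.
  obtain ⟨w₁, hw₁⟩ := exists_eventually_generic g (-y')
  have hev : ∀ j', ∀ᶠ t in 𝓝[>] (0 : ℝ), j' ∈ amax g l y' →
      g l j' (-y' + t • w₁) < g l j (-y' + t • w₁) := by
    intro j'
    by_cases h : j' ∈ amax g l y'
    · have hlt : 0 < g l j' y' - g l j y' :=
        sub_pos.2 (lt_of_not_ge fun hle => hj' (mem_amax_of_le h hle))
      filter_upwards [eventually_pos_add_mul hlt (g l j w₁ - g l j' w₁)] with t ht _
      simp only [map_add, map_smul, map_neg, smul_eq_mul]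
      linarith
    · exact Eventually.of_forall fun t h' => absurd h' h
  obtain ⟨t, hgen, hlt⟩ := (hw₁.and (eventually_all.2 hev)).exists
  set w := -y' + t • w₁
  obtain ⟨s, h1, h2⟩ := ((eventually_amax_add g y w).and (eventually_amax_add g y' w)).exists
  have hflat : ∀ x, (∀ i, amax g i (x + s • w) = locMax g i x w) →
      flat g (arg g Finset.univ (x + s • w)) = ⊤ := by
    intro x hx
    rw [eq_top_iff]
    rintro u - m p q ⟨-, hp⟩ ⟨-, hq⟩
    change p ∈ amax g m _ at hp
    change q ∈ amax g m _ at hq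
    rw [hx] at hp hq
    rw [hgen m p q (le_antisymm (hq.2 p hp.1) (hp.2 q hq.1))]
  refine ⟨y + s • w, y' + s • w, ?_, fun h => ?_, hflat y h1, hflat y' h2⟩
  · rw [h1, h2, locMax, locMax, hi]
  -- A functional `q` maximal near both points would be at least `j` in the direction `w`, as `j` is
  -- maximal at `y`, and less than `j`, as `q` is maximal at `y'`.
  · obtain ⟨q, hq⟩ := amax_nonempty g l (y + s • w)
    have hq' : (l, q) ∈ arg g Finset.univ (y' + s • w) := h ▸ ⟨Finset.mem_univ _, hq⟩
    have hq' : q ∈ amax g l (y' + s • w) := hq'.2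
    rw [h1] at hq
    rw [h2] at hq'
    exact absurd (hq.2 j hj) (not_le.2 (hlt q hq'.1))

omit [Fintype ι] in
/-- If the maximal functional is unique at all points of a segment, then it is constant. -/
theorem eq_of_unique_max_segment {M : Type*} [Finite M] (f : M → Y →ₗ[ℝ] ℝ) {x y : Y}
    (h : ∀ t ∈ Icc (0 : ℝ) 1, ∀ m m', (∀ q, f q (x + t • (y - x)) ≤ f m (x + t • (y - x))) →
      (∀ q, f q (x + t • (y - x)) ≤ f m' (x + t • (y - x))) → f m = f m')
    {m m' : M} (hm : ∀ q, f q x ≤ f m x) (hm' : ∀ q, f q y ≤ f m' y) : f m = f m' := by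
  have : Nonempty M := ⟨m⟩
  -- The closed sets `C p` with `f p = f m` and those with `f p ≠ f m` would separate the connected
  -- segment.
  let C : M → Set ℝ := fun p => {t | ∀ q, f q (x + t • (y - x)) ≤ f p (x + t • (y - x))}
  have hC : ∀ p, IsClosed (C p) := by
    intro p
    simp only [C, ofPred_forall, map_add, map_smul, smul_eq_mul]
    exact isClosed_iInter fun q => isClosed_le (by fun_prop) (by fun_prop)
  have h0 : (0 : ℝ) ∈ C m := by simpa [C] using hm
  have h1 : (1 : ℝ) ∈ C m' := by simpa [C] using hm'
  have hcover : Icc (0 : ℝ) 1 ⊆ (⋃ p ∈ {p | f p = f m}, C p) ∪ ⋃ p ∈ {p | f p ≠ f m}, C p := by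
    intro t _
    obtain ⟨p, hp⟩ := Finite.exists_max fun q => f q (x + t • (y - x))
    by_cases hpm : f p = f m
    · exact Or.inl (mem_biUnion (show p ∈ {p | f p = f m} from hpm) hp)
    · exact Or.inr (mem_biUnion (show p ∈ {p | f p ≠ f m} from hpm) hp)
  have hdisj : Icc (0 : ℝ) 1 ∩ ((⋃ p ∈ {p | f p = f m}, C p) ∩ ⋃ p ∈ {p | f p ≠ f m}, C p) = ∅ := by
    rw [eq_empty_iff_forall_notMem]
    rintro t ⟨ht, hU, hV⟩
    obtain ⟨p, hp, hp1⟩ := mem_iUnion₂.1 hU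
    obtain ⟨q, hq, hq1⟩ := mem_iUnion₂.1 hV
    exact hq ((h t ht q p hq1 hp1).trans hp)
  rcases isPreconnected_iff_subset_of_disjoint_closed.1 (isPreconnected_Icc (a := (0 : ℝ)) (b := 1))
    _ _ ((Set.toFinite _).isClosed_biUnion fun p _ => hC p)
    ((Set.toFinite _).isClosed_biUnion fun p _ => hC p) hcover hdisj with hU | hV
  · obtain ⟨p, hp, hp1⟩ := mem_iUnion₂.1 (hU (right_mem_Icc.2 zero_le_one))
    rw [← show f p = f m from hp]
    exact h 1 (right_mem_Icc.2 zero_le_one) p m' hp1 h1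
  · obtain ⟨p, hp, hp1⟩ := mem_iUnion₂.1 (hV (left_mem_Icc.2 zero_le_one))
    exact absurd (h 0 (left_mem_Icc.2 zero_le_one) p m hp1 h0) hp

/-- Where the flat is everything, each family has a unique maximal functional. If this held along
the segment, that functional would be constant, and the ends would lie in the same cell. -/
theorem exists_segment_flat_ne_top [Finite J] [Nonempty J] {a b : Y}
    (hab : arg g Finset.univ a ≠ arg g Finset.univ b) :
    ∃ t ∈ Icc (0 : ℝ) 1, flat g (arg g Finset.univ (a + t • (b - a))) ≠ ⊤ := by
  by_contra! h
  have key : ∀ i j j', j ∈ amax g i a → j' ∈ amax g i b → g i j = g i j' := by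
    intro i j j' hj hj'
    refine eq_of_unique_max_segment (g i) (fun t ht m m' hm hm' => ?_) hj hj'
    ext u
    have hu : u ∈ flat g (arg g Finset.univ (a + t • (b - a))) := by
      rw [h t ht]; exact Submodule.mem_top
    exact hu i m m' ⟨Finset.mem_univ _, hm⟩ ⟨Finset.mem_univ _, hm'⟩
  apply hab
  ext ⟨i, j⟩
  obtain ⟨p, hp⟩ := amax_nonempty g i a
  obtain ⟨q, hq⟩ := amax_nonempty g i b
  refine and_congr_right fun _ => ⟨fun hj => ?_, fun hj => ?_⟩
  · have e : g i j = g i q := key i j q hj hq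
    exact mem_amax_of_le hq (by rw [← e])
  · have e : g i p = g i j := key i p j hp hj
    exact mem_amax_of_le hp (by rw [e])

omit [Fintype ι] in
theorem amax_segment {i : ι} {a b : Y} [Finite J] [Nonempty J] (h : amax g i a = amax g i b) {t : ℝ}
    (ht : t ∈ Icc (0 : ℝ) 1) : amax g i (a + t • (b - a)) = amax g i a := by
  obtain ⟨p, hp⟩ := amax_nonempty g i a
  have hp' : p ∈ amax g i b := h ▸ hp
  have hval : ∀ j, g i j (a + t • (b - a)) = (1 - t) * g i j a + t * g i j b := fun j => by
    simp only [map_add, map_smul, map_sub, smul_eq_mul]; ring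
  ext j
  constructor
  · intro hj
    have h1 := hj p
    rw [hval, hval] at h1
    have h2 := hp j
    have h3 := hp' j
    rcases ht.2.eq_or_lt with rfl | ht1
    · rw [h]
      exact mem_amax_of_le hp' (by linarith)
    · refine mem_amax_of_le hp ?_
      have h4 := mul_le_mul_of_nonneg_left h3 ht.1
      exact le_of_mul_le_mul_left (by linarith) (sub_pos.2 ht1)
  · intro hj j'
    rw [hval, hval]
    have hj2 : j ∈ amax g i b := h ▸ hj
    have h4 := mul_le_mul_of_nonneg_left (hj2 j') ht.1
    have h5 := mul_le_mul_of_nonneg_left (hj j') (sub_nonneg.2 ht.2)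
    linarith

/-- The segment from `a` to `b` stays in one full-dimensional cell for `i`, but meets a smaller cell
of the refinement. Among all points of this cell for `i` that lie in smaller cells of the
refinement, take `z` with minimal maximal sets: every direction off its flat `L` leads into a
full-dimensional cell. If `L` had codimension at least two, some `w ∉ L` could be turned into `-w`
while avoiding `L`. The same functionals would then be maximal in both directions, which forces `w ∈
L`. -/
theorem exists_wall [Finite J] [Nonempty J] [FiniteDimensional ℝ Y] {i : ι} {a b : Y}
    (hi : amax g i a = amax g i b) (hab : arg g Finset.univ a ≠ arg g Finset.univ b)
    (ha : flat g (arg g Finset.univ a) = ⊤) :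
    ∃ z, flat g (arg g {i} z) = ⊤ ∧
      (finrank ℝ (flat g (arg g Finset.univ z)) : ℤ) = finrank ℝ Y - 1 := by
  obtain ⟨t, ht, hne⟩ := exists_segment_flat_ne_top hab
  obtain ⟨A, ⟨⟨z, ⟨hzi, hz⟩, rfl⟩, hmin⟩⟩ := (Set.toFinite (arg g Finset.univ ''
    {z | amax g i z = amax g i a ∧ flat g (arg g Finset.univ z) ≠ ⊤})).exists_minimal
    ⟨_, _, ⟨amax_segment hi ht, hne⟩, rfl⟩
  have hia : ∀ j ∈ amax g i a, ∀ j' ∈ amax g i a, g i j = g i j' := by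
    intro j hj j' hj'
    ext u
    have hu : u ∈ flat g (arg g Finset.univ a) := by rw [ha]; exact Submodule.mem_top
    exact hu i j j' ⟨Finset.mem_univ _, hj⟩ ⟨Finset.mem_univ _, hj'⟩
  refine ⟨z, ?_, ?_⟩
  · rw [eq_top_iff]
    rintro u - m j j' ⟨hm, hj⟩ ⟨-, hj'⟩
    obtain rfl := Finset.mem_singleton.1 hm
    change j ∈ amax g m z at hj
    change j' ∈ amax g m z at hj'
    rw [hzi] at hj hj'
    rw [hia j hj j' hj']
  set L := flat g (arg g Finset.univ z) with hL
  have hloc : ∀ w ∉ L, ∀ l, ∀ j ∈ locMax g l z w, ∀ j' ∈ locMax g l z w, g l j = g l j' := by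
    intro w hw l j hj j' hj'
    obtain ⟨s, hs⟩ := (eventually_amax_add g z w).exists
    have htop : flat g (arg g Finset.univ (z + s • w)) = ⊤ := by
      by_contra hcon
      have h1 : amax g i (z + s • w) = amax g i a := by
        rw [hs, locMax_eq_amax, hzi]
        intro p hp q hq
        rw [hzi] at hp hq
        rw [hia p hp q hq]
      have h2 : arg g Finset.univ z ⊆ arg g Finset.univ (z + s • w) := by
        refine hmin ⟨_, ⟨h1, hcon⟩, rfl⟩ ?_
        rintro ⟨m, p⟩ ⟨hm, hp⟩
        change p ∈ amax g m _ at hp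
        rw [hs] at hp
        exact ⟨hm, hp.1⟩
      apply hw
      intro m p q hp hq
      have h3 : p ∈ amax g m _ := (h2 hp).2
      have h4 : q ∈ amax g m _ := (h2 hq).2
      rw [hs] at h3 h4
      exact le_antisymm (h4.2 p h3.1) (h3.2 q h4.1)
    ext u
    have hu : u ∈ flat g (arg g Finset.univ (z + s • w)) := by rw [htop]; exact Submodule.mem_top
    refine hu l j j' ⟨Finset.mem_univ _, ?_⟩ ⟨Finset.mem_univ _, ?_⟩
    · change j ∈ amax g l _
      rwa [hs]
    · change j' ∈ amax g l _
      rwa [hs]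
  obtain ⟨w, -, hw⟩ := SetLike.exists_of_lt (lt_top_iff_ne_top.2 hz)
  by_cases htop : L ⊔ Submodule.span ℝ {w} = ⊤
  · have h1 := Submodule.finrank_add_le_finrank_add_finrank L (Submodule.span ℝ {w})
    have h2 := finrank_span_le_card (R := ℝ) ({w} : Set Y)
    rw [htop, finrank_top] at h1
    have h3 := Submodule.finrank_lt hz
    simp only [toFinset_singleton, Finset.card_singleton] at h2
    omega
  obtain ⟨w', -, hw'⟩ := SetLike.exists_of_lt (lt_top_iff_ne_top.2 htop)
  exfalso
  -- Since `w` and `w'` are independent modulo `L`, the path from `w` through `w'` to `-w` avoids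
  -- `L`.
  have hcomb : ∀ c d : ℝ, (c ≠ 0 ∨ d ≠ 0) → c • w + d • w' ∉ L := by
    intro c d hcd hmem
    by_cases hd : d = 0
    · rw [hd, zero_smul, add_zero, Submodule.smul_mem_iff _ (by tauto)] at hmem
      exact hw hmem
    · apply hw'
      rw [← Submodule.smul_mem_iff _ hd]
      have : d • w' = (c • w + d • w') - c • w := by abel
      rw [this]
      exact Submodule.sub_mem _ (Submodule.mem_sup_left hmem)
        (Submodule.smul_mem _ _ (Submodule.mem_sup_right (Submodule.mem_span_singleton_self w)))
  have hpath : ∀ l x y, (∀ t ∈ Icc (0 : ℝ) 1, x + t • (y - x) ∉ L) →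
      ∀ j ∈ locMax g l z x, ∀ j' ∈ locMax g l z y, g l j = g l j' := by
    intro l x y hxy j hj j' hj'
    refine eq_of_unique_max_segment (M := amax g l z) (fun q => g l q) (m := ⟨j, hj.1⟩)
      (m' := ⟨j', hj'.1⟩) (fun t ht p q hp hq => ?_) (fun q => hj.2 q q.2) (fun q => hj'.2 q q.2)
    exact hloc _ (hxy t ht) l p ⟨p.2, fun r hr => hp ⟨r, hr⟩⟩ q ⟨q.2, fun r hr => hq ⟨r, hr⟩⟩
  apply hw
  intro l p q hp hq
  have hex : ∀ x, (locMax g l z x).Nonempty := by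
    intro x
    have : Nonempty (amax g l z) := ⟨⟨p, hp.2⟩⟩
    obtain ⟨r, hr⟩ := Finite.exists_max fun r : amax g l z => g l r x
    exact ⟨r, r.2, fun j' hj' => hr ⟨j', hj'⟩⟩
  obtain ⟨r₁, h1⟩ := hex w
  obtain ⟨r₂, h2⟩ := hex w'
  obtain ⟨r₃, h3⟩ := hex (-w)
  have e1 : g l r₁ = g l r₂ := by
    refine hpath l w w' (fun t ht => ?_) r₁ h1 r₂ h2
    have : w + t • (w' - w) = (1 - t) • w + t • w' := by module
    rw [this]
    refine hcomb _ _ ?_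
    by_contra! hcon
    linarith [hcon.1, hcon.2]
  have e2 : g l r₂ = g l r₃ := by
    refine hpath l w' (-w) (fun t ht => ?_) r₂ h2 r₃ h3
    have : w' + t • (-w - w') = (-t) • w + (1 - t) • w' := by module
    rw [this]
    refine hcomb _ _ ?_
    by_contra! hcon
    linarith [hcon.1, hcon.2]
  -- The functional of `r₁` is the largest both at `w` and at `-w`, so all functionals maximal at
  -- `z` agree on `w`.
  have hle : ∀ r ∈ amax g l z, g l r w = g l r₁ w := by
    intro r hr
    have h4 := h1.2 r hr
    have h5 := h3.2 r hr
    rw [← e2, ← e1, map_neg, map_neg] at h5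
    linarith
  rw [hle p hp.2, hle q hq.2]

theorem ncard_cells_singleton_lt [Finite J] [Nonempty J] [FiniteDimensional ℝ Y] {i l : ι}
    {y y' : Y} {j : J} (hi : amax g i y = amax g i y') (hj : j ∈ amax g l y)
    (hj' : j ∉ amax g l y') {d : ℤ} (hd : d = finrank ℝ Y ∨ d = finrank ℝ Y - 1) :
    (cells g {i} d).ncard < (cells g Finset.univ d).ncard := by
  obtain ⟨a, b, hab, hne, ha, hb⟩ := exists_generic_pair hi hj hj'
  have hI : arg g {i} a = arg g {i} b := by
    ext ⟨m, p⟩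
    refine and_congr_right fun hm => ?_
    obtain rfl := Finset.mem_singleton.1 hm
    change p ∈ amax g _ _ ↔ p ∈ amax g _ _
    rw [hab]
  rcases hd with rfl | rfl
  · exact ncard_cells_lt_of_arg_ne (z := a) (z' := b) (by rw [ha, finrank_top])
      (by rw [hb, finrank_top]) hI hne
  · obtain ⟨z, h1, h2⟩ := exists_wall hab hne ha
    refine ncard_cells_lt_of_finrank_ne h2 ?_
    rw [h1, finrank_top]
    omega

end Fans

/-! ### Fan polyhedra: their faces, dimensions and `f`-vectors. -/

section Frames

variable {E Y ι J : Type*} [AddCommGroup E] [Module ℝ E] [AddCommGroup Y] [Module ℝ Y]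
  [Fintype ι]

/-- Affine coordinates that identify `E` with the product of the hyperplane `∑ cᵢ = 1` of `ι → ℝ`
and `Y`. -/
structure Frame (ι E Y : Type*) [AddCommGroup E] [Module ℝ E] [AddCommGroup Y] [Module ℝ Y]
    [Fintype ι] where
  /-- The coordinates in the hyperplane. -/
  co : ι → E →ᵃ[ℝ] ℝ
  /-- The coordinate in `Y`. -/
  pr : E →ᵃ[ℝ] Y
  sum_co : ∀ x, ∑ i, co i x = 1
  inj : ∀ x x', (∀ i, co i x = co i x') → pr x = pr x' → x = x'
  surj : ∀ (c : ι → ℝ) (y : Y), ∑ i, c i = 1 → ∃ x, (∀ i, co i x = c i) ∧ pr x = y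

theorem frame_pr_linear (F : Frame ι E Y) (x z : E) : F.pr.linear (x - z) = F.pr x - F.pr z := by
  have := F.pr.linearMap_vsub x z
  simpa using this

theorem frame_sum_linear (F : Frame ι E Y) (w : E) : ∑ i, (F.co i).linear w = 0 := by
  have h1 := F.sum_co ((0 : E) + (1 : ℝ) • w)
  simp only [affine_add_smul, one_mul, Finset.sum_add_distrib, F.sum_co] at h1
  linarith

theorem frame_linear_inj (F : Frame ι E Y) {w : E} (h : ∀ i, (F.co i).linear w = 0)
    (h' : F.pr.linear w = 0) : w = 0 := by
  have hz : ∀ f : E →ᵃ[ℝ] ℝ, f w = f 0 + f.linear w := fun f => by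
    have := affine_add_smul f 0 w 1
    simpa using this
  refine F.inj w 0 (fun i => by rw [hz, h, add_zero]) ?_
  have := frame_pr_linear F w 0
  rw [sub_zero, h'] at this
  exact (sub_eq_zero.1 this.symm)

theorem frame_linear_surj [Nonempty ι] (F : Frame ι E Y) (c : ι → ℝ) (y : Y) (hc : ∑ i, c i = 0) :
    ∃ w, (∀ i, (F.co i).linear w = c i) ∧ F.pr.linear w = y := by
  obtain ⟨x, hx, hx'⟩ := F.surj (fun i => F.co i 0 + c i) (F.pr 0 + y) (by
    rw [Finset.sum_add_distrib, F.sum_co, hc, add_zero])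
  refine ⟨x, fun i => ?_, ?_⟩
  · have := affine_sub (F.co i) x 0
    rw [sub_zero] at this
    rw [this, hx, add_sub_cancel_left]
  · have := frame_pr_linear F x 0
    rw [sub_zero] at this
    rw [this, hx', add_sub_cancel_left]

/-- The affine functions `cᵢ - gᵢⱼ(y)` in the coordinates of a frame. -/
def fanAff (F : Frame ι E Y) (g : ι → J → Y →ₗ[ℝ] ℝ) (s : ι × J) : E →ᵃ[ℝ] ℝ :=
  F.co s.1 - (g s.1 s.2).toAffineMap.comp F.pr

/-- The polyhedron of all `(c, y)` with `cᵢ ≥ gᵢⱼ(y)` for all `i` and `j`. -/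
def fanPoly (F : Frame ι E Y) (g : ι → J → Y →ₗ[ℝ] ℝ) : Set E := hPoly (fanAff F g)

variable {F : Frame ι E Y} {g : ι → J → Y →ₗ[ℝ] ℝ}

theorem fanAff_apply (s : ι × J) (x : E) : fanAff F g s x = F.co s.1 x - g s.1 s.2 (F.pr x) := rfl

theorem fanAff_linear (s : ι × J) (w : E) :
    (fanAff F g s).linear w = (F.co s.1).linear w - g s.1 s.2 (F.pr.linear w) := rfl

theorem mem_fanPoly {x : E} : x ∈ fanPoly F g ↔ ∀ i j, g i j (F.pr x) ≤ F.co i x := by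
  constructor
  · intro h i j
    have := h (i, j)
    rw [fanAff_apply] at this
    exact sub_nonneg.1 this
  · intro h s
    rw [fanAff_apply]
    exact sub_nonneg.2 (h _ _)

/-- The sum of the maxima of the families is positive away from the origin. -/
def FanPos (g : ι → J → Y →ₗ[ℝ] ℝ) : Prop := ∀ y ≠ 0, ∃ m : ι → J, 0 < ∑ i, g i (m i) y

open Classical in
/-- The indices `i` for which one of the constraints `cᵢ ≥ gᵢⱼ(y)` is tight at `x`. -/
def tight (F : Frame ι E Y) (g : ι → J → Y →ₗ[ℝ] ℝ) (x : E) : Finset ι :=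
  Finset.univ.filter fun i => ∃ j, F.co i x = g i j (F.pr x)

theorem mem_tight {x : E} {i : ι} : i ∈ tight F g x ↔ ∃ j, F.co i x = g i j (F.pr x) := by
  simp [tight]

/-- This encodes a face as a pair of an index set and a cell. -/
theorem act_eq_arg {x : E} (hx : x ∈ fanPoly F g) :
    act (fanAff F g) x = arg g (tight F g x) (F.pr x) := by
  rw [mem_fanPoly] at hx
  ext ⟨i, j⟩
  change fanAff F g (i, j) x = 0 ↔ i ∈ tight F g x ∧ j ∈ amax g i (F.pr x)
  rw [fanAff_apply, mem_tight, sub_eq_zero]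
  constructor
  · intro h
    exact ⟨⟨j, h⟩, fun j' => (hx i j').trans h.le⟩
  · rintro ⟨⟨j', h⟩, hj⟩
    exact le_antisymm (h.le.trans (hj j')) (hx i j)

theorem co_eq_of_tight {x : E} (hx : x ∈ fanPoly F g) {i : ι} (hi : i ∈ tight F g x) {j : J}
    (hj : j ∈ amax g i (F.pr x)) : F.co i x = g i j (F.pr x) := by
  obtain ⟨j', h⟩ := mem_tight.1 hi
  exact le_antisymm (h.le.trans (hj j')) (mem_fanPoly.1 hx i j)

theorem pr_ne_zero_of_tight_univ {x : E} (h : tight F g x = Finset.univ) : F.pr x ≠ 0 := by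
  intro h0
  have := F.sum_co x
  rw [Finset.sum_eq_zero fun i _ => ?_] at this
  · exact zero_ne_one this
  · obtain ⟨j, hj⟩ := mem_tight.1 (h ▸ Finset.mem_univ i)
    rw [hj, h0, map_zero]

omit [Fintype ι] in
theorem exists_best [Finite J] [Nonempty J] (g : ι → J → Y →ₗ[ℝ] ℝ) (y : Y) :
    ∃ β : ι → J, ∀ i, β i ∈ amax g i y :=
  ⟨fun i => (amax_nonempty g i y).some, fun i => (amax_nonempty g i y).some_mem⟩

theorem FanPos.sum_best_pos (h : FanPos g) {y : Y} (hy : y ≠ 0) {β : ι → J}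
    (hβ : ∀ i, β i ∈ amax g i y) : 0 < ∑ i, g i (β i) y := by
  obtain ⟨m, hm⟩ := h y hy
  exact hm.trans_le (Finset.sum_le_sum fun i _ => hβ i (m i))

theorem sum_le_one_of_mem {x : E} (hx : x ∈ fanPoly F g) (m : ι → J) :
    ∑ i, g i (m i) (F.pr x) ≤ 1 := by
  rw [← F.sum_co x]
  exact Finset.sum_le_sum fun i _ => mem_fanPoly.1 hx i (m i)

/-- Put the coordinates equal to the maxima at `s • y` plus a slack `d` supported exactly off `I`.
If `I` is everything, `s` normalises the sum of the maxima to `1`; otherwise `s` is small and the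
remaining mass is spread evenly off `I`. The excluded pair would have coordinate sum `0`. -/
theorem exists_tight_eq [Finite J] [Nonempty J] (F : Frame ι E Y) (hg : FanPos g)
    {I : Finset ι} {y : Y} (h : I ≠ Finset.univ ∨ y ≠ 0) :
    ∃ x ∈ fanPoly F g, tight F g x = I ∧ ∃ s : ℝ, 0 < s ∧ F.pr x = s • y := by
  classical
  obtain ⟨β, hβ⟩ := exists_best g y
  set G := ∑ i, g i (β i) y with hG
  obtain ⟨s, hs, d, hd, hsum⟩ : ∃ s : ℝ, 0 < s ∧ ∃ d : ι → ℝ, (∀ i, if i ∈ I then d i = 0 else 0 < d i) ∧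
      s * G + ∑ i, d i = 1 := by
    by_cases hI : I = Finset.univ
    · have hy : y ≠ 0 := by tauto
      have hGp : 0 < G := hg.sum_best_pos hy hβ
      refine ⟨1 / G, by positivity, 0, fun i => by simp [hI], ?_⟩
      simp [hGp.ne']
    · obtain ⟨s, h1, h2⟩ := ((eventually_pos_add_mul one_pos (-G)).and self_mem_nhdsWithin).exists
      obtain ⟨i₀, hi₀⟩ : ∃ i, i ∉ I := by
        by_contra! hcon
        exact hI (Finset.eq_univ_iff_forall.2 hcon)
      have hcard : 0 < ((Finset.univ.filter fun i => i ∉ I).card : ℝ) :=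
        Nat.cast_pos.2 (Finset.card_pos.2 ⟨i₀, by simpa using hi₀⟩)
      refine ⟨s, h2, fun i => if i ∉ I then
        (1 + s * -G) / ((Finset.univ.filter fun i => i ∉ I).card : ℝ) else 0, fun i => ?_, ?_⟩
      · split_ifs with h
        · exact if_neg (not_not.2 h)
        · exact (div_pos (by linarith) hcard).trans_eq (if_pos h).symm
      · rw [← Finset.sum_filter, Finset.sum_const, nsmul_eq_mul, mul_div_cancel₀ _ hcard.ne']
        ring
  obtain ⟨x, hx, hxy⟩ := F.surj (fun i => s * g i (β i) y + d i) (s • y) (by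
    rw [Finset.sum_add_distrib, ← Finset.mul_sum, ← hG, hsum])
  have hd0 : ∀ i, 0 ≤ d i := by
    intro i
    have := hd i
    split_ifs at this
    · exact this.ge
    · exact this.le
  have hle : ∀ i j, g i j (F.pr x) ≤ s * g i (β i) y := fun i j => by
    rw [hxy, map_smul, smul_eq_mul]
    exact mul_le_mul_of_nonneg_left (hβ i j) hs.le
  refine ⟨x, mem_fanPoly.2 fun i j => ?_, ?_, s, hs, hxy⟩
  · rw [hx]
    linarith [hle i j, hd0 i]
  · ext i
    have hdi := hd i
    rw [mem_tight]
    split_ifs at hdi with hi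
    · simp only [hi, iff_true]
      exact ⟨β i, by rw [hx, hxy, map_smul, smul_eq_mul, hdi, add_zero]⟩
    · simp only [hi, iff_false, not_exists]
      intro j hj
      rw [hx] at hj
      linarith [hle i j]

theorem exists_act_eq [Finite J] [Nonempty J] (F : Frame ι E Y) (hg : FanPos g)
    {I : Finset ι} {y : Y} (h : I ≠ Finset.univ ∨ y ≠ 0) :
    ∃ x ∈ fanPoly F g, tight F g x = I ∧ act (fanAff F g) x = arg g I y := by
  obtain ⟨x, hx, hI, s, hs, hxy⟩ := exists_tight_eq F hg h
  exact ⟨x, hx, hI, by rw [act_eq_arg hx, hI, hxy, arg_smul hs]⟩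

omit [Fintype ι] in
theorem index_eq_of_arg_eq [Finite J] [Nonempty J] {I I' : Finset ι} {y y' : Y}
    (h : arg g I y = arg g I' y') : I = I' := by
  have key : ∀ {I I' : Finset ι} {y y' : Y}, arg g I y = arg g I' y' → I ⊆ I' := by
    intro I I' y y' h i hi
    obtain ⟨j, hj⟩ := amax_nonempty g i y
    have : (i, j) ∈ arg g I' y' := h ▸ ⟨hi, hj⟩
    exact this.1
  exact Finset.Subset.antisymm (key h) (key h.symm)

/-- By homogenisation: a direction `w` of the face and a multiple `s` of `x` together amount to a
free vector of the flat and free values of the coordinates that are not tight. The tight coordinates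
follow from the vector, and `s` is the sum of all coordinates, as those of `w` sum to `0` and those
of `x` to `1`. -/
theorem finrank_lin_act [FiniteDimensional ℝ E] [FiniteDimensional ℝ Y] [Nonempty ι] [Finite J]
    [Nonempty J] {x : E} (hx : x ∈ fanPoly F g) :
    finrank ℝ (lin (fanAff F g) (act (fanAff F g) x)) + 1 + (tight F g x).card =
      finrank ℝ (flat g (act (fanAff F g) x)) + Fintype.card ι := by
  classical
  set A := act (fanAff F g) x with hA
  have hAeq : A = arg g (tight F g x) (F.pr x) := act_eq_arg hx
  obtain ⟨β, hβ⟩ := exists_best g (F.pr x)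
  have hβA : ∀ i ∈ tight F g x, (i, β i) ∈ A := fun i hi => by rw [hAeq]; exact ⟨hi, hβ i⟩
  have hlin : ∀ w ∈ lin (fanAff F g) A, ∀ s ∈ A,
      (F.co s.1).linear w = g s.1 s.2 (F.pr.linear w) := fun w hw s hs => by
    have := hw s hs
    rw [fanAff_linear] at this
    exact sub_eq_zero.1 this
  have hxA : ∀ s ∈ A, F.co s.1 x = g s.1 s.2 (F.pr x) := fun s hs => by
    have : fanAff F g s x = 0 := hs
    rw [fanAff_apply] at this
    exact sub_eq_zero.1 this
  have hflat : ∀ (w : lin (fanAff F g) A) (s : ℝ), F.pr.linear w + s • F.pr x ∈ flat g A := by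
    intro w s i j j' hj hj'
    simp only [map_add, map_smul]
    rw [← hlin w w.2 _ hj, ← hlin w w.2 _ hj', ← hxA _ hj, ← hxA _ hj']
  let T : (lin (fanAff F g) A × ℝ) →ₗ[ℝ] (flat g A × ({i // i ∉ tight F g x} → ℝ)) :=
    { toFun := fun p => (⟨F.pr.linear p.1 + p.2 • F.pr x, hflat p.1 p.2⟩,
        fun i => (F.co i).linear p.1 + p.2 * F.co i x)
      map_add' := fun p q => by
        ext
        · simp only [Prod.fst_add, Prod.snd_add, Submodule.coe_add, map_add, add_smul]
          abel
        · simp only [Prod.fst_add, Prod.snd_add, Submodule.coe_add, map_add, Pi.add_apply]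
          ring
      map_smul' := fun c p => by
        ext
        · simp [mul_smul]
        · simp [mul_add, mul_assoc] }
  have hT : Function.Bijective T := by
    constructor
    · rw [← LinearMap.ker_eq_bot, LinearMap.ker_eq_bot']
      rintro ⟨w, s⟩ h
      have h1 : F.pr.linear w + s • F.pr x = 0 := congrArg (fun p => (p.1 : Y)) h
      have h2 : ∀ i ∉ tight F g x, (F.co i).linear w + s * F.co i x = 0 := fun i hi =>
        congrFun (congrArg Prod.snd h) ⟨i, hi⟩
      have h3 : ∀ i, (F.co i).linear w + s * F.co i x = 0 := by
        intro i
        by_cases hi : i ∈ tight F g x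
        · rw [hlin w w.2 _ (hβA i hi), hxA _ (hβA i hi), ← smul_eq_mul, ← map_smul, ← map_add, h1,
            map_zero]
        · exact h2 i hi
      have h4 : s = 0 := by
        have := Finset.sum_congr (s₁ := Finset.univ) rfl fun i _ => h3 i
        rwa [Finset.sum_add_distrib, frame_sum_linear, ← Finset.mul_sum, F.sum_co, zero_add, mul_one,
          Finset.sum_const_zero] at this
      subst h4
      simp only [zero_smul, add_zero, zero_mul] at h1 h3
      have : (w : E) = 0 := frame_linear_inj F h3 h1
      ext
      · simpa using this
      · rfl
    · rintro ⟨⟨u, hu⟩, c⟩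
      let c' : ι → ℝ := fun i => if hi : i ∈ tight F g x then g i (β i) u else c ⟨i, hi⟩
      set s := ∑ i, c' i
      obtain ⟨w, hw1, hw2⟩ := frame_linear_surj F (fun i => c' i - s * F.co i x) (u - s • F.pr x) (by
        rw [Finset.sum_sub_distrib, ← Finset.mul_sum, F.sum_co, mul_one, sub_self])
      refine ⟨(⟨w, ?_⟩, s), ?_⟩
      · rintro ⟨i, j⟩ hij
        have hi : i ∈ tight F g x := by rw [hAeq] at hij; exact hij.1
        rw [fanAff_linear, hw1, hw2, hxA _ hij]
        simp only [c', dif_pos hi, map_sub, map_smul, smul_eq_mul]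
        rw [hu i (β i) j (hβA i hi) hij]
        ring
      · ext i
        · simp only [T, LinearMap.coe_mk, AddHom.coe_mk, hw2]
          abel
        · simp only [T, LinearMap.coe_mk, AddHom.coe_mk, hw1, c', dif_neg i.2]
          ring
  have h := (LinearEquiv.ofBijective T hT).finrank_eq
  rw [finrank_prod, finrank_prod, finrank_self, finrank_pi, Fintype.card_subtype_compl] at h
  simp only [Fintype.card_coe] at h
  have hle : (tight F g x).card ≤ Fintype.card ι := Finset.card_le_univ _
  omega

theorem eq_zero_of_mem_flat_univ [Finite J] [Nonempty J] (hg : FanPos g) {u : Y}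
    (h : ∀ i j j', g i j u = g i j' u) : u = 0 := by
  by_contra hu
  obtain ⟨m, hm⟩ := hg u hu
  obtain ⟨m', hm'⟩ := hg (-u) (neg_ne_zero.2 hu)
  simp only [map_neg, Finset.sum_neg_distrib] at hm'
  have : ∑ i, g i (m i) u = ∑ i, g i (m' i) u := Finset.sum_congr rfl fun i _ => h i _ _
  linarith

omit [Fintype ι] in
theorem amax_zero (i : ι) : amax g i 0 = Set.univ := by
  ext j; simp [amax]

theorem flat_arg_univ_zero [Finite J] [Nonempty J] (hg : FanPos g) :
    flat g (arg g Finset.univ 0) = ⊥ := by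
  rw [eq_bot_iff]
  intro u hu
  refine eq_zero_of_mem_flat_univ hg fun i j j' => hu i j j' ⟨Finset.mem_univ _, ?_⟩
    ⟨Finset.mem_univ _, ?_⟩ <;> simp [amax_zero]

theorem cells_univ_zero [Finite J] [Nonempty J] [FiniteDimensional ℝ Y] (hg : FanPos g) :
    (cells g Finset.univ 0).ncard = 1 := by
  rw [Set.ncard_eq_one]
  refine ⟨arg g Finset.univ 0, ?_⟩
  ext A
  constructor
  · rintro ⟨y, rfl, hd⟩
    have h0 : finrank ℝ (flat g (arg g Finset.univ y)) = 0 := by exact_mod_cast hd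
    have h1 := self_mem_flat (g := g) Finset.univ y
    rw [Submodule.finrank_eq_zero.1 h0, Submodule.mem_bot] at h1
    rw [h1]; rfl
  · rintro rfl
    exact ⟨0, rfl, by rw [flat_arg_univ_zero hg, finrank_bot]; rfl⟩

omit [Fintype ι] in
theorem cells_neg (I : Finset ι) {d : ℤ} (hd : d < 0) : (cells g I d).ncard = 0 := by
  suffices h : cells g I d = ∅ by rw [h, Set.ncard_empty]
  rw [eq_empty_iff_forall_notMem]
  rintro A ⟨y, -, h⟩
  omega

theorem ncard_iUnion_eq_sum {α β : Type*} [Fintype α] [Finite β] (S : α → Set β)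
    (h : Pairwise fun a b => Disjoint (S a) (S b)) : (⋃ a, S a).ncard = ∑ a, (S a).ncard := by
  classical
  have := Fintype.ofFinite β
  have e : (⋃ a, S a).toFinset = Finset.univ.biUnion fun a => (S a).toFinset := by
    ext; simp
  rw [Set.ncard_eq_toFinset_card', e, Finset.card_biUnion]
  · exact Finset.sum_congr rfl fun a _ => (Set.ncard_eq_toFinset_card' _).symm
  · intro a _ b _ hab
    exact Set.disjoint_toFinset.2 (h hab)

variable [TopologicalSpace E]

/-- The `f`-vector of a fan polyhedron counts the cones in the normal fans of all subfamilies. -/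
theorem fVec_fanPoly [FiniteDimensional ℝ E] [FiniteDimensional ℝ Y] [Nonempty ι] [Finite J]
    [Nonempty J] (hc : ∀ f : E →ₗ[ℝ] ℝ, Continuous f) (F : Frame ι E Y) (hg : FanPos g) (j : ℤ) :
    fVec (fanPoly F g) j =
      ∑ I : Finset ι, (cells g I (j + 1 - Fintype.card ι + I.card)).ncard := by
  classical
  have hcard : ∀ I : Finset ι, I ≠ Finset.univ → I.card < Fintype.card ι := fun I hI =>
    lt_of_le_of_ne (Finset.card_le_univ I) fun h => hI (Finset.card_eq_iff_eq_univ I |>.1 h)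
  rcases lt_trichotomy j (-1) with hj | rfl | hj
  · rw [fVec_lt_neg_one _ hj, Finset.sum_eq_zero]
    intro I _
    have := Finset.card_le_univ I
    exact cells_neg I (by omega)
  -- Only the full index set with the cone `{0}` remains; this pair, at which there is no point,
  -- counts the empty face.
  · rw [fVec_neg_one, Finset.sum_eq_single Finset.univ]
    · rw [Finset.card_univ, show (-1 : ℤ) + 1 - Fintype.card ι + Fintype.card ι = 0 by ring,
        cells_univ_zero hg]
    · intro I _ hI
      have := hcard I hI
      exact cells_neg I (by omega)
    · simp
  · rw [fanPoly, fVec_hPoly hc (by omega), ← ncard_iUnion_eq_sum]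
    · congr 1
      ext A
      simp only [mem_iUnion]
      constructor
      · rintro ⟨x, hx, rfl, hd⟩
        refine ⟨tight F g x, F.pr x, act_eq_arg hx, ?_⟩
        have := finrank_lin_act hx
        omega
      · rintro ⟨I, y, rfl, hd⟩
        have hor : I ≠ Finset.univ ∨ y ≠ 0 := by
          by_contra! hcon
          obtain ⟨rfl, rfl⟩ := hcon
          rw [flat_arg_univ_zero hg, finrank_bot, Finset.card_univ] at hd
          omega
        obtain ⟨x, hx, hI, hact⟩ := exists_act_eq F hg hor
        refine ⟨x, hx, hact, ?_⟩
        have := finrank_lin_act hx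
        rw [hact, hI] at this
        omega
    · intro I I' hII
      refine Set.disjoint_left.2 ?_
      rintro A ⟨y, rfl, -⟩ ⟨y', h, -⟩
      exact hII (index_eq_of_arg_eq h)

end Frames

/-! ### Multiples of a single family, and sums of families. -/

section Scaled

variable {E Y ι J M : Type*} [AddCommGroup E] [Module ℝ E] [AddCommGroup Y] [Module ℝ Y]

/-- The families of all multiples `rᵢ • h` of the members of a single family. -/
def scal (r : ι → ℝ) (h : M → Y →ₗ[ℝ] ℝ) : ι → M → Y →ₗ[ℝ] ℝ := fun i m => r i • h m

/-- The number of `d`-dimensional cones in the normal fan of a single family. -/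
def numCones (h : M → Y →ₗ[ℝ] ℝ) (d : ℤ) : ℕ :=
  (cells (fun _ : Unit => h) Finset.univ d).ncard

theorem mem_amax_scal {r : ι → ℝ} {h : M → Y →ₗ[ℝ] ℝ} {i : ι} (hr : 0 ≤ r i) {y : Y} {m : M} :
    m ∈ amax (scal r h) i y ↔ r i = 0 ∨ ∀ m', h m' y ≤ h m y := by
  simp only [amax, scal, mem_ofPred_eq, LinearMap.smul_apply, smul_eq_mul]
  rcases hr.eq_or_lt with h0 | h0
  · simp [← h0]
  · simp [h0.ne', h0]

/-- A positive multiple has the same maximal functionals and a zero multiple imposes nothing, so one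
positive coefficient in `I` reveals the whole fan of `h`. -/
theorem ncard_cells_scal {r : ι → ℝ} (hr : ∀ i, 0 ≤ r i) (h : M → Y →ₗ[ℝ] ℝ) {I : Finset ι}
    (hI : ∃ i ∈ I, 0 < r i) (d : ℤ) : (cells (scal r h) I d).ncard = numCones h d := by
  obtain ⟨i₀, hi₀, hpos⟩ := hI
  let Φ : Set (Unit × M) → Set (ι × M) := fun B => {s | s.1 ∈ I ∧ (r s.1 = 0 ∨ ((), s.2) ∈ B)}
  have harg : ∀ y, arg (scal r h) I y = Φ (arg (fun _ : Unit => h) Finset.univ y) := by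
    intro y
    ext ⟨i, m⟩
    refine and_congr_right fun _ => ?_
    rw [mem_amax_scal (hr i)]
    simp [arg, amax]
  have hflat : ∀ B, flat (scal r h) (Φ B) = flat (fun _ : Unit => h) B := by
    intro B
    ext u
    constructor
    · intro hu i m m' hm hm'
      have := hu i₀ m m' ⟨hi₀, Or.inr hm⟩ ⟨hi₀, Or.inr hm'⟩
      exact mul_left_cancel₀ hpos.ne' this
    · rintro hu i m m' ⟨-, hm⟩ ⟨-, hm'⟩
      change r i * h m u = r i * h m' u
      by_cases h0 : r i = 0
      · rw [h0, zero_mul, zero_mul]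
      · rw [hu () m m' (hm.resolve_left h0) (hm'.resolve_left h0)]
  have hinj : Function.Injective Φ := by
    intro B B' hBB
    ext ⟨u, m⟩
    have : (i₀, m) ∈ Φ B ↔ (i₀, m) ∈ Φ B' := by rw [hBB]
    simpa [Φ, hi₀, hpos.ne'] using this
  rw [numCones, ← Set.ncard_image_of_injective _ hinj]
  congr 1
  ext A
  constructor
  · rintro ⟨y, rfl, hd⟩
    refine ⟨_, ⟨y, rfl, ?_⟩, (harg y).symm⟩
    rw [← hd, harg, hflat]
  · rintro ⟨_, ⟨y, rfl, hd⟩, rfl⟩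
    exact ⟨y, (harg y).symm, by rw [hflat, hd]⟩

theorem flat_arg_eq_top {g : ι → J → Y →ₗ[ℝ] ℝ} {I : Finset ι} (h : ∀ i ∈ I, ∀ j j', g i j = g i j')
    (y : Y) : flat g (arg g I y) = ⊤ := by
  rw [eq_top_iff]
  rintro u - i j j' ⟨hi, -⟩ -
  rw [h i hi j j']

theorem ncard_cells_of_const {g : ι → J → Y →ₗ[ℝ] ℝ} {I : Finset ι}
    (h : ∀ i ∈ I, ∀ j j', g i j = g i j') (d : ℤ) :
    (cells g I d).ncard = if d = finrank ℝ Y then 1 else 0 := by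
  have harg : ∀ y, arg g I y = arg g I 0 := by
    intro y
    ext ⟨i, j⟩
    refine and_congr_right fun hi => ?_
    rw [amax_zero]
    simp only [Set.mem_univ, iff_true]
    intro j'
    rw [h i hi j' j]
  split_ifs with hd
  · rw [Set.ncard_eq_one]
    refine ⟨arg g I 0, ?_⟩
    ext A
    constructor
    · rintro ⟨y, rfl, -⟩
      exact harg y
    · rintro rfl
      exact ⟨0, rfl, by rw [flat_arg_eq_top h, finrank_top, hd]⟩
  · suffices h : cells g I d = ∅ by rw [h, Set.ncard_empty]
    rw [eq_empty_iff_forall_notMem]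
    rintro A ⟨y, rfl, hA⟩
    rw [flat_arg_eq_top h, finrank_top] at hA
    exact hd hA.symm

theorem numCones_of_lt [FiniteDimensional ℝ Y] (h : M → Y →ₗ[ℝ] ℝ) {d : ℤ}
    (hd : (finrank ℝ Y : ℤ) < d) : numCones h d = 0 := by
  rw [numCones]
  suffices h : cells (fun _ : Unit => h) Finset.univ d = ∅ by rw [h, Set.ncard_empty]
  rw [eq_empty_iff_forall_notMem]
  rintro A ⟨y, rfl, hA⟩
  have := Submodule.finrank_le (flat (fun _ : Unit => h) (arg (fun _ : Unit => h) Finset.univ y))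
  omega

variable [Fintype ι]

/-- The family of all sums with one summand from each of the families. -/
def sumFam (g : ι → J → Y →ₗ[ℝ] ℝ) : (ι → J) → Y →ₗ[ℝ] ℝ := fun m => ∑ i, g i (m i)

theorem sumFam_apply (g : ι → J → Y →ₗ[ℝ] ℝ) (m : ι → J) (y : Y) :
    sumFam g m y = ∑ i, g i (m i) y := by rw [sumFam, LinearMap.sum_apply]

theorem sumFam_max_iff [Finite J] [Nonempty J] {g : ι → J → Y →ₗ[ℝ] ℝ} {m : ι → J} {y : Y} :
    (∀ m', sumFam g m' y ≤ sumFam g m y) ↔ ∀ i, m i ∈ amax g i y := by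
  classical
  constructor
  · intro h i j
    have h1 := h (Function.update m i j)
    rw [sumFam_apply, sumFam_apply, ← Finset.add_sum_erase _ _ (Finset.mem_univ i),
      ← Finset.add_sum_erase _ _ (Finset.mem_univ i), Function.update_self] at h1
    rw [Finset.sum_congr rfl (fun l hl => by rw [Function.update_of_ne (Finset.ne_of_mem_erase hl)]) ]
      at h1
    linarith
  · intro h m'
    rw [sumFam_apply, sumFam_apply]
    exact Finset.sum_le_sum fun i _ => h i (m' i)

/-- The fan of a sum is the common refinement: a tuple is maximal exactly if all its entries are.
Exchanging one entry of a maximal tuple recovers the maximal set of each family. -/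
theorem ncard_cells_univ [Finite J] [Nonempty J] (g : ι → J → Y →ₗ[ℝ] ℝ) (d : ℤ) :
    (cells g Finset.univ d).ncard = numCones (sumFam g) d := by
  classical
  let Ψ : Set (ι × J) → Set (Unit × (ι → J)) := fun A => {s | ∀ i, (i, s.2 i) ∈ A}
  have harg : ∀ y, arg (fun _ : Unit => sumFam g) Finset.univ y = Ψ (arg g Finset.univ y) := by
    intro y
    ext ⟨u, m⟩
    have := sumFam_max_iff (g := g) (m := m) (y := y)
    simpa [arg, Ψ, amax] using this
  have hupd : ∀ y {β : ι → J}, (∀ l, β l ∈ amax g l y) → ∀ i j,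
      (((), Function.update β i j) ∈ Ψ (arg g Finset.univ y) ↔ (i, j) ∈ arg g Finset.univ y) := by
    intro y β hβ i j
    constructor
    · intro h
      have h1 : (i, Function.update β i j i) ∈ arg g Finset.univ y := h i
      rwa [Function.update_self] at h1
    · intro h l
      by_cases hl : l = i
      · subst hl
        simpa using h
      · change (l, Function.update β i j l) ∈ _
        rw [Function.update_of_ne hl]
        exact ⟨Finset.mem_univ _, hβ l⟩
  have hflat : ∀ y, flat (fun _ : Unit => sumFam g) (Ψ (arg g Finset.univ y)) =
      flat g (arg g Finset.univ y) := by
    intro y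
    obtain ⟨β, hβ⟩ := exists_best g y
    ext u
    constructor
    · intro hu i j j' hj hj'
      have h1 := hu () _ _ ((hupd y hβ i j).2 hj) ((hupd y hβ i j').2 hj')
      change sumFam g _ u = sumFam g _ u at h1
      rw [sumFam_apply, sumFam_apply, ← Finset.add_sum_erase _ _ (Finset.mem_univ i),
        ← Finset.add_sum_erase _ _ (Finset.mem_univ i), Function.update_self,
        Function.update_self] at h1
      have h2 : ∀ p : J, ∑ l ∈ Finset.univ.erase i, g l (Function.update β i p l) u =
          ∑ l ∈ Finset.univ.erase i, g l (β l) u := fun p =>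
        Finset.sum_congr rfl fun l hl => by rw [Function.update_of_ne (Finset.ne_of_mem_erase hl)]
      rw [h2, h2] at h1
      linarith
    · intro hu _ m m' hm hm'
      change sumFam g _ u = sumFam g _ u
      rw [sumFam_apply, sumFam_apply]
      exact Finset.sum_congr rfl fun i _ => hu i _ _ (hm i) (hm' i)
  have himg : cells (fun _ : Unit => sumFam g) Finset.univ d = Ψ '' cells g Finset.univ d := by
    ext A
    constructor
    · rintro ⟨y, rfl, hd⟩
      refine ⟨_, ⟨y, rfl, ?_⟩, (harg y).symm⟩
      rw [← hd, harg, hflat]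
    · rintro ⟨_, ⟨y, rfl, hd⟩, rfl⟩
      exact ⟨y, (harg y).symm, by rw [hflat, hd]⟩
  rw [numCones, himg, Set.InjOn.ncard_image]
  have key : ∀ y y', Ψ (arg g Finset.univ y) = Ψ (arg g Finset.univ y') →
      arg g Finset.univ y ⊆ arg g Finset.univ y' := by
    rintro y y' h ⟨i, j⟩ hij
    obtain ⟨β, hβ⟩ := exists_best g y
    have h1 := (hupd y hβ i j).2 hij
    rw [h] at h1
    have h2 : (i, Function.update β i j i) ∈ arg g Finset.univ y' := h1 i
    rwa [Function.update_self] at h2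
  rintro _ ⟨y, rfl, -⟩ _ ⟨y', rfl, -⟩ h
  exact Subset.antisymm (key y y' h) (key y' y h.symm)

theorem fanPos_scal {r : ι → ℝ} (hsum : ∑ i, r i = 1) {h : M → Y →ₗ[ℝ] ℝ}
    (hh : ∀ y ≠ 0, ∃ m, 0 < h m y) : FanPos (scal r h) := by
  intro y hy
  obtain ⟨m, hm⟩ := hh y hy
  refine ⟨fun _ => m, ?_⟩
  simp only [scal, LinearMap.smul_apply, smul_eq_mul]
  rwa [← Finset.sum_mul, hsum, one_mul]

theorem fanPos_unit {h : M → Y →ₗ[ℝ] ℝ} (hh : ∀ y ≠ 0, ∃ m, 0 < h m y) :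
    FanPos (fun _ : Unit => h) := by
  intro y hy
  obtain ⟨m, hm⟩ := hh y hy
  exact ⟨fun _ => m, by simpa using hm⟩

/-- With a single index, the empty index set accounts for the polyhedron itself and the full one for
its proper faces, as cones over them. -/
theorem fVec_unit [TopologicalSpace E] [FiniteDimensional ℝ E] [FiniteDimensional ℝ Y] [Finite M]
    [Nonempty M] (hc : ∀ f : E →ₗ[ℝ] ℝ, Continuous f) (F : Frame Unit E Y) {h : M → Y →ₗ[ℝ] ℝ}
    (hh : ∀ y ≠ 0, ∃ m, 0 < h m y) (j : ℤ) :
    fVec (fanPoly F fun _ : Unit => h) j =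
      (if j = finrank ℝ Y then 1 else 0) + numCones h (j + 1) := by
  rw [fVec_fanPoly hc F (fanPos_unit hh), show (Finset.univ : Finset (Finset Unit)) =
    {∅, Finset.univ} from rfl, Finset.sum_pair (by decide), ncard_cells_of_const (by simp)]
  simp [numCones]

/-- The termwise comparison of `P` and `P'`. If all coefficients in `I` vanish, both fans consist of
the whole space alone. -/
theorem ncard_cells_le_scal [Finite J] [Nonempty J] {g : ι → J → Y →ₗ[ℝ] ℝ} {r : ι → ℝ}
    (hr : ∀ i, 0 ≤ r i) (hrg : ∀ i, r i = 0 → ∀ j j', g i j = g i j') (I : Finset ι) (d : ℤ) :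
    (cells g I d).ncard ≤ (cells (scal r (sumFam g)) I d).ncard := by
  by_cases hI : ∃ i ∈ I, 0 < r i
  · rw [ncard_cells_scal hr _ hI, ← ncard_cells_univ]
    exact ncard_cells_le I d
  · push Not at hI
    have h0 : ∀ i ∈ I, r i = 0 := fun i hi => le_antisymm (hI i hi) (hr i)
    rw [ncard_cells_of_const fun i hi => hrg i (h0 i hi), ncard_cells_of_const fun i hi m m' => ?_]
    simp [scal, h0 i hi]

/-- The termwise comparison of `P'` and `Σ ⊕ Q`. On the right every nonempty `I` sees the whole fan;
on the left the full index set does, because some `r l` is positive. -/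
theorem ncard_cells_scal_le_scal [Finite M] [Nonempty M] {M' : Type*} [Finite M'] [Nonempty M']
    {h : M → Y →ₗ[ℝ] ℝ} {h' : M' → Y →ₗ[ℝ] ℝ} {r r' : ι → ℝ} (hr : ∀ i, 0 ≤ r i)
    (hsum : ∑ i, r i = 1) (hr' : ∀ i, 0 < r' i) (hh : ∀ d, numCones h d = numCones h' d)
    (I : Finset ι) (d : ℤ) :
    (cells (scal r h) I d).ncard ≤ (cells (scal r' h') I d).ncard := by
  rcases I.eq_empty_or_nonempty with rfl | ⟨i, hi⟩
  · rw [ncard_cells_of_const (by simp), ncard_cells_of_const (by simp)]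
  · rw [ncard_cells_scal (fun i => (hr' i).le) _ ⟨i, hi, hr' i⟩, ← hh]
    obtain ⟨l, -, hl⟩ := Finset.exists_lt_of_sum_lt (s := Finset.univ) (f := fun _ : ι => (0 : ℝ))
      (g := r) (by rw [hsum]; simp)
    rw [← ncard_cells_scal hr h ⟨l, Finset.mem_univ l, hl⟩]
    exact ncard_cells_le I d

end Scaled

/-! ### Comparison of face lattices and `f`-vectors. -/

section Comparison

variable {E Y ι J : Type*} [AddCommGroup E] [Module ℝ E] [AddCommGroup Y] [Module ℝ Y]
  [Fintype ι] [Finite J] [Nonempty J] [FiniteDimensional ℝ Y]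

omit [Finite J] [Nonempty J] in
/-- The coefficients of `f₀` are the same for families between `g` and `g'`. -/
theorem ncard_cells_eq_of_vertices [DecidableEq ι] {g : ι → J → Y →ₗ[ℝ] ℝ} {J' : Type*} [Finite J']
    [Nonempty J'] {g' : ι → J' → Y →ₗ[ℝ] ℝ} (hg' : FanPos g')
    (hle : ∀ I d, (cells g I d).ncard ≤ (cells g' I d).ncard)
    (huniv : ∀ d, (cells g Finset.univ d).ncard = (cells g' Finset.univ d).ncard)
    (hone : ∀ i, 1 ≤ (cells g {i}ᶜ 0).ncard) (I : Finset ι) :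
    (cells g I (0 + 1 - Fintype.card ι + I.card)).ncard =
      (cells g' I (0 + 1 - Fintype.card ι + I.card)).ncard := by
  by_cases h1 : I = Finset.univ
  · rw [h1, huniv]
  by_cases h2 : I.card + 1 = Fintype.card ι
  · have h3 : Iᶜ.card = 1 := by rw [Finset.card_compl]; omega
    obtain ⟨i, hi⟩ := Finset.card_eq_one.1 h3
    obtain rfl : I = {i}ᶜ := by rw [← hi, compl_compl]
    have hd : (0 + 1 - Fintype.card ι + ({i}ᶜ : Finset ι).card : ℤ) = 0 := by omega
    rw [hd]
    have h4 := ncard_cells_le (g := g') {i}ᶜ 0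
    rw [cells_univ_zero hg'] at h4
    have h5 := hle {i}ᶜ 0
    have h6 := hone i
    omega
  · have h3 : I.card < Fintype.card ι := (Finset.card_lt_iff_ne_univ I).2 h1
    rw [cells_neg I (by omega), cells_neg I (by omega)]

omit [Fintype ι] [FiniteDimensional ℝ Y] in
theorem arg_subset_arg_iff {g : ι → J → Y →ₗ[ℝ] ℝ} {I K : Finset ι} {y z : Y} :
    arg g I y ⊆ arg g K z ↔ ∀ i ∈ I, i ∈ K ∧ amax g i y ⊆ amax g i z := by
  constructor
  · intro hs i hi
    obtain ⟨j, hj⟩ := amax_nonempty g i y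
    have h3 : (i, j) ∈ arg g K z := hs ⟨hi, hj⟩
    refine ⟨h3.1, fun p hp => ?_⟩
    have h4 : (i, p) ∈ arg g K z := hs ⟨hi, hp⟩
    exact h4.2
  · rintro hs ⟨i, j⟩ ⟨hi, hj⟩
    exact ⟨(hs i hi).1, (hs i hi).2 hj⟩

omit [FiniteDimensional ℝ Y] in
-- Faces with the same pair `(I, y)` are matched. By `h`, for `r i > 0` the fan of the `i`-th family
-- is already the common refinement; for `r i = 0` it is trivial on both sides.
theorem combEquiv_fanPoly_scal [TopologicalSpace E] (hc : ∀ f : E →ₗ[ℝ] ℝ, Continuous f)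
    (F : Frame ι E Y) {g : ι → J → Y →ₗ[ℝ] ℝ} (hg : FanPos g) {r : ι → ℝ} (hr : ∀ i, 0 ≤ r i)
    (hsum : ∑ i, r i = 1) (hrg : ∀ i, r i = 0 → ∀ j j', g i j = g i j')
    (h : ∀ i, 0 < r i → ∀ y z, amax g i y ⊆ amax g i z → ∀ l, amax g l y ⊆ amax g l z) :
    CombEquiv (fanPoly F g) (fanPoly F (scal r (sumFam g))) := by
  set g' := scal r (sumFam g) with hg'def
  have hg' : FanPos g' := fanPos_scal hsum fun y hy => by
    obtain ⟨m, hm⟩ := hg y hy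
    exact ⟨m, by rwa [sumFam_apply]⟩
  have hconst : ∀ i, r i = 0 → ∀ y, amax g i y = Set.univ := by
    intro i hi y
    ext j
    simp only [Set.mem_univ, iff_true]
    intro j'
    rw [hrg i hi j' j]
  refine combEquiv_hPoly hc (fun x x' => ∃ I y, act (fanAff F g) x = arg g I y ∧
    act (fanAff F g') x' = arg g' I y) ?_ ?_ ?_
  · intro x hx
    have hor : tight F g x ≠ Finset.univ ∨ F.pr x ≠ 0 :=
      or_iff_not_imp_left.2 fun h => pr_ne_zero_of_tight_univ (not_not.1 h)
    obtain ⟨x', hx', -, hact⟩ := exists_act_eq F hg' hor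
    exact ⟨x', hx', _, _, act_eq_arg hx, hact⟩
  · intro x hx
    have hor : tight F g' x ≠ Finset.univ ∨ F.pr x ≠ 0 :=
      or_iff_not_imp_left.2 fun h => pr_ne_zero_of_tight_univ (not_not.1 h)
    obtain ⟨x', hx', -, hact⟩ := exists_act_eq F hg hor
    exact ⟨x', hx', _, _, hact, act_eq_arg hx⟩
  · rintro x - x' - z - z' - ⟨I, y, h1, h1'⟩ ⟨K, w, h2, h2'⟩
    rw [h1, h1', h2, h2']
    rw [arg_subset_arg_iff, arg_subset_arg_iff]
    refine forall₂_congr fun i _ => and_congr_right fun _ => ?_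
    rcases (hr i).eq_or_lt with h0 | h0
    · rw [hconst i h0.symm, hconst i h0.symm]
      refine iff_of_true subset_rfl ?_
      intro m _
      exact (mem_amax_scal (hr i)).2 (Or.inl h0.symm)
    · have hm : ∀ u m, m ∈ amax g' i u ↔ ∀ l, m l ∈ amax g l u := by
        intro u m
        rw [mem_amax_scal (hr i), sumFam_max_iff]
        exact or_iff_right h0.ne'
      constructor
      · intro hs m hmy
        rw [hm] at hmy ⊢
        exact fun l => h i h0 y w hs l (hmy l)
      · intro hs j hj
        classical
        obtain ⟨β, hβ⟩ := exists_best g y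
        have h3 : Function.update β i j ∈ amax g' i y := by
          rw [hm]
          intro l
          by_cases hl : l = i
          · subst hl; simpa using hj
          · rw [Function.update_of_ne hl]; exact hβ l
        have h4 := (hm _ _).1 (hs h3) i
        rwa [Function.update_self] at h4

/-- Replacing `z` by `z + t • y` with small `t` turns the inclusion for `i` into an equality, and
adds no functional to the maximal set for `l`. -/
theorem ncard_cells_singleton_lt_of_subset {g : ι → J → Y →ₗ[ℝ] ℝ} {i l : ι} {y z : Y}
    (hi : amax g i y ⊆ amax g i z) (hl : ¬amax g l y ⊆ amax g l z) {d : ℤ}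
    (hd : d = finrank ℝ Y ∨ d = finrank ℝ Y - 1) :
    (cells g {i} d).ncard < (cells g Finset.univ d).ncard := by
  obtain ⟨j, hj, hj'⟩ := not_subset.1 hl
  obtain ⟨t, ht⟩ := (eventually_amax_add g z y).exists
  refine ncard_cells_singleton_lt (y := y) (y' := z + t • y) ?_ hj ?_ hd
  · rw [ht]
    refine Subset.antisymm (fun p hp => ⟨hi hp, fun q _ => hp q⟩) fun p hp => ?_
    obtain ⟨q, hq⟩ := amax_nonempty g i y
    exact mem_amax_of_le hq (hp.2 q (hi hq))
  · rw [ht]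
    exact fun h => hj' h.1

/-- Some `i` with `r i > 0` has a fan coarser than the refinement. The two admitted values of `j`
are those for which the term of `{i}` counts maximal cones or walls. -/
theorem fVec_lt_of_not_combEquiv [TopologicalSpace E] [FiniteDimensional ℝ E] [Nonempty ι]
    (hc : ∀ f : E →ₗ[ℝ] ℝ, Continuous f)
    (F : Frame ι E Y) {g : ι → J → Y →ₗ[ℝ] ℝ} (hg : FanPos g) {r : ι → ℝ} (hr : ∀ i, 0 ≤ r i)
    (hsum : ∑ i, r i = 1) (hrg : ∀ i, r i = 0 → ∀ j j', g i j = g i j')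
    (hnot : ¬CombEquiv (fanPoly F g) (fanPoly F (scal r (sumFam g)))) {j : ℤ}
    (hj : j + 2 - Fintype.card ι = finrank ℝ Y ∨ j + 2 - Fintype.card ι = finrank ℝ Y - 1) :
    fVec (fanPoly F g) j < fVec (fanPoly F (scal r (sumFam g))) j := by
  have hg' : FanPos (scal r (sumFam g)) := fanPos_scal hsum fun y hy => by
    obtain ⟨m, hm⟩ := hg y hy
    exact ⟨m, by rwa [sumFam_apply]⟩
  have h := mt (combEquiv_fanPoly_scal hc F hg hr hsum hrg) hnot
  push Not at h
  obtain ⟨i, hi, y, z, hyz, l, hl⟩ := h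
  rw [fVec_fanPoly hc F hg, fVec_fanPoly hc F hg']
  refine Finset.sum_lt_sum (fun I _ => ncard_cells_le_scal hr hrg I _) ⟨{i}, Finset.mem_univ _, ?_⟩
  rw [ncard_cells_scal hr _ ⟨i, Finset.mem_singleton_self i, hi⟩, ← ncard_cells_univ]
  refine ncard_cells_singleton_lt_of_subset hyz hl ?_
  rw [Finset.card_singleton]
  omega

end Comparison

/-! ### Facet inequalities of a polytope from its dual body. -/

section FacetRepresentation

variable {E : Type*} [NormedAddCommGroup E] [NormedSpace ℝ E] [FiniteDimensional ℝ E]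

omit [FiniteDimensional ℝ E] in
/-- An extreme point of the dual body is determined by its tight constraints. -/
theorem eq_zero_of_mem_extremePoints {s : Set E} (hs : s.Finite) {x₀ : E} {l : StrongDual ℝ E}
    (hl : l ∈ {l : StrongDual ℝ E | ∀ v ∈ s, l (v - x₀) ≤ 1}.extremePoints ℝ)
    {w : StrongDual ℝ E} (hw : ∀ v ∈ s, l (v - x₀) = 1 → w (v - x₀) = 0) : w = 0 := by
  have hev : ∀ w : StrongDual ℝ E, (∀ v ∈ s, l (v - x₀) = 1 → w (v - x₀) = 0) →
      ∀ᶠ t in 𝓝[>] (0 : ℝ), ∀ v ∈ s, (l + t • w) (v - x₀) ≤ 1 := by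
    intro w hw
    rw [eventually_all_finite hs]
    intro v hv
    by_cases h : l (v - x₀) = 1
    · refine Eventually.of_forall fun t => ?_
      simp [h, hw v hv h]
    · filter_upwards [eventually_pos_add_mul (sub_pos.2 (lt_of_le_of_ne (hl.1 v hv) h))
        (-(w (v - x₀)))] with t ht
      simp only [_root_.add_apply, _root_.smul_apply, smul_eq_mul]
      linarith
  obtain ⟨t, ⟨h1, h2⟩, h3⟩ := (((hev w hw).and (hev (-w) fun v hv h => by
    simp [hw v hv h])).and self_mem_nhdsWithin).exists
  have h4 := hl.2 (x₁ := l + t • w) h1 (x₂ := l + t • -w) h2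
    ⟨1 / 2, 1 / 2, by norm_num, by norm_num, by norm_num, by module⟩
  have h5 : t • w = 0 := by simpa using h4
  exact (smul_eq_zero.1 h5).resolve_left (ne_of_gt h3)

omit [FiniteDimensional ℝ E] in
theorem le_one_of_mem_convexHull {s : Set E} {x₀ : E} {l : StrongDual ℝ E}
    (hl : ∀ v ∈ s, l (v - x₀) ≤ 1) {y : E} (hy : y ∈ convexHull ℝ s) : l (y - x₀) ≤ 1 := by
  have hconv : Convex ℝ {y | l (y - x₀) ≤ 1} := by
    have : {y | l (y - x₀) ≤ 1} = {y | l y ≤ 1 + l x₀} := by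
      ext y; simp
    rw [this]
    exact convex_halfSpace_le l.toLinearMap.isLinear _
  exact convexHull_min (t := {y | l (y - x₀) ≤ 1}) hl hconv hy

theorem isCompact_dualBody {s : Set E} {x₀ : E} (hx₀ : x₀ ∈ interior (convexHull ℝ s)) :
    IsCompact {l : StrongDual ℝ E | ∀ v ∈ s, l (v - x₀) ≤ 1} := by
  have : ProperSpace (StrongDual ℝ E) := FiniteDimensional.proper ℝ _
  refine Metric.isCompact_of_isClosed_isBounded ?_ ?_
  · simp only [ofPred_forall]
    exact isClosed_biInter fun v _ => isClosed_le (by fun_prop) continuous_const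
  · obtain ⟨r, hr, hball⟩ := Metric.mem_nhds_iff.1 (mem_interior_iff_mem_nhds.1 hx₀)
    -- The bound `2 / r` comes from testing on vectors of norm `r / 2`, which lie strictly inside
    -- the ball.
    refine (Metric.isBounded_closedBall (x := (0 : StrongDual ℝ E)) (r := 2 / r)).subset ?_
    intro l hl
    rw [mem_closedBall_zero_iff]
    have hb : ∀ u : E, ‖u‖ < r → l u ≤ 1 := by
      intro u hu
      have := le_one_of_mem_convexHull hl (y := x₀ + u) (hball (by simpa using hu))
      rwa [add_sub_cancel_left] at this
    refine ContinuousLinearMap.opNorm_le_bound _ (by positivity) fun u => ?_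
    by_cases hu : u = 0
    · simp [hu]
    have hu' : 0 < ‖u‖ := norm_pos_iff.2 hu
    have hn : ‖(r / (2 * ‖u‖)) • u‖ < r := by
      rw [norm_smul, Real.norm_eq_abs, abs_of_pos (by positivity)]
      field_simp
      linarith
    have h1 := hb _ hn
    have h2 := hb (-((r / (2 * ‖u‖)) • u)) (by rwa [norm_neg])
    rw [map_neg, map_smul, smul_eq_mul] at h2
    rw [map_smul, smul_eq_mul] at h1
    have h3 : |r / (2 * ‖u‖) * l u| ≤ 1 := abs_le.2 ⟨by linarith, h1⟩
    rw [abs_mul, abs_of_pos (by positivity)] at h3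
    rw [Real.norm_eq_abs]
    field_simp at h3 ⊢
    linarith

/-- The inequalities are the extreme points of the dual body at an interior point `x₀`. They are
finitely many, since the generators at which one is tight determine it. By Krein–Milman they span
the dual body, which cuts out `P` by Hahn–Banach. The tight generators of an extreme point, seen
from `x₀`, span the whole space, so it defines a facet. -/
theorem exists_facet_representation {P : Set E} (hP : IsPolytope P)
    (hdim : dim P = (finrank ℝ E : ℤ)) (hpos : 0 < finrank ℝ E) :
    ∃ (S : Set (StrongDual ℝ E)) (x₀ : E), S.Finite ∧
      P = hPoly (fun l : S => AffineMap.const ℝ E (1 : ℝ) -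
        (l.1.toLinearMap.toAffineMap.comp (AffineMap.id ℝ E - AffineMap.const ℝ E x₀))) ∧
      ∀ l ∈ S, {x | x ∈ P ∧ l (x - x₀) = 1} ∈ facets P := by
  obtain ⟨s, hs, rfl⟩ := hP
  have hne : (convexHull ℝ s).Nonempty := by
    by_contra h
    rw [not_nonempty_iff_eq_empty.1 h, dim_empty] at hdim
    omega
  have hspan : vectorSpan ℝ (convexHull ℝ s) = ⊤ := by
    rw [dim_eq_finrank hne] at hdim
    exact Submodule.eq_top_of_finrank_eq (by exact_mod_cast hdim)
  obtain ⟨x₀, hx₀⟩ := (convex_convexHull ℝ s).interior_nonempty_iff_affineSpan_eq_top.2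
    ((AffineSubspace.affineSpan_eq_top_iff_vectorSpan_eq_top_of_nonempty ℝ _ _ hne).2 hspan)
  set C := {l : StrongDual ℝ E | ∀ v ∈ s, l (v - x₀) ≤ 1} with hC
  have hCc : IsCompact C := isCompact_dualBody hx₀
  have hCv : Convex ℝ C := by
    intro l hl l' hl' a b ha hb hab v hv
    have h1 := mul_le_mul_of_nonneg_left (hl v hv) ha
    have h2 := mul_le_mul_of_nonneg_left (hl' v hv) hb
    simp only [_root_.add_apply, _root_.smul_apply, smul_eq_mul]
    linarith
  have hfin : (C.extremePoints ℝ).Finite := by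
    refine Set.Finite.of_finite_image (f := fun l => {v | v ∈ s ∧ l (v - x₀) = 1})
      (hs.finite_subsets.subset ?_) ?_
    · rintro _ ⟨l, -, rfl⟩ v hv
      exact hv.1
    · intro l hl l' hl' h
      refine sub_eq_zero.1 (eq_zero_of_mem_extremePoints hs hl fun v hv h1 => ?_)
      have h : {v | v ∈ s ∧ l (v - x₀) = 1} = {v | v ∈ s ∧ l' (v - x₀) = 1} := h
      have h2 : v ∈ {v | v ∈ s ∧ l' (v - x₀) = 1} := by
        rw [← h]
        exact ⟨hv, h1⟩
      rw [_root_.sub_apply, h1, h2.2, sub_self]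
  have hKM : convexHull ℝ (C.extremePoints ℝ) = C := by
    rw [← (hfin.isCompact_convexHull ℝ).isClosed.closure_eq]
    exact closure_convexHull_extremePoints hCc hCv
  have hrep : convexHull ℝ s = hPoly (fun l : C.extremePoints ℝ => AffineMap.const ℝ E (1 : ℝ) -
        (l.1.toLinearMap.toAffineMap.comp (AffineMap.id ℝ E - AffineMap.const ℝ E x₀))) := by
    ext x
    constructor
    · rintro hx ⟨l, hl⟩
      exact sub_nonneg.2 (le_one_of_mem_convexHull hl.1 hx)
    · intro hx
      by_contra hxs
      have hall : ∀ l ∈ C, l (x - x₀) ≤ 1 := by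
        rw [← hKM]
        intro l hl
        refine convexHull_min (t := {l : StrongDual ℝ E | l (x - x₀) ≤ 1})
          (fun l hl => sub_nonneg.1 (hx ⟨l, hl⟩)) ?_ hl
        intro l hl l' hl' a b ha hb hab
        have h1 := mul_le_mul_of_nonneg_left hl ha
        have h2 := mul_le_mul_of_nonneg_left hl' hb
        change (a • l + b • l') (x - x₀) ≤ 1
        simp only [_root_.add_apply, _root_.smul_apply, smul_eq_mul]
        linarith
      obtain ⟨f, u, hf, hu⟩ := geometric_hahn_banach_closed_point (convex_convexHull ℝ s)
        (hs.isCompact_convexHull ℝ).isClosed hxs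
      have h0 : 0 < u - f x₀ := sub_pos.2 (hf x₀ (interior_subset hx₀))
      have h1 : (1 / (u - f x₀)) • f ∈ C := by
        intro v hv
        have := hf v (subset_convexHull ℝ s hv)
        rw [_root_.smul_apply, map_sub, smul_eq_mul, one_div_mul_eq_div,
          div_le_one h0]
        linarith
      have h2 := hall _ h1
      rw [_root_.smul_apply, map_sub, smul_eq_mul, one_div_mul_eq_div,
          div_le_one h0] at h2
      linarith
  refine ⟨C.extremePoints ℝ, x₀, hfin, hrep, fun l hl => ⟨?_, ?_⟩⟩
  · have : Finite (C.extremePoints ℝ) := hfin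
    have h := hFace_mem_faces (a := fun l : C.extremePoints ℝ => AffineMap.const ℝ E (1 : ℝ) -
        (l.1.toLinearMap.toAffineMap.comp (AffineMap.id ℝ E - AffineMap.const ℝ E x₀)))
        (fun f => f.continuous_of_finiteDimensional) {⟨l, hl⟩}
    rw [← hrep] at h
    convert h using 1
    ext x
    rw [hFace, ← hrep]
    refine and_congr_right fun _ => ?_
    rw [singleton_subset_iff]
    change l (x - x₀) = 1 ↔ 1 - l (x - x₀) = 0
    rw [sub_eq_zero, eq_comm]
  · set F := {x | x ∈ convexHull ℝ s ∧ l (x - x₀) = 1}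
    set T := Submodule.span ℝ ((fun v => v - x₀) '' {v | v ∈ s ∧ l (v - x₀) = 1}) with hT
    have hTtop : T = ⊤ := by
      by_contra hne
      obtain ⟨f, hf0, hf⟩ := Submodule.exists_le_ker_of_lt_top T (lt_top_iff_ne_top.2 hne)
      have := eq_zero_of_mem_extremePoints hs hl (w := LinearMap.toContinuousLinearMap f)
        fun v hv h => hf (Submodule.subset_span ⟨v, ⟨hv, h⟩, rfl⟩)
      exact hf0 (by simpa using this)
    obtain ⟨v₀, hv₀s, hv₀⟩ : ∃ v, v ∈ s ∧ l (v - x₀) = 1 := by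
      by_contra! hcon
      have : {v | v ∈ s ∧ l (v - x₀) = 1} = ∅ := by
        ext v; simpa using hcon v
      rw [hT, this, image_empty, Submodule.span_empty] at hTtop
      rw [← finrank_top ℝ E, ← hTtop, finrank_bot] at hpos
      omega
    have hmem : ∀ v ∈ s, l (v - x₀) = 1 → v ∈ F := fun v hv h => ⟨subset_convexHull ℝ s hv, h⟩
    have hle : vectorSpan ℝ F ≤ LinearMap.ker l.toLinearMap := by
      rw [vectorSpan_def, Submodule.span_le]
      rintro _ ⟨y, hy, z, hz, rfl⟩
      change l (y - z) = 0
      have : y - z = (y - x₀) - (z - x₀) := by abel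
      rw [this, map_sub, hy.2, hz.2, sub_self]
    have hlt : finrank ℝ (vectorSpan ℝ F) < finrank ℝ E := by
      refine Submodule.finrank_lt fun h => ?_
      have : v₀ - x₀ ∈ LinearMap.ker l.toLinearMap := hle (h ▸ Submodule.mem_top)
      have : l (v₀ - x₀) = 0 := this
      linarith
    -- The tight generators span everything from `x₀`; moving the base point to `v₀` costs at most
    -- one dimension.
    have hge : finrank ℝ E ≤ finrank ℝ (vectorSpan ℝ F) + 1 := by
      have h1 : T ≤ vectorSpan ℝ F ⊔ Submodule.span ℝ {v₀ - x₀} := by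
        rw [hT, Submodule.span_le]
        rintro _ ⟨v, ⟨hv, h⟩, rfl⟩
        have : v - x₀ = (v - v₀) + (v₀ - x₀) := by abel
        change v - x₀ ∈ _
        rw [this]
        exact Submodule.add_mem _ (Submodule.mem_sup_left
          (vsub_mem_vectorSpan ℝ (hmem v hv h) (hmem v₀ hv₀s hv₀)))
          (Submodule.mem_sup_right (Submodule.mem_span_singleton_self _))
      have h2 := Submodule.finrank_mono h1
      rw [hTtop, finrank_top] at h2
      have h3 := Submodule.finrank_add_le_finrank_add_finrank (vectorSpan ℝ F)
        (Submodule.span ℝ {v₀ - x₀})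
      have h4 := finrank_span_le_card (R := ℝ) ({v₀ - x₀} : Set E)
      simp only [toFinset_singleton, Finset.card_singleton] at h4
      omega
    rw [hdim, dim_eq_finrank ⟨v₀, hmem v₀ hv₀s hv₀⟩]
    omega

end FacetRepresentation

/-! ### The vertices of the simplex in fan coordinates. -/

section Vertices

variable {E Y ι J : Type*} [AddCommGroup E] [Module ℝ E] [AddCommGroup Y] [Module ℝ Y]
  [Fintype ι] [DecidableEq ι]

/-- The points `v i` are the vertices of the simplex `{c ≥ 0, y = 0}` in the coordinates of `F`. -/
structure IsVertexFamily (F : Frame ι E Y) (v : ι → E) : Prop where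
  co_eq : ∀ i l, F.co i (v l) = if i = l then 1 else 0
  pr_eq : ∀ l, F.pr (v l) = 0

variable {F : Frame ι E Y} {v : ι → E} {g : ι → J → Y →ₗ[ℝ] ℝ}

theorem IsVertexFamily.vertex_mem (hv : IsVertexFamily F v) (l : ι) : v l ∈ fanPoly F g := by
  rw [mem_fanPoly]
  intro i j
  rw [hv.pr_eq, map_zero, hv.co_eq]
  split_ifs <;> norm_num

theorem IsVertexFamily.mem_act (hv : IsVertexFamily F v) (l i : ι) (j : J) :
    (i, j) ∈ act (fanAff F g) (v l) ↔ i ≠ l := by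
  change fanAff F g (i, j) (v l) = 0 ↔ _
  rw [fanAff_apply, hv.pr_eq, map_zero, sub_zero, hv.co_eq]
  simp

theorem IsVertexFamily.linear_apply (hv : IsVertexFamily F v) (f : E →ᵃ[ℝ] ℝ) (l₀ : ι) {w : E}
    (hw : F.pr.linear w = 0) : f.linear w = ∑ l, (F.co l).linear w * (f (v l) - f (v l₀)) := by
  have : w = ∑ l, (F.co l).linear w • (v l - v l₀) := by
    refine sub_eq_zero.1 (frame_linear_inj F (fun i => ?_) ?_)
    · rw [map_sub, map_sum]
      simp only [map_smul, affine_sub, smul_eq_mul, hv.co_eq, mul_sub]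
      rw [Finset.sum_sub_distrib, ← Finset.sum_mul, frame_sum_linear]
      simp
    · rw [map_sub, hw, map_sum, Finset.sum_eq_zero, sub_zero]
      intro l _
      rw [map_smul, frame_pr_linear, hv.pr_eq, hv.pr_eq, sub_zero, smul_zero]
  conv_lhs => rw [this]
  rw [map_sum]
  exact Finset.sum_congr rfl fun l _ => by rw [map_smul, affine_sub, smul_eq_mul]

omit [DecidableEq ι] in
theorem frame_linear_surjective [Nonempty ι] (F : Frame ι E Y) :
    Function.Surjective F.pr.linear := fun y => by
  obtain ⟨w, -, hw⟩ := frame_linear_surj F 0 y (by simp)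
  exact ⟨w, hw⟩

/-- An affine function with the values `δᵢₗ` at the vertices differs from the `i`-th coordinate by a
linear function of the coordinate in `Y`. -/
theorem IsVertexFamily.exists_linear [Nonempty ι] (hv : IsVertexFamily F v) {f : E →ᵃ[ℝ] ℝ} {i : ι}
    (hf : ∀ l, f (v l) = if i = l then 1 else 0) :
    ∃ γ : Y →ₗ[ℝ] ℝ, ∀ x, f x = F.co i x - γ (F.pr x) := by
  obtain ⟨ρ, hρ⟩ := LinearMap.exists_rightInverse_of_surjective F.pr.linear
    (LinearMap.range_eq_top.2 (frame_linear_surjective F))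
  -- The difference vanishes at all vertices, hence is constant along the fibres of `F.pr`, so it
  -- may be evaluated on any lift `ρ`.
  refine ⟨(F.co i - f).linear ∘ₗ ρ, fun x => ?_⟩
  have h0 : ∀ l, (F.co i - f) (v l) = 0 := fun l => by
    change F.co i (v l) - f (v l) = 0
    rw [hv.co_eq, hf, sub_self]
  have h1 : (F.co i - f).linear (x - v i - ρ (F.pr x)) = 0 := by
    rw [hv.linear_apply _ i]
    · simp [h0]
    · rw [map_sub, frame_pr_linear, hv.pr_eq, sub_zero]
      have : F.pr.linear (ρ (F.pr x)) = F.pr x := LinearMap.congr_fun hρ (F.pr x)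
      rw [this, sub_self]
  rw [map_sub, affine_sub, h0, sub_zero, sub_eq_zero] at h1
  change f x = F.co i x - (F.co i - f).linear (ρ (F.pr x))
  rw [← h1]
  change f x = F.co i x - (F.co i x - f x)
  ring

theorem lin_act_eq_bot_of_extreme {K : Type*} [Finite K] {a : K → E →ᵃ[ℝ] ℝ} {x : E}
    (hx : x ∈ (hPoly a).extremePoints ℝ) : lin a (act a x) = ⊥ := by
  rw [eq_bot_iff]
  intro w hw
  have h1 := eventually_mem_hPoly (w := w) hx.1 fun k hk => (hw k hk).ge
  have h2 := eventually_mem_hPoly (w := -w) hx.1 fun k hk => by rw [map_neg, hw k hk, neg_zero]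
  obtain ⟨t, ⟨h1, h2⟩, h3⟩ := ((h1.and h2).and self_mem_nhdsWithin).exists
  have h4 := hx.2 h1 h2 ⟨1 / 2, 1 / 2, by norm_num, by norm_num, by norm_num, by module⟩
  have h5 : t • w = 0 := by simpa using h4
  exact (Submodule.mem_bot ℝ).2 ((smul_eq_zero.1 h5).resolve_left (ne_of_gt h3))

theorem IsVertexFamily.tight_eq [Nonempty J] (hv : IsVertexFamily F v) (i : ι) :
    tight F g (v i) = {i}ᶜ := by
  ext l
  rw [mem_tight, hv.pr_eq]
  simp [hv.co_eq]

/-- At `v i` all indices but `i` are tight; as an extreme point spans a face of dimension `0`, the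
dimension formula leaves nothing for the flat. -/
theorem IsVertexFamily.flat_eq_bot [FiniteDimensional ℝ E] [FiniteDimensional ℝ Y]
    [Finite J] [Nonempty J] (hv : IsVertexFamily F v) {i : ι}
    (hx : v i ∈ (fanPoly F g).extremePoints ℝ) : flat g (arg g {i}ᶜ 0) = ⊥ := by
  have : Nonempty ι := ⟨i⟩
  have h := finrank_lin_act (hv.vertex_mem (g := g) i)
  rw [lin_act_eq_bot_of_extreme hx, finrank_bot, hv.tight_eq, Finset.card_compl,
    Finset.card_singleton, act_eq_arg (hv.vertex_mem i), hv.tight_eq, hv.pr_eq] at h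
  have := Fintype.card_pos (α := ι)
  exact Submodule.finrank_eq_zero.1 (by omega)

theorem IsVertexFamily.one_le_ncard_cells [FiniteDimensional ℝ E] [FiniteDimensional ℝ Y]
    [Finite J] [Nonempty J] (hv : IsVertexFamily F v) {i : ι}
    (hx : v i ∈ (fanPoly F g).extremePoints ℝ) : 1 ≤ (cells g {i}ᶜ 0).ncard := by
  refine (Set.ncard_pos (Set.toFinite _)).2 ?_
  exact ⟨_, 0, rfl, by rw [hv.flat_eq_bot hx, finrank_bot]; rfl⟩

/-- All coordinates are nonnegative on the polyhedron, so at the ends of a segment through `v i`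
those other than the `i`-th vanish. The vanishing of the `l`-th, with `r l > 0`, forces the
component in `Y` to be zero. -/
theorem IsVertexFamily.mem_extremePoints_scal {M : Type*} (hv : IsVertexFamily F v) {r : ι → ℝ}
    {h : M → Y →ₗ[ℝ] ℝ} (hh : ∀ y ≠ 0, ∃ m, 0 < h m y) {i l : ι} (hl : l ≠ i) (hrl : 0 < r l)
    (hr : ∀ i, 0 ≤ r i) [Nonempty M] :
    v i ∈ (fanPoly F (scal r h)).extremePoints ℝ := by
  refine ⟨hv.vertex_mem i, ?_⟩
  intro x hx x' hx' hseg
  obtain ⟨a, b, ha, hb, hab, hxx⟩ := hseg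
  have hnn : ∀ z ∈ fanPoly F (scal r h), ∀ p, 0 ≤ F.co p z := by
    intro z hz p
    by_cases h0 : F.pr z = 0
    · have := mem_fanPoly.1 hz p (Classical.arbitrary M)
      rwa [h0, map_zero] at this
    · obtain ⟨m, hm⟩ := hh _ h0
      exact (mul_nonneg (hr p) hm.le).trans (mem_fanPoly.1 hz p m)
  have hz : ∀ p, p ≠ i → F.co p x = 0 := by
    intro p hp
    have h1 := hv.co_eq p i
    rw [if_neg hp, ← hxx, Convex.combo_affine_apply hab, smul_eq_mul, smul_eq_mul] at h1
    have h2 := mul_nonneg ha.le (hnn x hx p)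
    have h3 := mul_nonneg hb.le (hnn x' hx' p)
    have h4 : a * F.co p x = 0 := by linarith
    exact (mul_eq_zero.1 h4).resolve_left ha.ne'
  have hpr : F.pr x = 0 := by
    by_contra h0
    obtain ⟨m, hm⟩ := hh _ h0
    have h1 : r l * h m (F.pr x) ≤ F.co l x := mem_fanPoly.1 hx l m
    rw [hz l hl] at h1
    exact absurd (mul_pos hrl hm) (not_lt.2 h1)
  refine F.inj _ _ (fun p => ?_) (by rw [hpr, hv.pr_eq])
  rw [hv.co_eq]
  split_ifs with hp
  · subst hp
    have := F.sum_co x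
    rwa [Finset.sum_eq_single p (fun q _ hq => hz q hq) (by simp)] at this
  · exact hz p hp

omit [DecidableEq ι] in
theorem finrank_frame [FiniteDimensional ℝ E] [FiniteDimensional ℝ Y] [Finite J] [Nonempty J]
    [Nonempty ι] (F : Frame ι E Y) (hg : FanPos g) :
    finrank ℝ E + 1 = finrank ℝ Y + Fintype.card ι := by
  obtain ⟨x, hx, hI, hact⟩ := exists_act_eq F hg (I := ∅) (y := 0)
    (Or.inl Finset.univ_nonempty.ne_empty.symm)
  have hempty : arg g ∅ 0 = ∅ := by ext; simp [arg]
  have h := finrank_lin_act hx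
  rw [hact, hI, hempty, show lin (fanAff F g) ∅ = ⊤ from eq_top_iff.2 fun w _ k hk => absurd hk (by simp),
    show flat g ∅ = ⊤ from eq_top_iff.2 fun w _ i j j' hk => absurd hk (by simp), finrank_top,
    finrank_top] at h
  simpa using h

omit [DecidableEq ι] in
theorem dim_fanPoly [Finite J] [Nonempty J] [Nonempty ι] (F : Frame ι E Y) (hg : FanPos g) :
    dim (fanPoly F g) = (finrank ℝ E : ℤ) := by
  obtain ⟨x, hx, hI, hact⟩ := exists_act_eq F hg (I := ∅) (y := 0)
    (Or.inl Finset.univ_nonempty.ne_empty.symm)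
  have hempty : arg g ∅ 0 = ∅ := by ext; simp [arg]
  rw [hempty] at hact
  have h := dim_hFace_act hx
  rw [hact, show lin (fanAff F g) ∅ = ⊤ from eq_top_iff.2 fun w _ k hk => absurd hk (by simp),
    finrank_top, show hFace (fanAff F g) ∅ = fanPoly F g by ext; simp [hFace, fanPoly]] at h
  exact h

variable [TopologicalSpace E]

/-- By the dimension formula a face of codimension one has exactly one tight index, and this is the
vertex it misses. -/
theorem IsVertexFamily.facet_inter [FiniteDimensional ℝ E] [FiniteDimensional ℝ Y]
    [Finite J] [Nonempty J] [Nonempty ι] (hv : IsVertexFamily F v)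
    (hg : FanPos g) (hpos : 0 < finrank ℝ E) {T : Set E} (hT : T ∈ facets (fanPoly F g)) :
    ∃ i, ∀ l, v l ∈ T ↔ l ≠ i := by
  obtain ⟨hT, hd⟩ := hT
  rw [dim_fanPoly F hg] at hd
  have hne : T.Nonempty := by
    by_contra h
    rw [not_nonempty_iff_eq_empty.1 h, dim_empty] at hd
    omega
  obtain ⟨x, -, hx, rfl⟩ := exists_eq_hFace_act hT hne
  rw [dim_hFace_act hx] at hd
  have h1 := finrank_lin_act hx
  have h2 := finrank_frame F hg
  have h3 := Submodule.finrank_le (flat g (act (fanAff F g) x))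
  have h4 : (tight F g x).card ≠ 0 := by
    intro h0
    rw [Finset.card_eq_zero] at h0
    rw [act_eq_arg hx, h0, show arg g ∅ (F.pr x) = ∅ by ext; simp [arg],
      show lin (fanAff F g) ∅ = ⊤ from eq_top_iff.2 fun w _ k hk => absurd hk (by simp),
      finrank_top] at hd
    omega
  obtain ⟨i, hi⟩ := Finset.card_eq_one.1 (show (tight F g x).card = 1 by omega)
  refine ⟨i, fun l => ⟨?_, fun hl => ⟨hv.vertex_mem l, ?_⟩⟩⟩
  · rintro ⟨-, h⟩ rfl
    obtain ⟨j, hj⟩ := amax_nonempty g l (F.pr x)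
    have h5 : (l, j) ∈ act (fanAff F g) x := by
      rw [act_eq_arg hx, hi]
      exact ⟨Finset.mem_singleton_self l, hj⟩
    exact (hv.mem_act l l j).1 (h h5) rfl
  · rintro ⟨p, j⟩ hp
    rw [act_eq_arg hx, hi] at hp
    rw [hv.mem_act]
    have : p = i := Finset.mem_singleton.1 hp.1
    rw [this]
    exact hl.symm

/-- The union of the faces without vertices of the simplex. -/
theorem IsVertexFamily.mem_sUnion_faces (hv : IsVertexFamily F v) [Finite J] [Nonempty J]
    (hc : ∀ f : E →ₗ[ℝ] ℝ, Continuous f) {x : E} :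
    x ∈ ⋃₀ {T | T ∈ faces (fanPoly F g) ∧ Disjoint T (range v)} ↔
      x ∈ fanPoly F g ∧ tight F g x = Finset.univ := by
  constructor
  · rintro ⟨T, ⟨hT, hd⟩, hxT⟩
    obtain ⟨z, -, hz, rfl⟩ := exists_eq_hFace_act hT ⟨x, hxT⟩
    refine ⟨hxT.1, ?_⟩
    rw [Finset.eq_univ_iff_forall]
    intro i
    by_contra hi
    have hmem : v i ∈ hFace (fanAff F g) (act (fanAff F g) z) := by
      refine ⟨hv.vertex_mem i, ?_⟩
      rintro ⟨p, j⟩ hp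
      rw [hv.mem_act]
      rintro rfl
      have h1 : (p, j) ∈ act (fanAff F g) x := hxT.2 hp
      rw [act_eq_arg hxT.1] at h1
      exact hi h1.1
    exact Set.disjoint_left.1 hd hmem ⟨i, rfl⟩
  · rintro ⟨hx, ht⟩
    refine ⟨hFace (fanAff F g) (act (fanAff F g) x), ⟨hFace_mem_faces hc _, ?_⟩, mem_hFace_act hx⟩
    rw [Set.disjoint_right]
    rintro _ ⟨i, rfl⟩ ⟨-, h⟩
    obtain ⟨j, hj⟩ := amax_nonempty g i (F.pr x)
    have h1 : (i, j) ∈ act (fanAff F g) x := by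
      rw [act_eq_arg hx, ht]
      exact ⟨Finset.mem_univ i, hj⟩
    exact (hv.mem_act i i j).1 (h h1) rfl

omit [DecidableEq ι] [TopologicalSpace E] in
-- Choose `y` at which the two functionals differ. Over positive multiples of `y` and `-y` lie
-- points of `U` with all coordinates tight. Their connecting line crosses the zero fibre at a point
-- whose `l`-th coordinate is a positive multiple of the spread, maximum minus minimum, of the
-- `l`-th family on `y`.
theorem exists_mem_affineSpan_co_pos [Finite J] [Nonempty J] (hg : FanPos g) {U : Set E}
    (hU : ∀ x ∈ fanPoly F g, tight F g x = Finset.univ → x ∈ U) {i : ι} {j j' : J}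
    (hne : g i j ≠ g i j') :
    ∃ z ∈ affineSpan ℝ U, F.pr z = 0 ∧ (∀ l, 0 ≤ F.co l z) ∧ 0 < F.co i z := by
  obtain ⟨y, hy⟩ : ∃ y, g i j y ≠ g i j' y := by
    by_contra! h
    exact hne (LinearMap.ext h)
  have hy0 : y ≠ 0 := by
    rintro rfl
    simp at hy
  obtain ⟨x, hx, hxt, s, hs, hxs⟩ := exists_tight_eq F hg (I := Finset.univ) (Or.inr hy0)
  obtain ⟨x', hx', hxt', s', hs', hxs'⟩ := exists_tight_eq F hg (I := Finset.univ)
    (Or.inr (neg_ne_zero.2 hy0))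
  obtain ⟨β, hβ⟩ := exists_best g y
  obtain ⟨β', hβ'⟩ := exists_best g (-y)
  have hco : ∀ l, F.co l x = s * g l (β l) y := fun l => by
    rw [co_eq_of_tight hx (hxt ▸ Finset.mem_univ l) (j := β l) (by rw [hxs, amax_smul hs]; exact hβ l),
      hxs, map_smul, smul_eq_mul]
  have hco' : ∀ l, F.co l x' = -(s' * g l (β' l) y) := fun l => by
    rw [co_eq_of_tight hx' (hxt' ▸ Finset.mem_univ l) (j := β' l)
      (by rw [hxs', amax_smul hs']; exact hβ' l), hxs', map_smul, smul_eq_mul, map_neg, mul_neg]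
  have hmax : ∀ l p, g l p y ≤ g l (β l) y := fun l p => hβ l p
  have hmin : ∀ l p, g l (β' l) y ≤ g l p y := fun l p => by
    have := hβ' l p
    rw [map_neg, map_neg] at this
    linarith
  have hz : ∀ l, F.co l (x + (s / (s + s')) • (x' - x)) =
      s * s' / (s + s') * (g l (β l) y - g l (β' l) y) := fun l => by
    rw [affine_add_smul, affine_sub, hco, hco']
    field_simp
    ring
  have hpos : 0 < s * s' / (s + s') := by positivity
  refine ⟨x + (s / (s + s')) • (x' - x), ?_, ?_, fun l => ?_, ?_⟩
  · have h1 := mem_affineSpan ℝ (hU x hx hxt)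
    have h2 := mem_affineSpan ℝ (hU x' hx' hxt')
    have := AffineMap.lineMap_mem (s / (s + s')) h1 h2
    rwa [AffineMap.lineMap_apply, vsub_eq_sub, vadd_eq_add, add_comm] at this
  · have h1 := frame_pr_linear F (x + (s / (s + s')) • (x' - x)) x
    rw [add_sub_cancel_left, map_smul, frame_pr_linear, hxs, hxs'] at h1
    rw [sub_eq_iff_eq_add.1 h1.symm]
    have h2 : (s / (s + s')) • (s' • -y - s • y) + s • y =
        (-(s / (s + s') * s') - s / (s + s') * s + s) • y := by module
    rw [h2, show -(s / (s + s') * s') - s / (s + s') * s + s = 0 by field_simp; ring, zero_smul]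
  · rw [hz]
    exact mul_nonneg hpos.le (sub_nonneg.2 (hmin l (β l)))
  · rw [hz]
    refine mul_pos hpos (sub_pos.2 ?_)
    rcases lt_or_gt_of_ne hy with h | h
    · exact (hmin i j).trans_lt (h.trans_le (hmax i j'))
    · exact (hmin i j').trans_lt (h.trans_le (hmax i j))

omit [DecidableEq ι] [TopologicalSpace E] in
/-- For the families of all multiples of the members of a single family, the points at which all
coordinates are tight span an affine subspace on which the coordinates are constant. -/
theorem finrank_vectorSpan_tight_scal [Nonempty ι] {M : Type*} [Finite M] [Nonempty M]
    {r : ι → ℝ} (hr : ∀ i, 0 ≤ r i) (hsum : ∑ i, r i = 1) {h : M → Y →ₗ[ℝ] ℝ}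
    (hh : ∀ y ≠ 0, ∃ m, 0 < h m y) :
    finrank ℝ (vectorSpan ℝ {x | x ∈ fanPoly F (scal r h) ∧ tight F (scal r h) x = Finset.univ}) =
      finrank ℝ Y := by
  have hg := fanPos_scal hsum hh
  have hco : ∀ x ∈ fanPoly F (scal r h), tight F (scal r h) x = Finset.univ → ∀ i, F.co i x = r i := by
    intro x hx ht
    obtain ⟨m, hm⟩ := Finite.exists_max fun m => h m (F.pr x)
    -- Summing over `i` shows that the maximum of `h` at this point is `1`.
    have hval : ∀ i, F.co i x = r i * h m (F.pr x) := fun i =>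
      co_eq_of_tight hx (ht ▸ Finset.mem_univ i) ((mem_amax_scal (hr i)).2 (Or.inr hm))
    have h1 := F.sum_co x
    simp only [hval, ← Finset.sum_mul, hsum, one_mul] at h1
    intro i
    rw [hval, h1, mul_one]
  set U := {x | x ∈ fanPoly F (scal r h) ∧ tight F (scal r h) x = Finset.univ}
  have hle : ∀ w ∈ vectorSpan ℝ U, ∀ i, (F.co i).linear w = 0 := by
    intro w hw i
    have : vectorSpan ℝ U ≤ LinearMap.ker (F.co i).linear := by
      rw [vectorSpan_def, Submodule.span_le]
      rintro _ ⟨x, hx, z, hz, rfl⟩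
      change (F.co i).linear (x - z) = 0
      rw [affine_sub, hco x hx.1 hx.2, hco z hz.1 hz.2, sub_self]
    exact this hw
  let T : vectorSpan ℝ U →ₗ[ℝ] Y := F.pr.linear ∘ₗ (vectorSpan ℝ U).subtype
  refine (LinearEquiv.ofBijective T ⟨?_, ?_⟩).finrank_eq
  · rw [← LinearMap.ker_eq_bot, LinearMap.ker_eq_bot']
    rintro ⟨w, hw⟩ h0
    exact Subtype.ext (frame_linear_inj F (hle w hw) h0)
  · intro y
    by_cases hy : y = 0
    · exact ⟨0, by rw [map_zero, hy]⟩
    obtain ⟨x, hx, hxt, s, hs, hxs⟩ := exists_tight_eq F hg (I := Finset.univ) (Or.inr hy)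
    obtain ⟨x', hx', hxt', s', hs', hxs'⟩ := exists_tight_eq F hg (I := Finset.univ)
      (Or.inr (neg_ne_zero.2 hy))
    refine ⟨⟨(1 / (s + s')) • (x - x'), Submodule.smul_mem _ _
      (vsub_mem_vectorSpan ℝ (show x ∈ U from ⟨hx, hxt⟩) (show x' ∈ U from ⟨hx', hxt'⟩))⟩, ?_⟩
    change F.pr.linear ((1 / (s + s')) • (x - x')) = y
    rw [map_smul, frame_pr_linear, hxs, hxs', smul_neg, sub_neg_eq_add, ← add_smul, smul_smul,
      one_div_mul_cancel (by positivity), one_smul]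

omit [DecidableEq ι] [TopologicalSpace E] in
-- A point lifts exactly if the sum of the maxima is at most `1`; the remainder is spread evenly
-- over the coordinates.
theorem frame_image_fanPoly [Finite J] [Nonempty J] [Nonempty ι] (F : Frame ι E Y)
    (g : ι → J → Y →ₗ[ℝ] ℝ) :
    F.pr '' fanPoly F g = {y | ∀ m, sumFam g m y ≤ 1} := by
  ext y
  constructor
  · rintro ⟨x, hx, rfl⟩ m
    rw [sumFam_apply]
    exact sum_le_one_of_mem hx m
  · intro hy
    obtain ⟨β, hβ⟩ := exists_best g y
    have h1 : sumFam g β y ≤ 1 := hy β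
    have hcard : (0 : ℝ) < Fintype.card ι := Nat.cast_pos.2 Fintype.card_pos
    obtain ⟨x, hx, hxy⟩ := F.surj (fun i => g i (β i) y + (1 - sumFam g β y) / Fintype.card ι) y (by
      rw [Finset.sum_add_distrib, ← sumFam_apply, Finset.sum_const, nsmul_eq_mul, Finset.card_univ]
      field_simp
      ring)
    refine ⟨x, mem_fanPoly.2 fun i j => ?_, hxy⟩
    rw [hx, hxy]
    have h2 := hβ i j
    have h3 : 0 ≤ (1 - sumFam g β y) / Fintype.card ι := div_nonneg (by linarith) hcard.le
    linarith

omit [DecidableEq ι] [TopologicalSpace E] in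
theorem sumFam_scal_le_one_iff {M : Type*} {r : ι → ℝ} (hr : ∀ i, 0 ≤ r i)
    (hsum : ∑ i, r i = 1) {h : M → Y →ₗ[ℝ] ℝ} {y : Y} :
    (∀ m, sumFam (scal r h) m y ≤ 1) ↔ ∀ m, h m y ≤ 1 := by
  constructor
  · intro hy m
    have := hy fun _ => m
    rw [sumFam_apply] at this
    simp only [scal, LinearMap.smul_apply, smul_eq_mul] at this
    rwa [← Finset.sum_mul, hsum, one_mul] at this
  · intro hy m
    rw [sumFam_apply, ← hsum]
    refine Finset.sum_le_sum fun i _ => ?_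
    exact mul_le_of_le_one_right (hr i) (hy (m i))

end Vertices

/-! ### Bounded polyhedra as fan polyhedra. -/

section Bounded

variable {E Y ι J : Type*} [NormedAddCommGroup E] [NormedSpace ℝ E] [AddCommGroup Y] [Module ℝ Y]
  [Fintype ι]

theorem eq_zero_of_ray_subset {S : Set E} (hS : Bornology.IsBounded S) {x w : E}
    (h : ∀ s : ℝ, 0 ≤ s → x + s • w ∈ S) : w = 0 := by
  obtain ⟨R, hR⟩ := hS.exists_norm_le
  by_contra hw
  have hw' : 0 < ‖w‖ := norm_pos_iff.2 hw
  have hR0 : 0 ≤ R := (norm_nonneg _).trans (hR _ (h 0 le_rfl))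
  have h1 := hR _ (h ((R + ‖x‖ + 1) / ‖w‖) (by positivity))
  have h2 : ‖((R + ‖x‖ + 1) / ‖w‖) • w‖ = R + ‖x‖ + 1 := by
    rw [norm_smul, Real.norm_eq_abs, abs_of_nonneg (by positivity)]
    field_simp
  have h3 := norm_sub_le (x + ((R + ‖x‖ + 1) / ‖w‖) • w) x
  rw [add_sub_cancel_left, h2] at h3
  linarith

/-- If the sum of the maxima at `y` were nonpositive, subtracting its mean from each maximum would
give a direction of coordinate sum `0` along which a ray stays in the polyhedron. -/
theorem fanPos_of_isBounded [Nonempty ι] [Finite J] [Nonempty J] {F : Frame ι E Y}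
    {g : ι → J → Y →ₗ[ℝ] ℝ} (hb : Bornology.IsBounded (fanPoly F g)) : FanPos g := by
  intro y hy
  by_contra! hcon
  obtain ⟨β, hβ⟩ := exists_best g y
  have hcard : (0 : ℝ) < Fintype.card ι := Nat.cast_pos.2 Fintype.card_pos
  obtain ⟨w, hw, hwy⟩ := frame_linear_surj F
    (fun i => g i (β i) y - (∑ l, g l (β l) y) / Fintype.card ι) y (by
      rw [Finset.sum_sub_distrib, Finset.sum_const, nsmul_eq_mul, Finset.card_univ]
      field_simp
      ring)
  obtain ⟨x, hx, hxy⟩ := F.surj (fun _ => 1 / Fintype.card ι) 0 (by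
    rw [Finset.sum_const, nsmul_eq_mul, Finset.card_univ]
    field_simp)
  have hw0 := eq_zero_of_ray_subset hb (x := x) (w := w) fun s hs => mem_fanPoly.2 fun i j => by
    have h1 := frame_pr_linear F (x + s • w) x
    rw [add_sub_cancel_left, map_smul, hwy, hxy, sub_zero] at h1
    rw [← h1, affine_add_smul, hx, hw, map_smul, smul_eq_mul]
    have h2 := mul_le_mul_of_nonneg_left (hβ i j) hs
    have h3 : (∑ l, g l (β l) y) / Fintype.card ι ≤ 0 := div_nonpos_of_nonpos_of_nonneg (hcon β) hcard.le
    have h4 := mul_nonneg hs (neg_nonneg.2 h3)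
    have h5 : (0 : ℝ) ≤ 1 / Fintype.card ι := by positivity
    linarith
  rw [hw0, map_zero] at hwy
  exact hy hwy.symm

/-- A bounded polyhedron such that each constraint is tight at all but one of the vertices of the
simplex is a fan polyhedron. -/
theorem IsVertexFamily.exists_eq_fanPoly [DecidableEq ι] [Nonempty ι] {F : Frame ι E Y} {v : ι → E}
    (hv : IsVertexFamily F v) {K : Type*} {a : K → E →ᵃ[ℝ] ℝ}
    (hb : Bornology.IsBounded (hPoly a)) (hne : ∀ i, ∃ x ∈ hPoly a, x ≠ v i)
    (hmem : ∀ i, v i ∈ hPoly a) (ha : ∀ k, ∃ i, ∀ l, a k (v l) = 0 ↔ l ≠ i) :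
    Nonempty K ∧ ∃ g : ι → K → Y →ₗ[ℝ] ℝ, hPoly a = fanPoly F g := by
  choose t ht using ha
  have hpos : ∀ k, 0 < a k (v (t k)) := fun k =>
    lt_of_le_of_ne (hmem _ k) fun h => (ht k (t k)).1 h.symm rfl
  have hγ : ∀ k, ∃ γ : Y →ₗ[ℝ] ℝ, ∀ x, ((a k (v (t k)))⁻¹ • a k) x = F.co (t k) x - γ (F.pr x) := by
    intro k
    refine hv.exists_linear fun l => ?_
    change (a k (v (t k)))⁻¹ * a k (v l) = _
    split_ifs with h
    · rw [h, inv_mul_cancel₀]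
      rw [← h]
      exact (hpos k).ne'
    · rw [(ht k l).2 (Ne.symm h), mul_zero]
  choose γ hγ using hγ
  -- Otherwise all constraints vanish at `v i`, and the ray from `v i` through another point lies in
  -- the bounded polyhedron.
  have hsurj : ∀ i, ∃ k, t k = i := by
    intro i
    by_contra! hcon
    obtain ⟨x, hx, hxi⟩ := hne i
    refine hxi (sub_eq_zero.1 (eq_zero_of_ray_subset hb (x := v i) (w := x - v i) fun s hs k => ?_))
    rw [affine_add_smul, affine_sub, (ht k i).2 (hcon k).symm, sub_zero, zero_add]
    exact mul_nonneg hs (hx k)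
  choose τ hτ using hsurj
  -- All families share the index type `K`; entries that do not belong to `i` repeat the constraint
  -- `τ i`.
  refine ⟨⟨τ (Classical.arbitrary ι)⟩, fun i k => if t k = i then γ k else γ (τ i), ?_⟩
  have hiff : ∀ k x, 0 ≤ a k x ↔ γ k (F.pr x) ≤ F.co (t k) x := by
    intro k x
    have h1 : (a k (v (t k)))⁻¹ * a k x = F.co (t k) x - γ k (F.pr x) := hγ k x
    rw [← sub_nonneg (a := F.co (t k) x), ← h1]
    exact (mul_nonneg_iff_of_pos_left (inv_pos.2 (hpos k))).symm
  ext x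
  rw [mem_fanPoly]
  constructor
  · intro hx i k
    split_ifs with h
    · rw [← h]
      exact (hiff k x).1 (hx k)
    · have := (hiff (τ i) x).1 (hx (τ i))
      rwa [hτ] at this
  · intro hx k
    have := hx (t k) k
    rw [if_pos rfl] at this
    exact (hiff k x).2 this

theorem exists_pos_add_mem_of_mem_intrinsicInterior {S : Set E} {x z : E}
    (hx : x ∈ intrinsicInterior ℝ S) (hz : z ∈ S) : ∃ t : ℝ, 0 < t ∧ x + t • (x - z) ∈ S := by
  obtain ⟨y, hy, rfl⟩ := mem_intrinsicInterior.1 hx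
  let f : ℝ → affineSpan ℝ S := fun t =>
    ⟨AffineMap.lineMap (y : E) z (-t), AffineMap.lineMap_mem _ y.2 (subset_affineSpan ℝ S hz)⟩
  have hf : Continuous f := by
    refine Continuous.subtype_mk ?_ _
    simp only [AffineMap.lineMap_apply, vsub_eq_sub, vadd_eq_add]
    fun_prop
  have hf0 : f 0 = y := by
    apply Subtype.ext
    simp [f]
  have h1 : ∀ᶠ t in 𝓝 (0 : ℝ), f t ∈ interior ((↑) ⁻¹' S : Set (affineSpan ℝ S)) :=
    hf.continuousAt.eventually_mem (by rw [hf0]; exact isOpen_interior.mem_nhds hy)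
  obtain ⟨t, ht, h0⟩ := ((h1.filter_mono nhdsWithin_le_nhds).and
    (self_mem_nhdsWithin (s := Ioi (0 : ℝ)))).exists
  refine ⟨t, h0, ?_⟩
  have h2 : ((f t : affineSpan ℝ S) : E) ∈ S :=
    interior_subset (s := ((↑) ⁻¹' S : Set (affineSpan ℝ S))) ht
  have h3 : ((f t : affineSpan ℝ S) : E) = y + t • ((y : E) - z) := by
    simp only [f, AffineMap.lineMap_apply, vsub_eq_sub, vadd_eq_add]
    module
  rwa [h3] at h2

end Bounded

/-! ### The projected polytope and the direct sum as fan polyhedra. -/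

section Hulls

variable {E Y ι J : Type*} [AddCommGroup E] [Module ℝ E] [AddCommGroup Y] [Module ℝ Y]
  [Fintype ι]

theorem affineMap_sum {N : Type*} [Fintype N] (f : E →ᵃ[ℝ] Y) (w : N → ℝ) (z : N → E)
    (hw : ∑ j, w j = 1) : f (∑ j, w j • z j) = ∑ j, w j • f (z j) := by
  have hd : ∀ x, f x = f.linear x + f 0 := fun x => congrFun f.decomp x
  simp only [hd (z _), hd (∑ j, _), map_sum, map_smul, smul_add, Finset.sum_add_distrib,
    ← Finset.sum_smul, hw, one_smul]

theorem IsVertexFamily.convexHull_eq [DecidableEq ι] {F : Frame ι E Y} {v : ι → E}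
    (hv : IsVertexFamily F v) :
    convexHull ℝ (range v) = {x | F.pr x = 0 ∧ ∀ i, 0 ≤ F.co i x} := by
  apply Subset.antisymm
  · refine convexHull_min ?_ ?_
    · rintro _ ⟨l, rfl⟩
      refine ⟨hv.pr_eq l, fun i => ?_⟩
      rw [hv.co_eq]
      split_ifs <;> norm_num
    · intro x hx z hz a b ha hb hab
      refine ⟨?_, fun i => ?_⟩
      · rw [Convex.combo_affine_apply hab, hx.1, hz.1, smul_zero, smul_zero, add_zero]
      · rw [Convex.combo_affine_apply hab]
        exact add_nonneg (mul_nonneg ha (hx.2 i)) (mul_nonneg hb (hz.2 i))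
  · rintro x ⟨hx, hx'⟩
    have : x = ∑ l, F.co l x • v l := by
      refine F.inj _ _ (fun i => ?_) ?_
      · rw [affineMap_sum _ _ _ (F.sum_co x)]
        simp [hv.co_eq]
      · rw [affineMap_sum _ _ _ (F.sum_co x), hx]
        simp [hv.pr_eq]
    rw [this]
    exact (convex_convexHull ℝ _).sum_mem (fun i _ => hx' i) (F.sum_co x)
      fun i _ => subset_convexHull ℝ _ ⟨i, rfl⟩

/-- Moving the vertices outside the simplex to the affine subspace `c = r` gives a fan polyhedron for
the multiples of the sums. -/
theorem IsVertexFamily.convexHull_projection [DecidableEq ι] [Finite J] [Nonempty J] [Nonempty ι]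
    {F : Frame ι E Y} {v : ι → E} (hv : IsVertexFamily F v) {g : ι → J → Y →ₗ[ℝ] ℝ} (hg : FanPos g)
    {V : Set E} (hV : fanPoly F g = convexHull ℝ V) {r : ι → ℝ} (hr : ∀ i, 0 ≤ r i)
    (hsum : ∑ i, r i = 1) {φ : E → E} (hφ : ∀ x i, F.co i (φ x) = r i)
    (hφ' : ∀ x, F.pr (φ x) = F.pr x) :
    convexHull ℝ (φ '' (V \ range v) ∪ range v) = fanPoly F (scal r (sumFam g)) := by
  apply Subset.antisymm
  · refine convexHull_min ?_ (convex_hPoly _)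
    rintro _ (⟨x, ⟨hx, -⟩, rfl⟩ | ⟨i, rfl⟩)
    · rw [mem_fanPoly]
      intro i m
      have hxP : x ∈ fanPoly F g := hV ▸ subset_convexHull ℝ V hx
      have h1 := sum_le_one_of_mem hxP m
      rw [hφ, hφ']
      change r i * sumFam g m (F.pr x) ≤ r i
      rw [sumFam_apply]
      exact mul_le_of_le_one_right (hr i) h1
    · exact hv.vertex_mem i
  · intro x hx
    set S := convexHull ℝ (φ '' (V \ range v) ∪ range v) with hS
    have hS1 : convexHull ℝ (range v) ⊆ S := convexHull_mono subset_union_right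
    have hx0 : ∀ i m, r i * sumFam g m (F.pr x) ≤ F.co i x := fun i m => mem_fanPoly.1 hx i m
    by_cases hy : F.pr x = 0
    · apply hS1
      rw [hv.convexHull_eq]
      refine ⟨hy, fun i => ?_⟩
      have := hx0 i fun _ => Classical.arbitrary J
      rwa [hy, map_zero, mul_zero] at this
    obtain ⟨β, hβ⟩ := exists_best g (F.pr x)
    -- The gauge of the basis polytope. The aim is `x = γ • u + (1 - γ) • s`, with `s` in the
    -- simplex and `u` over a boundary point of the basis polytope, with coordinates `r`.
    set γ := sumFam g β (F.pr x) with hγ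
    have hγ0 : 0 < γ := by
      rw [hγ, sumFam_apply]
      exact hg.sum_best_pos hy hβ
    have hγmax : ∀ m, sumFam g m (F.pr x) ≤ γ := sumFam_max_iff.2 hβ
    have hγ1 : γ ≤ 1 := by
      have := Finset.sum_le_sum fun i (_ : i ∈ Finset.univ) => hx0 i β
      rwa [← Finset.sum_mul, hsum, one_mul, F.sum_co] at this
    obtain ⟨x₁, hx₁, hx₁y⟩ : γ⁻¹ • F.pr x ∈ F.pr '' fanPoly F g := by
      rw [frame_image_fanPoly]
      intro m
      rw [map_smul, smul_eq_mul, inv_mul_le_one₀ hγ0]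
      exact hγmax m
    rw [hV, mem_convexHull_iff_exists_fintype] at hx₁
    obtain ⟨N, _, w, z, hw, hw1, hz, hwz⟩ := hx₁
    have hzP : ∀ j, z j ∈ fanPoly F g := fun j => hV ▸ subset_convexHull ℝ V (hz j)
    have hprsum : ∑ j, w j • F.pr (z j) = γ⁻¹ • F.pr x := by
      rw [← affineMap_sum _ _ _ hw1, hwz, hx₁y]
    -- The functional of `β` is at most `1` on the polyhedron and equals `1` at `x₁`, so it is `1`
    -- at each point used with nonzero weight; at the `v i` it is `0`.
    have hout : ∀ j, w j ≠ 0 → z j ∉ range v := by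
      rintro j hj ⟨i, hi⟩
      have h1 : ∑ j, w j * (1 - sumFam g β (F.pr (z j))) = 0 := by
        simp only [mul_sub, mul_one, Finset.sum_sub_distrib, hw1]
        have : ∑ j, w j * sumFam g β (F.pr (z j)) = sumFam g β (∑ j, w j • F.pr (z j)) := by
          simp
        rw [this, hprsum, map_smul, ← hγ, smul_eq_mul, inv_mul_cancel₀ hγ0.ne', sub_self]
      have h2 := (Finset.sum_eq_zero_iff_of_nonneg fun j _ => mul_nonneg (hw j) (by
        rw [sumFam_apply]
        exact sub_nonneg.2 (sum_le_one_of_mem (hzP j) β))).1 h1 j (Finset.mem_univ j)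
      rw [← hi, hv.pr_eq, map_zero, sub_zero, mul_one] at h2
      exact hj h2
    have hu : ∑ j, w j • φ (z j) ∈ S := by
      rw [← Finset.sum_filter_of_ne (p := fun j => w j ≠ 0) fun j _ h h0 => h (by rw [h0, zero_smul])]
      refine (convex_convexHull ℝ _).sum_mem (fun j _ => hw j) ?_ fun j hj => ?_
      · rw [Finset.sum_filter_ne_zero, hw1]
      · exact subset_convexHull ℝ _ (Or.inl ⟨z j, ⟨hz j, hout j (Finset.mem_filter.1 hj).2⟩, rfl⟩)
    set u := ∑ j, w j • φ (z j) with hudef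
    have huco : ∀ i, F.co i u = r i := fun i => by
      rw [hudef, affineMap_sum _ _ _ hw1]
      simp only [hφ, smul_eq_mul, ← Finset.sum_mul, hw1, one_mul]
    have hupr : F.pr u = γ⁻¹ • F.pr x := by
      rw [hudef, affineMap_sum _ _ _ hw1]
      simp only [hφ', hprsum]
    rcases hγ1.eq_or_lt with h1 | h1
    · have : x = u := by
        refine F.inj _ _ (fun i => ?_) (by rw [hupr, h1, inv_one, one_smul])
        have hle : ∀ i ∈ Finset.univ, r i ≤ F.co i x := fun i _ => by
          have := hx0 i β
          rwa [← hγ, h1, mul_one] at this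
        rw [huco]
        exact ((Finset.sum_eq_sum_iff_of_le hle).1 (by rw [hsum, F.sum_co]) i (Finset.mem_univ i)).symm
      rw [this]
      exact hu
    · have h1' : 0 < 1 - γ := sub_pos.2 h1
      obtain ⟨s, hs, hs'⟩ := F.surj (fun i => (1 - γ)⁻¹ * (F.co i x - r i * γ)) 0 (by
        rw [← Finset.mul_sum, Finset.sum_sub_distrib, F.sum_co, ← Finset.sum_mul, hsum, one_mul,
          inv_mul_cancel₀ h1'.ne'])
      have hsS : s ∈ S := by
        apply hS1
        rw [hv.convexHull_eq]
        refine ⟨hs', fun i => ?_⟩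
        rw [hs]
        exact mul_nonneg (inv_nonneg.2 h1'.le) (sub_nonneg.2 (hx0 i β))
      have : x = γ • u + (1 - γ) • s := by
        refine F.inj _ _ (fun i => ?_) ?_
        · rw [Convex.combo_affine_apply (by ring), huco, hs, smul_eq_mul, smul_eq_mul]
          field_simp
          ring
        · rw [Convex.combo_affine_apply (by ring), hupr, hs', smul_zero, add_zero, smul_smul,
            mul_inv_cancel₀ hγ0.ne', one_smul]
      rw [this]
      exact convex_convexHull ℝ _ hu hsS hγ0.le h1'.le (by ring)

/-- The frame of a product with an affine basis of the first factor. -/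
def basisFrame (b : AffineBasis ι ℝ E) (Y : Type*) [AddCommGroup Y] [Module ℝ Y] :
    Frame ι (E × Y) Y where
  co i := (b.coord i).comp (LinearMap.fst ℝ E Y).toAffineMap
  pr := (LinearMap.snd ℝ E Y).toAffineMap
  sum_co x := b.sum_coord_apply_eq_one x.1
  inj x x' h h' := by
    refine Prod.ext ?_ h'
    rw [← b.linear_combination_coord_eq_self x.1, ← b.linear_combination_coord_eq_self x'.1]
    exact Finset.sum_congr rfl fun i _ => congrArg (· • b i) (h i)
  surj c y hc := by
    refine ⟨(∑ i, c i • b i, y), fun i => ?_, rfl⟩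
    change b.coord i (∑ i, c i • b i) = c i
    classical
    rw [affineMap_sum _ _ _ hc]
    simp [b.coord_apply]

/-- The frame induced by a frame along a bijective affine map. -/
def Frame.pullback {E' : Type*} [AddCommGroup E'] [Module ℝ E'] (F : Frame ι E Y) (e : E' →ᵃ[ℝ] E)
    (he : Function.Bijective e) : Frame ι E' Y where
  co i := (F.co i).comp e
  pr := F.pr.comp e
  sum_co x := F.sum_co (e x)
  inj _ _ h h' := he.1 (F.inj _ _ h h')
  surj c y hc := by
    obtain ⟨x, hx, hxy⟩ := F.surj c y hc
    obtain ⟨x', rfl⟩ := he.2 x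
    exact ⟨x', hx, hxy⟩

/-- The frame with trivial first factor and the given origin. -/
def unitFrame (q : Y) : Frame Unit Y Y where
  co _ := AffineMap.const ℝ Y 1
  pr := AffineMap.id ℝ Y - AffineMap.const ℝ Y q
  sum_co x := by simp
  inj x x' _ h := sub_left_injective h
  surj c y hc := ⟨y + q, fun i => by simpa using hc.symm, add_sub_cancel_right y q⟩

theorem fanPoly_unitFrame {M : Type*} (q : Y) (h : M → Y →ₗ[ℝ] ℝ) :
    fanPoly (unitFrame q) (fun _ => h) = {y | ∀ m, h m (y - q) ≤ 1} := by
  ext y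
  rw [mem_fanPoly]
  exact ⟨fun hy m => hy () m, fun hy _ m => hy m⟩

theorem directSum_eq_fanPoly {M : Type*} [Finite M] [Nonempty M] (b : AffineBasis ι ℝ E)
    (hb : ∀ i, 0 < b.coord i 0) {h : M → Y →ₗ[ℝ] ℝ} (hh : ∀ y ≠ 0, ∃ m, 0 < h m y) :
    directSum (convexHull ℝ (range b)) {y | ∀ m, h m y ≤ 1} =
      fanPoly (basisFrame b Y) (scal (fun i => b.coord i 0) h) := by
  rw [AffineBasis.convexHull_eq_nonneg_coord]
  have hcoord : ∀ (i : ι) (a : ℝ) (x : E), b.coord i (a • x) =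
      a * b.coord i x + (1 - a) * b.coord i 0 := fun i a x => by
    have h1 := Convex.combo_affine_apply (f := b.coord i) (x := x) (y := 0) (a := a) (b := 1 - a)
      (by ring)
    rwa [smul_zero, add_zero, smul_eq_mul, smul_eq_mul] at h1
  ext ⟨x, y⟩
  rw [mem_fanPoly]
  change _ ↔ ∀ i m, b.coord i 0 * h m y ≤ b.coord i x
  constructor
  · rintro ⟨v, hv, w, hw, s, t, hs, ht, hst, hz⟩ i m
    obtain ⟨rfl, rfl⟩ := Prod.mk.injEq .. ▸ hz
    rw [hcoord, map_smul, smul_eq_mul]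
    have h1 := mul_nonneg hs (hv i)
    have h2 := mul_le_mul_of_nonneg_left (hw m) ht
    have h3 := mul_le_mul_of_nonneg_left (h2.trans (by linarith : t * 1 ≤ 1 - s)) (hb i).le
    linarith
  · intro hz
    have hsum0 := b.sum_coord_apply_eq_one 0
    have hsumx := b.sum_coord_apply_eq_one x
    obtain ⟨m, hm⟩ := Finite.exists_max fun m => h m y
    set γ := h m y with hγ
    have hγ1 : γ ≤ 1 := by
      have := Finset.sum_le_sum fun i (_ : i ∈ Finset.univ) => hz i m
      rwa [← Finset.sum_mul, hsum0, one_mul, hsumx] at this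
    have hγ0 : y ≠ 0 → 0 < γ := fun hy => by
      obtain ⟨m', hm'⟩ := hh y hy
      exact hm'.trans_le (hm m')
    have hγ0' : 0 ≤ γ := by
      by_cases hy : y = 0
      · rw [hγ, hy, map_zero]
      · exact (hγ0 hy).le
    -- For `y = 0` also `γ = 0`, and the convention `0⁻¹ = 0` is harmless.
    have hinv : γ • γ⁻¹ • y = y := by
      by_cases hy : y = 0
      · simp [hy]
      · rw [smul_smul, mul_inv_cancel₀ (hγ0 hy).ne', one_smul]
    have hw : γ⁻¹ • y ∈ {y | ∀ m, h m y ≤ 1} := by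
      intro p
      rw [map_smul, smul_eq_mul]
      by_cases hy : y = 0
      · simp [hy]
      · rw [inv_mul_le_one₀ (hγ0 hy)]
        exact hm p
    rcases hγ1.eq_or_lt with h1 | h1
    · have hx : x = 0 := by
        rw [← b.linear_combination_coord_eq_self x, ← b.linear_combination_coord_eq_self (0 : E)]
        have hle : ∀ i ∈ Finset.univ, b.coord i 0 ≤ b.coord i x := fun i _ => by
          have := hz i m
          rwa [← hγ, h1, mul_one] at this
        exact Finset.sum_congr rfl fun i _ => by
          rw [((Finset.sum_eq_sum_iff_of_le hle).1 (by rw [hsum0, hsumx]) i (Finset.mem_univ i))]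
      refine ⟨0, fun i => (hb i).le, γ⁻¹ • y, hw, 0, γ, le_rfl, hγ0', by linarith, ?_⟩
      rw [hinv, hx, smul_zero]
    · have h1' : 0 < 1 - γ := sub_pos.2 h1
      refine ⟨(1 - γ)⁻¹ • x, fun i => ?_, γ⁻¹ • y, hw, 1 - γ, γ, h1'.le, hγ0', by linarith, ?_⟩
      · have h2 : b.coord i ((1 - γ)⁻¹ • x) = (1 - γ)⁻¹ * (b.coord i x - b.coord i 0 * γ) := by
          rw [hcoord]
          field_simp
          ring
        rw [h2]
        exact mul_nonneg (inv_nonneg.2 h1'.le) (sub_nonneg.2 (hz i m))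
      · rw [hinv, smul_smul, mul_inv_cancel₀ h1'.ne', one_smul]

end Hulls

/-! ### Barycentric coordinates of the simplex, extended along a complement. -/

section SimplexFrame

variable {n k : ℕ} (σ : Affine.Simplex ℝ (EucSp n) k)

theorem finrank_simplexDir : finrank ℝ (simplexDir σ) = k :=
  σ.independent.finrank_vectorSpan (by simp)

theorem vsub_mem_simplexDir {p : EucSp n} (hp : p ∈ simplexBody σ) (i : Fin (k + 1)) :
    σ.points i - p ∈ simplexDir σ := by
  have h1 := convexHull_subset_affineSpan (𝕜 := ℝ) _ hp
  have h2 := mem_affineSpan ℝ (mem_range_self (f := σ.points) i)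
  have := AffineSubspace.vsub_mem_direction h2 h1
  rwa [direction_affineSpan] at this

/-- The vertices of the simplex, relative to a base point in it, as an affine basis of the
direction. -/
def simplexBasis {p : EucSp n} (hp : p ∈ simplexBody σ) :
    AffineBasis (Fin (k + 1)) ℝ (simplexDir σ) :=
  have hind : AffineIndependent ℝ fun i =>
      (⟨σ.points i - p, vsub_mem_simplexDir σ hp i⟩ : simplexDir σ) := by
    refine AffineIndependent.of_comp ((simplexDir σ).subtype.toAffineMap +
      AffineMap.const ℝ (simplexDir σ) p) ?_
    have e : ((simplexDir σ).subtype.toAffineMap + AffineMap.const ℝ (simplexDir σ) p) ∘ (fun i =>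
        (⟨σ.points i - p, vsub_mem_simplexDir σ hp i⟩ : simplexDir σ)) = σ.points :=
      funext fun i => sub_add_cancel (σ.points i) p
    rw [e]
    exact σ.independent
  { toFun := fun i => ⟨σ.points i - p, vsub_mem_simplexDir σ hp i⟩
    ind' := hind
    tot' := hind.affineSpan_eq_top_iff_card_eq_finrank_add_one.2 (by
      rw [finrank_simplexDir, Fintype.card_fin]) }

/-- The coordinates of a point relative to `V ⊕ W`, with `V` the direction of the simplex. -/
def splitMap {W : Submodule ℝ (EucSp n)} (hW : IsCompl W (simplexDir σ)) (p : EucSp n) :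
    EucSp n →ᵃ[ℝ] simplexDir σ × (EucSp n ⧸ simplexDir σ) :=
  (((simplexDir σ).projectionOnto W hW.symm).prod (simplexDir σ).mkQ).toAffineMap.comp
    (AffineMap.id ℝ (EucSp n) - AffineMap.const ℝ (EucSp n) p)

theorem splitMap_bijective {W : Submodule ℝ (EucSp n)} (hW : IsCompl W (simplexDir σ))
    (p : EucSp n) : Function.Bijective (splitMap σ hW p) := by
  have hlin : Function.Bijective
      (((simplexDir σ).projectionOnto W hW.symm).prod (simplexDir σ).mkQ) := by
    constructor
    · rw [← LinearMap.ker_eq_bot, LinearMap.ker_eq_bot']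
      intro x hx
      have h1 : (simplexDir σ).projectionOnto W hW.symm x = 0 := congrArg Prod.fst hx
      have h2 : (simplexDir σ).mkQ x = 0 := congrArg Prod.snd hx
      rw [Submodule.projectionOnto_apply_eq_zero_iff] at h1
      rw [Submodule.mkQ_apply, Submodule.Quotient.mk_eq_zero] at h2
      exact Submodule.disjoint_def.1 hW.disjoint x h1 h2
    · rintro ⟨v, y⟩
      obtain ⟨e, rfl⟩ := Submodule.mkQ_surjective _ y
      refine ⟨v + (e - (simplexDir σ).projectionOnto W hW.symm e), Prod.ext ?_ ?_⟩
      · change (simplexDir σ).projectionOnto W hW.symm _ = v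
        rw [map_add, map_sub, Submodule.projectionOnto_apply_left, Submodule.projectionOnto_apply_left,
          sub_self, add_zero]
      · change (simplexDir σ).mkQ _ = (simplexDir σ).mkQ e
        rw [Submodule.mkQ_apply, Submodule.mkQ_apply, Submodule.Quotient.eq]
        have : v + (e - (simplexDir σ).projectionOnto W hW.symm e) - e =
          (v - (simplexDir σ).projectionOnto W hW.symm e : simplexDir σ) := by
          push_cast
          abel
        rw [this]
        exact Subtype.coe_prop _
  exact hlin.comp ⟨fun x x' h => sub_left_injective h, fun y => ⟨y + p, add_sub_cancel_right y p⟩⟩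

/-- The barycentric coordinates of the simplex, extended to the whole space along `W`, together with
the quotient map. -/
def simplexFrame {W : Submodule ℝ (EucSp n)} (hW : IsCompl W (simplexDir σ)) {p : EucSp n}
    (hp : p ∈ simplexBody σ) :
    Frame (Fin (k + 1)) (EucSp n) (EucSp n ⧸ simplexDir σ) :=
  (basisFrame (simplexBasis σ hp) _).pullback (splitMap σ hW p) (splitMap_bijective σ hW p)

theorem simplexFrame_co {W : Submodule ℝ (EucSp n)} (hW : IsCompl W (simplexDir σ)) {p : EucSp n}
    (hp : p ∈ simplexBody σ) (i : Fin (k + 1)) (x : EucSp n) : (simplexFrame σ hW hp).co i x =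
      (simplexBasis σ hp).coord i ((simplexDir σ).projectionOnto W hW.symm (x - p)) := rfl

theorem simplexFrame_pr {W : Submodule ℝ (EucSp n)} (hW : IsCompl W (simplexDir σ)) {p : EucSp n}
    (hp : p ∈ simplexBody σ) (x : EucSp n) : (simplexFrame σ hW hp).pr x =
      (simplexDir σ).mkQ (x - p) := rfl

theorem isVertexFamily_simplexFrame {W : Submodule ℝ (EucSp n)} (hW : IsCompl W (simplexDir σ))
    {p : EucSp n} (hp : p ∈ simplexBody σ) :
    IsVertexFamily (simplexFrame σ hW hp) σ.points where
  co_eq i l := by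
    have h1 : (simplexDir σ).projectionOnto W hW.symm (σ.points l - p) = simplexBasis σ hp l :=
      Submodule.projectionOnto_apply_left hW.symm ⟨_, vsub_mem_simplexDir σ hp l⟩
    rw [simplexFrame_co, h1, AffineBasis.coord_apply]
  pr_eq l := by
    rw [simplexFrame_pr, Submodule.mkQ_apply, Submodule.Quotient.mk_eq_zero]
    exact vsub_mem_simplexDir σ hp l

theorem simplexFrame_co_vertexProjection {P : Set (EucSp n)} {σ : Affine.Simplex ℝ (EucSp n) k}
    (c : Placement P σ) (hp : c.p ∈ simplexBody σ) (x : EucSp n) (i : Fin (k + 1)) :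
    (simplexFrame σ c.isCompl hp).co i (vertexProjection c x) =
      (simplexFrame σ c.isCompl hp).co i c.p := by
  rw [simplexFrame_co, simplexFrame_co, vertexProjection, add_sub_cancel_left, sub_self, map_zero,
    (Submodule.projectionOnto_apply_eq_zero_iff _).2]
  rw [Submodule.projection_apply]
  exact Subtype.coe_prop _

theorem simplexFrame_pr_vertexProjection {P : Set (EucSp n)} {σ : Affine.Simplex ℝ (EucSp n) k}
    (c : Placement P σ) (hp : c.p ∈ simplexBody σ) (x : EucSp n) :
    (simplexFrame σ c.isCompl hp).pr (vertexProjection c x) =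
      (simplexFrame σ c.isCompl hp).pr x := by
  rw [simplexFrame_pr, simplexFrame_pr, vertexProjection, add_sub_cancel_left, Submodule.mkQ_apply,
    Submodule.mkQ_apply, eq_comm, Submodule.Quotient.eq, ← Submodule.projectionOnto_apply_eq_zero_iff c.isCompl,
    map_sub, Submodule.projection_apply, Submodule.projectionOnto_apply_left, sub_self]

end SimplexFrame

/-! ### Polytopes as hulls of their vertices. -/

section Polytopes

variable {E : Type*} [NormedAddCommGroup E] [NormedSpace ℝ E] {P : Set E}

theorem IsPolytope.finite_vertices (hP : IsPolytope P) : (vertices P).Finite := by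
  obtain ⟨s, hs, rfl⟩ := hP
  exact hs.subset extremePoints_convexHull_subset

theorem IsPolytope.isCompact (hP : IsPolytope P) : IsCompact P := by
  obtain ⟨s, hs, rfl⟩ := hP
  exact hs.isCompact_convexHull ℝ

theorem IsPolytope.eq_convexHull_vertices (hP : IsPolytope P) : P = convexHull ℝ (vertices P) := by
  have hconv : Convex ℝ P := by
    obtain ⟨s, -, rfl⟩ := hP
    exact convex_convexHull ℝ s
  rw [← (hP.finite_vertices.isCompact_convexHull ℝ).isClosed.closure_eq]
  exact (closure_convexHull_extremePoints hP.isCompact hconv).symm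

end Polytopes

/-! ### Rearrangement of the sum over index sets. -/

section Counting

/-- The sum over all subsets of a set with `k + 1` elements, in terms of the complementary
cardinality. -/
theorem sum_finset_fin_eq (k : ℕ) (f : ℤ → ℕ) :
    ∑ I : Finset (Fin (k + 1)), (if I.card = 0 then 0 else f (k - I.card)) =
      ∑ l ∈ Finset.Ico (-1 : ℤ) k, f l * (k + 1).choose (l + 1).toNat := by
  have h := Finset.sum_powerset_apply_card (fun m : ℕ => if m = 0 then 0 else f (k - m))
    (x := (Finset.univ : Finset (Fin (k + 1))))
  rw [Finset.powerset_univ, Finset.card_univ, Fintype.card_fin] at h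
  rw [h, Finset.sum_range_succ', if_pos rfl, smul_zero, add_zero]
  -- Sets of cardinality `m + 1` correspond to `l = k - (m + 1)`; their complements have `l + 1`
  -- elements.
  refine Finset.sum_bij' (fun m _ => (k : ℤ) - (m + 1 : ℕ)) (fun l _ => (k - 1 - l).toNat) ?_ ?_ ?_ ?_ ?_
  · intro m hm
    have := Finset.mem_range.1 hm
    rw [Finset.mem_Ico]
    omega
  · intro l hl
    have := Finset.mem_Ico.1 hl
    rw [Finset.mem_range]
    omega
  · intro m hm
    omega
  · intro l hl
    have := Finset.mem_Ico.1 hl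
    omega
  · intro m hm
    have := Finset.mem_range.1 hm
    rw [if_neg (Nat.succ_ne_zero m), smul_eq_mul, mul_comm]
    congr 1
    rw [← Nat.choose_symm (by omega)]
    congr 1
    omega

theorem sum_sum_ite_eq (k t : ℕ) (f : ℤ → ℕ) (hf : ∀ r < -1, f r = 0) (j : ℤ) :
    ∑ r ∈ Finset.Ico (-1 : ℤ) t, ∑ l ∈ Finset.Ico (-1 : ℤ) k,
      (if r + l = j - 1 then f r * (k + 1).choose (l + 1).toNat else 0) =
    ∑ l ∈ Finset.Ico (-1 : ℤ) k, (if j - 1 - l < t then f (j - 1 - l) else 0) *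
      (k + 1).choose (l + 1).toNat := by
  rw [Finset.sum_comm]
  refine Finset.sum_congr rfl fun l _ => ?_
  have h1 : ∀ r : ℤ, (r + l = j - 1) = (r = j - 1 - l) := fun r => by
    rw [eq_iff_iff]; omega
  simp only [h1, Finset.sum_ite_eq', Finset.mem_Ico]
  by_cases h2 : -1 ≤ j - 1 - l
  · by_cases h3 : j - 1 - l < t
    · rw [if_pos ⟨h2, h3⟩, if_pos h3]
    · rw [if_neg fun h => h3 h.2, if_neg h3, zero_mul]
  · rw [if_neg fun h => h2 h.1, hf _ (not_le.1 h2)]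
    simp

end Counting

/-! ### Special simplices, placements and the basis polytope. -/

section SpecialSimplices

variable {n k : ℕ} {P : Set (EucSp n)} {σ : Affine.Simplex ℝ (EucSp n) k}

theorem Placement.mem_simplexBody (c : Placement P σ) : c.p ∈ simplexBody σ :=
  (intrinsicInterior_subset c.mem).2

/-- The base point exists only if some nonempty face avoids the vertices of `Σ`. This excludes the
degenerate case `n = 0`. -/
theorem Placement.exists_mem (c : Placement P σ) : ∃ x ∈ P, x ∉ simplexVertices σ := by
  have h1 : (residualSpan P σ : Set (EucSp n)).Nonempty := ⟨_, (intrinsicInterior_subset c.mem).1⟩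
  obtain ⟨x, T, ⟨hT, hd⟩, hx⟩ := (affineSpan_nonempty ℝ).1 h1
  exact ⟨x, hT.subset hx, Set.disjoint_left.1 hd hx⟩

theorem ncard_simplexVertices_inter (T : Set (EucSp n)) :
    (simplexVertices σ ∩ T).ncard = {i | σ.points i ∈ T}.ncard := by
  rw [← Set.ncard_image_of_injective _ σ.independent.injective]
  congr 1
  ext x
  constructor
  · rintro ⟨⟨i, rfl⟩, h⟩
    exact ⟨i, h, rfl⟩
  · rintro ⟨i, h, rfl⟩
    exact ⟨⟨i, rfl⟩, h⟩

theorem ncard_simplexVertices_inter_eq_iff (T : Set (EucSp n)) :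
    (simplexVertices σ ∩ T).ncard = k ↔ ∃ i, ∀ l, σ.points l ∈ T ↔ l ≠ i := by
  rw [ncard_simplexVertices_inter]
  have h := Set.ncard_add_ncard_compl {i | σ.points i ∈ T}
  rw [Nat.card_eq_fintype_card, Fintype.card_fin] at h
  have h1 : {i | σ.points i ∈ T}.ncard = k ↔ {i | σ.points i ∈ T}ᶜ.ncard = 1 := by omega
  rw [h1, Set.ncard_eq_one]
  refine exists_congr fun i => ?_
  rw [Set.ext_iff]
  refine forall_congr' fun l => ?_
  simp only [mem_compl_iff, mem_ofPred_eq, mem_singleton_iff]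
  tauto

/-- A polytope with a special simplex is a fan polyhedron in the coordinates given by the simplex. -/
theorem exists_eq_fanPoly (hP : IsPolytope P) (hn : dim P = n) (hσ : IsSpecialSimplex P σ)
    (c : Placement P σ) : ∃ (K : Type) (_ : Finite K) (_ : Nonempty K)
      (g : Fin (k + 1) → K → (EucSp n ⧸ simplexDir σ) →ₗ[ℝ] ℝ),
      P = fanPoly (simplexFrame σ c.isCompl c.mem_simplexBody) g := by
  obtain ⟨z, hzP, hz⟩ := c.exists_mem
  have hv := isVertexFamily_simplexFrame σ c.isCompl c.mem_simplexBody
  have hmem : ∀ i, σ.points i ∈ P := fun i => (hσ.1 ⟨i, rfl⟩).1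
  have hn0 : 0 < n := by
    rw [Nat.pos_iff_ne_zero]
    rintro rfl
    exact hz ⟨0, Subsingleton.elim _ _⟩
  obtain ⟨S, x₀, hS, hrep, hfac⟩ := exists_facet_representation hP
    (by rw [hn, finrank_euclideanSpace, Fintype.card_fin]) (by simpa using hn0)
  have : Finite S := hS
  obtain ⟨hne, g, hg⟩ := hv.exists_eq_fanPoly (by rw [← hrep]; exact hP.isCompact.isBounded)
    (fun i => ⟨z, by rw [← hrep]; exact hzP, fun h => hz ⟨i, h.symm⟩⟩)
    (fun i => by rw [← hrep]; exact hmem i) (fun l => by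
      obtain ⟨i, hi⟩ := (ncard_simplexVertices_inter_eq_iff _).1 (hσ.2 _ (hfac l l.2))
      refine ⟨i, fun m => ?_⟩
      rw [← hi m]
      change 1 - l.1 (σ.points m - x₀) = 0 ↔ _ ∧ _
      rw [sub_eq_zero, eq_comm]
      exact (and_iff_right (hmem m)).symm)
  exact ⟨S, this, hne, g, hrep.trans hg⟩

theorem basisPolytope_eq {K : Type*} [Finite K] [Nonempty K] {W : Submodule ℝ (EucSp n)}
    (hW : IsCompl W (simplexDir σ)) {p : EucSp n} (hp : p ∈ simplexBody σ)
    (g : Fin (k + 1) → K → (EucSp n ⧸ simplexDir σ) →ₗ[ℝ] ℝ) :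
    basisPolytope (fanPoly (simplexFrame σ hW hp) g) σ =
      {y | ∀ m, sumFam g m (y - (simplexDir σ).mkQ p) ≤ 1} := by
  have h := frame_image_fanPoly (simplexFrame σ hW hp) g
  ext y
  constructor
  · rintro ⟨x, hx, rfl⟩
    have h1 : (simplexFrame σ hW hp).pr x ∈ {y | ∀ m, sumFam g m y ≤ 1} := h ▸ ⟨x, hx, rfl⟩
    rwa [simplexFrame_pr, map_sub] at h1
  · intro hy
    have h1 : y - (simplexDir σ).mkQ p ∈ {y | ∀ m, sumFam g m y ≤ 1} := hy
    rw [← h] at h1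
    obtain ⟨x, hx, hxy⟩ := h1
    rw [simplexFrame_pr, map_sub] at hxy
    exact ⟨x, hx, sub_left_injective hxy⟩

theorem projectedPolytope_eq (hP : IsPolytope P) (c : Placement P σ) {K : Type*} [Finite K]
    [Nonempty K] {g : Fin (k + 1) → K → (EucSp n ⧸ simplexDir σ) →ₗ[ℝ] ℝ} (hg : FanPos g)
    (hPg : P = fanPoly (simplexFrame σ c.isCompl c.mem_simplexBody) g) :
    projectedPolytope c = fanPoly (simplexFrame σ c.isCompl c.mem_simplexBody)
      (scal (fun i => (simplexFrame σ c.isCompl c.mem_simplexBody).co i c.p) (sumFam g)) := by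
  have hv := isVertexFamily_simplexFrame σ c.isCompl c.mem_simplexBody
  have hp := c.mem_simplexBody
  rw [simplexBody, simplexVertices, hv.convexHull_eq] at hp
  exact hv.convexHull_projection hg (hPg.symm.trans hP.eq_convexHull_vertices) hp.2
    (Frame.sum_co _ _) (fun x i => simplexFrame_co_vertexProjection c c.mem_simplexBody x i)
    fun x => simplexFrame_pr_vertexProjection c c.mem_simplexBody x

/-- The base point of the copy of the basis polytope is in the relative interior of the face of the
simplex that corresponds to the families with at least two members. -/
theorem Placement.co_pos (c : Placement P σ) {K : Type*} [Finite K]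
    [Nonempty K] {g : Fin (k + 1) → K → (EucSp n ⧸ simplexDir σ) →ₗ[ℝ] ℝ} (hg : FanPos g)
    (hPg : P = fanPoly (simplexFrame σ c.isCompl c.mem_simplexBody) g) {i : Fin (k + 1)}
    {j j' : K} (hne : g i j ≠ g i j') :
    0 < (simplexFrame σ c.isCompl c.mem_simplexBody).co i c.p := by
  set F := simplexFrame σ c.isCompl c.mem_simplexBody
  have hv : IsVertexFamily F σ.points := isVertexFamily_simplexFrame σ c.isCompl c.mem_simplexBody
  obtain ⟨z, hz, hz0, hzl, hzi⟩ := exists_mem_affineSpan_co_pos (F := F) hg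
    (U := ⋃₀ residualComplex P σ) (fun x hx ht => by
      have := (hv.mem_sUnion_faces fun f => f.continuous_of_finiteDimensional).2 ⟨hx, ht⟩
      rwa [← hPg] at this) hne
  -- Slightly beyond `p`, seen from `z`, the `i`-th coordinate is still nonnegative; as it is
  -- positive at `z`, it cannot vanish at `p`.
  obtain ⟨t, ht, h⟩ := exists_pos_add_mem_of_mem_intrinsicInterior c.mem
    (show z ∈ (residualSpan P σ : Set (EucSp n)) ∩ simplexBody σ from ⟨hz, by
      rw [simplexBody, simplexVertices, hv.convexHull_eq]
      exact ⟨hz0, hzl⟩⟩)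
  have h2 := h.2
  rw [simplexBody, simplexVertices, hv.convexHull_eq] at h2
  have h3 := h2.2 i
  rw [affine_add_smul, affine_sub] at h3
  by_contra! hcon
  have h4 := mul_pos ht hzi
  have h5 := mul_nonneg ht.le (neg_nonneg.2 hcon)
  linarith

theorem isSpecialSimplex_fanPoly {M : Type*} [Finite M] [Nonempty M] (hn0 : 0 < n)
    {W : Submodule ℝ (EucSp n)} (hW : IsCompl W (simplexDir σ)) {p : EucSp n}
    (hp : p ∈ simplexBody σ) {g : Fin (k + 1) → M → (EucSp n ⧸ simplexDir σ) →ₗ[ℝ] ℝ}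
    (hg : FanPos g) (hext : ∀ i, σ.points i ∈ (fanPoly (simplexFrame σ hW hp) g).extremePoints ℝ) :
    IsSpecialSimplex (fanPoly (simplexFrame σ hW hp) g) σ := by
  refine ⟨?_, fun T hT => ?_⟩
  · rintro _ ⟨i, rfl⟩
    exact hext i
  · rw [ncard_simplexVertices_inter_eq_iff]
    exact (isVertexFamily_simplexFrame σ hW hp).facet_inter hg (by simpa using hn0) hT

/-- The translate of a full-dimensional polytope by an interior point. -/
theorem translate_eq {Y M : Type*} [AddCommGroup Y] [Module ℝ Y] {h : M → Y →ₗ[ℝ] ℝ} {q₀ q : Y}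
    (hq : ∀ m, h m (q - q₀) < 1) :
    (fun x => x - q) '' {y | ∀ m, h m (y - q₀) ≤ 1} =
      {y | ∀ m, ((1 - h m (q - q₀))⁻¹ • h m) y ≤ 1} := by
  have key : ∀ y, (∀ m, h m (y - q₀) ≤ 1) ↔ ∀ m, ((1 - h m (q - q₀))⁻¹ • h m) (y - q) ≤ 1 := by
    intro y
    refine forall_congr' fun m => ?_
    rw [LinearMap.smul_apply, smul_eq_mul, inv_mul_le_one₀ (sub_pos.2 (hq m)), map_sub, map_sub, map_sub]
    constructor <;> intro h <;> linarith
  ext y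
  constructor
  · rintro ⟨x, hx, rfl⟩
    exact (key x).1 hx
  · intro hy
    refine ⟨y + q, (key _).2 ?_, add_sub_cancel_right y q⟩
    rwa [add_sub_cancel_right]

theorem lt_one_of_mem_interior {Y M : Type*} [AddCommGroup Y] [Module ℝ Y] [TopologicalSpace Y]
    [IsTopologicalAddGroup Y] [ContinuousSMul ℝ Y] {h : M → Y →ₗ[ℝ] ℝ} {q₀ q : Y}
    (hq : q ∈ interior {y | ∀ m, h m (y - q₀) ≤ 1}) (m : M) : h m (q - q₀) < 1 := by
  refine lt_of_le_of_ne (interior_subset hq m) fun h1 => ?_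
  have hf : Continuous fun t : ℝ => q + t • (q - q₀) := by fun_prop
  have h2 : ∀ᶠ t in 𝓝 (0 : ℝ), q + t • (q - q₀) ∈ interior {y | ∀ m, h m (y - q₀) ≤ 1} :=
    hf.continuousAt.eventually_mem (by
      rw [zero_smul, add_zero]
      exact isOpen_interior.mem_nhds hq)
  obtain ⟨t, ht, h0⟩ := ((h2.filter_mono nhdsWithin_le_nhds).and
    (self_mem_nhdsWithin (s := Ioi (0 : ℝ)))).exists
  have h3 : h m (q + t • (q - q₀) - q₀) ≤ 1 := interior_subset ht m
  have h4 : q + t • (q - q₀) - q₀ = (1 + t) • (q - q₀) := by module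
  rw [h4, map_smul, h1, smul_eq_mul, mul_one] at h3
  have h0 : 0 < t := h0
  linarith

/-- The cones are those over the proper faces of the polyhedron, the empty face giving `{0}`. Hence
their number depends on `Q` alone, not on the chosen centre. -/
theorem numCones_eq_ite {Y M : Type*} [AddCommGroup Y] [Module ℝ Y] [FiniteDimensional ℝ Y]
    [TopologicalSpace Y] [Finite M] [Nonempty M] (hc : ∀ f : Y →ₗ[ℝ] ℝ, Continuous f) (q : Y)
    {h : M → Y →ₗ[ℝ] ℝ} (hh : ∀ y ≠ 0, ∃ m, 0 < h m y) (d : ℤ) :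
    numCones h d = if d - 1 < finrank ℝ Y then fVec {y | ∀ m, h m (y - q) ≤ 1} (d - 1) else 0 := by
  rw [← fanPoly_unitFrame, fVec_unit hc _ hh, sub_add_cancel]
  split_ifs with h1 h2
  · omega
  · rw [zero_add]
  · exact numCones_of_lt h (by omega)

/-- A full-dimensional simplex as an affine basis. -/
def simplexAffineBasis (τ : Affine.Simplex ℝ (EucSp k) k) :
    AffineBasis (Fin (k + 1)) ℝ (EucSp k) where
  toFun := τ.points
  ind' := τ.independent
  tot' := τ.independent.affineSpan_eq_top_iff_card_eq_finrank_add_one.2 (by simp)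

end SpecialSimplices

end SpecialSimplex

end
theorem mainTheorem4 (n k : ℕ) (P : Set (EucSp n)) (hP : IsPolytope P) (hn : dim P = n)
    (σ : Affine.Simplex ℝ (EucSp n) k) (hσ : IsSpecialSimplex P σ) (hwild : IsWild P σ)
    (c : Placement P σ) :
    -- `P'` is a meek `n`-polytope with special simplex `Σ` and basis polytope `Q`
    (IsPolytope (projectedPolytope c) ∧ dim (projectedPolytope c) = n ∧
      IsSpecialSimplex (projectedPolytope c) σ ∧ IsMeek (projectedPolytope c) σ ∧
      basisPolytope (projectedPolytope c) σ = basisPolytope P σ) ∧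
    -- comparison of the `f`-vectors of `P` and `P'`
    fVec P 0 = fVec (projectedPolytope c) 0 ∧
    (∀ i : ℤ, i = n - 2 ∨ i = n - 1 → fVec P i < fVec (projectedPolytope c) i) ∧
    (∀ i : ℤ, fVec P i ≤ fVec (projectedPolytope c) i) ∧
    -- comparison with `Σ ⊕ Q`, for every `k`-simplex `τ` and every translate `Q - q` of `Q` that
    -- contain the origin in their interiors, and the `f`-vector of `Σ ⊕ Q`
    (∀ τ : Affine.Simplex ℝ (EucSp k) k, (0 : EucSp k) ∈ interior (simplexBody τ) →
      ∀ q ∈ interior (basisPolytope P σ),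
        (∀ i : ℤ, fVec (projectedPolytope c) i ≤
          fVec (directSum (simplexBody τ) ((fun x => x - q) '' basisPolytope P σ)) i) ∧
        (fVec (projectedPolytope c) 0 =
          fVec (directSum (simplexBody τ) ((fun x => x - q) '' basisPolytope P σ)) 0) ∧
        (∀ j : ℤ, 0 ≤ j → j ≤ n - 1 →
          fVec (directSum (simplexBody τ) ((fun x => x - q) '' basisPolytope P σ)) j =
            ∑ r ∈ Finset.Ico (-1 : ℤ) (dim (basisPolytope P σ)), ∑ l ∈ Finset.Ico (-1 : ℤ) k,
              if r + l = j - 1 then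
                fVec (basisPolytope P σ) r * (k + 1).choose (l + 1).toNat
              else 0)) := by
  classical
  obtain ⟨K, _, _, g, hPg⟩ := exists_eq_fanPoly hP hn hσ c
  have hp := c.mem_simplexBody
  set F := simplexFrame σ c.isCompl c.mem_simplexBody
  have hv : IsVertexFamily F σ.points := isVertexFamily_simplexFrame σ c.isCompl c.mem_simplexBody
  have hcE : ∀ f : EucSp n →ₗ[ℝ] ℝ, Continuous f := fun f => f.continuous_of_finiteDimensional
  have hclosed : IsClosed (simplexDir σ : Set (EucSp n)) :=
    (simplexDir σ).closed_of_finiteDimensional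
  have hcY : ∀ f : (EucSp n ⧸ simplexDir σ) →ₗ[ℝ] ℝ, Continuous f :=
    fun f => f.continuous_of_finiteDimensional
  have hg : FanPos g := fanPos_of_isBounded (by rw [← hPg]; exact hP.isCompact.isBounded)
  have hh : ∀ y ≠ 0, ∃ m, 0 < sumFam g m y := fun y hy => by
    obtain ⟨m, hm⟩ := hg y hy
    exact ⟨m, by rwa [sumFam_apply]⟩
  set r : Fin (k + 1) → ℝ := fun i => F.co i c.p with hr_def
  have hr : ∀ i, 0 ≤ r i := by
    rw [simplexBody, simplexVertices, hv.convexHull_eq] at hp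
    exact hp.2
  have hsum : ∑ i, r i = 1 := F.sum_co c.p
  have hrg : ∀ i, r i = 0 → ∀ j j', g i j = g i j' := fun i hi j j' => by
    by_contra hne
    exact (c.co_pos hg hPg hne).ne' hi
  have hP' : projectedPolytope c = fanPoly F (scal r (sumFam g)) := projectedPolytope_eq hP c hg hPg
  have hg' : FanPos (scal r (sumFam g)) := fanPos_scal hsum hh
  set t := Module.finrank ℝ (EucSp n ⧸ simplexDir σ) with ht
  have hnkt : n = k + t := by
    have := finrank_frame F hg
    rw [finrank_euclideanSpace, Fintype.card_fin, Fintype.card_fin] at this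
    omega
  obtain ⟨z, hzP, hz⟩ := c.exists_mem
  have hn0 : 0 < n := by
    rw [Nat.pos_iff_ne_zero]
    rintro rfl
    exact hz ⟨0, Subsingleton.elim _ _⟩
  have hU : ∀ {M : Type} [Finite M] [Nonempty M]
      (f : Fin (k + 1) → M → (EucSp n ⧸ simplexDir σ) →ₗ[ℝ] ℝ),
      ⋃₀ residualComplex (fanPoly F f) σ =
        {x | x ∈ fanPoly F f ∧ tight F f x = Finset.univ} := fun f => by
    ext x
    exact hv.mem_sUnion_faces hcE
  -- A point of the residual complex has all coordinates tight, so its component in the quotient is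
  -- nonzero.
  obtain ⟨y₀, hy₀⟩ : ∃ y : EucSp n ⧸ simplexDir σ, y ≠ 0 := by
    have h1 : (residualSpan P σ : Set (EucSp n)).Nonempty := ⟨_, (intrinsicInterior_subset c.mem).1⟩
    obtain ⟨x, hx⟩ := (affineSpan_nonempty ℝ).1 h1
    rw [hPg, hU] at hx
    exact ⟨_, pr_ne_zero_of_tight_univ hx.2⟩
  have hext : ∀ i, σ.points i ∈ (fanPoly F (scal r (sumFam g))).extremePoints ℝ := by
    intro i
    -- Otherwise all families but the `i`-th are constant and their flat is the whole nonzero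
    -- quotient; it is zero, however, as the `i`-th point is a vertex of `P`.
    obtain ⟨l, hl, hrl⟩ : ∃ l, l ≠ i ∧ 0 < r l := by
      by_contra! hcon
      have hflat := hv.flat_eq_bot (g := g) (by rw [← hPg]; exact hσ.1 ⟨i, rfl⟩)
      rw [flat_arg_eq_top fun l hl => hrg l (le_antisymm (hcon l (by simpa using hl)) (hr l))] at hflat
      exact hy₀ ((Submodule.mem_bot ℝ).1 (hflat ▸ Submodule.mem_top))
    exact hv.mem_extremePoints_scal hh hl hrl hr
  have hQ : basisPolytope P σ = {y | ∀ m, sumFam g m (y - (simplexDir σ).mkQ c.p) ≤ 1} :=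
    (congrArg (basisPolytope · σ) hPg).trans (basisPolytope_eq c.isCompl c.mem_simplexBody g)
  have hQ' : basisPolytope (projectedPolytope c) σ = basisPolytope P σ := by
    rw [hQ, hP', basisPolytope_eq]
    ext y
    exact sumFam_scal_le_one_iff hr hsum
  have hdimQ : dim (basisPolytope P σ) = t := by
    rw [hQ, ← fanPoly_unitFrame]
    exact dim_fanPoly _ (fanPos_unit hh)
  have hmeek : IsMeek (projectedPolytope c) σ := by
    have hne : (⋃₀ residualComplex (projectedPolytope c) σ).Nonempty := by
      obtain ⟨x, hx, hxt, -⟩ := exists_tight_eq F hg' (I := Finset.univ) (Or.inr hy₀)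
      rw [hP', hU]
      exact ⟨x, hx, hxt⟩
    rw [IsMeek, hQ', hdimQ, residualSpan, dim_eq_finrank ((affineSpan_nonempty ℝ).2 hne)]
    change (t : ℤ) = Module.finrank ℝ (affineSpan ℝ _).direction
    rw [direction_affineSpan, hP', hU, finrank_vectorSpan_tight_scal hr hsum hh]
  have hle := ncard_cells_le_scal (g := g) hr hrg
  have hone : ∀ i, 1 ≤ (cells g {i}ᶜ 0).ncard := fun i =>
    hv.one_le_ncard_cells (by rw [← hPg]; exact hσ.1 ⟨i, rfl⟩)
  obtain ⟨i₀, -, hi₀⟩ := Finset.exists_lt_of_sum_lt (s := Finset.univ)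
    (f := fun _ : Fin (k + 1) => (0 : ℝ)) (g := r) (by rw [hsum]; simp)
  have huniv : ∀ d, (cells (scal r (sumFam g)) Finset.univ d).ncard = numCones (sumFam g) d :=
    ncard_cells_scal hr _ ⟨i₀, Finset.mem_univ _, hi₀⟩
  refine ⟨⟨⟨_, (hP.finite_vertices.sdiff.image _).union (Set.finite_range _), rfl⟩, ?_, ?_, hmeek, hQ'⟩,
    ?_, ?_, ?_, ?_⟩
  · rw [hP', dim_fanPoly F hg', finrank_euclideanSpace, Fintype.card_fin]
  · rw [hP']
    exact isSpecialSimplex_fanPoly hn0 c.isCompl c.mem_simplexBody hg' hext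
  · rw [hP', hPg, fVec_fanPoly hcE F hg, fVec_fanPoly hcE F hg']
    exact Finset.sum_congr rfl fun I _ => ncard_cells_eq_of_vertices hg' hle
      (fun d => by rw [huniv, ncard_cells_univ]) hone I
  · intro i hi
    have hnot := hwild.2 c
    rw [hP', hPg] at hnot ⊢
    -- By `n = k + t`, the values `n - 1` and `n - 2` belong to cones of dimension `t` and `t - 1`
    -- for singletons.
    refine fVec_lt_of_not_combEquiv hcE F hg hr hsum hrg hnot ?_
    rw [Fintype.card_fin]
    omega
  · intro i
    rw [hP', hPg, fVec_fanPoly hcE F hg, fVec_fanPoly hcE F hg']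
    exact Finset.sum_le_sum fun I _ => hle I _
  · intro τ hτ q hq
    rw [hQ] at hq
    have hq1 := lt_one_of_mem_interior hq
    -- Recentring `Q` at the interior point `q` rescales each functional by a positive constant.
    set h' : (Fin (k + 1) → K) → (EucSp n ⧸ simplexDir σ) →ₗ[ℝ] ℝ :=
      fun m => (1 - sumFam g m (q - (simplexDir σ).mkQ c.p))⁻¹ • sumFam g m with hh'_def
    have hh' : ∀ y ≠ 0, ∃ m, 0 < h' m y := fun y hy => by
      obtain ⟨m, hm⟩ := hh y hy
      exact ⟨m, mul_pos (inv_pos.2 (sub_pos.2 (hq1 m))) hm⟩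
    set b := simplexAffineBasis τ
    have hb : ∀ i, 0 < b.coord i 0 := by
      have h1 : (0 : EucSp k) ∈ interior (convexHull ℝ (Set.range b)) := hτ
      rwa [AffineBasis.interior_convexHull] at h1
    have hQq : (fun x => x - q) '' basisPolytope P σ = {y | ∀ m, h' m y ≤ 1} := by
      rw [hQ]
      exact translate_eq hq1
    have hDS : directSum (simplexBody τ) ((fun x => x - q) '' basisPolytope P σ) =
        fanPoly (basisFrame b _) (scal (fun i => b.coord i 0) h') := by
      rw [hQq]
      exact directSum_eq_fanPoly b hb hh'
    have hbsum : ∑ i, b.coord i 0 = 1 := b.sum_coord_apply_eq_one 0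
    have hg'' : FanPos (scal (fun i => b.coord i 0) h') := fanPos_scal hbsum hh'
    have hcD : ∀ f : (EucSp k × (EucSp n ⧸ simplexDir σ)) →ₗ[ℝ] ℝ, Continuous f :=
      fun f => f.continuous_of_finiteDimensional
    have hQ'' : basisPolytope P σ = {y | ∀ m, h' m (y - q) ≤ 1} := by
      ext y
      have h1 : y ∈ basisPolytope P σ ↔ y - q ∈ (fun x => x - q) '' basisPolytope P σ :=
        (sub_left_injective.mem_set_image).symm
      rw [h1, hQq]
      rfl
    have hcones : ∀ d, numCones (sumFam g) d =
        if d - 1 < t then fVec (basisPolytope P σ) (d - 1) else 0 := fun d => by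
      rw [numCones_eq_ite hcY ((simplexDir σ).mkQ c.p) hh, ← hQ]
    have hcones' : ∀ d, numCones h' d =
        if d - 1 < t then fVec (basisPolytope P σ) (d - 1) else 0 := fun d => by
      rw [numCones_eq_ite hcY q hh', ← hQ'']
    -- Both families describe `Q`, from different centres; the fans may differ, the numbers of cones
    -- do not.
    have hceq : ∀ d, numCones (sumFam g) d = numCones h' d := fun d => by rw [hcones, hcones']
    have hle' := ncard_cells_scal_le_scal hr hsum hb hceq
    rw [hP', hDS, fVec_fanPoly hcE F hg']
    refine ⟨fun i => ?_, ?_, fun j hj0 hj => ?_⟩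
    · rw [fVec_fanPoly hcE F hg', fVec_fanPoly hcD _ hg'']
      exact Finset.sum_le_sum fun I _ => hle' I _
    · rw [fVec_fanPoly hcD _ hg'']
      exact Finset.sum_congr rfl fun I _ => ncard_cells_eq_of_vertices hg'' hle'
        (fun d => by rw [huniv, hceq, ncard_cells_scal (fun i => (hb i).le) _
          ⟨i₀, Finset.mem_univ _, hb i₀⟩]) (fun i => (hone i).trans (hle _ _)) I
    · rw [fVec_fanPoly hcD _ hg'', hdimQ, sum_sum_ite_eq k t _ (fun r hr => fVec_lt_neg_one _ hr),
        ← sum_finset_fin_eq]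
      refine Finset.sum_congr rfl fun I _ => ?_
      split_ifs with h1 h2
      -- The empty index set contributes only the polytope itself, in dimension `n`, which `j ≤ n -
      -- 1` excludes.
      · rw [Finset.card_eq_zero.1 h1, ncard_cells_of_const (by simp), if_neg]
        rw [Finset.card_empty, Fintype.card_fin]
        push_cast
        omega
      all_goals
        obtain ⟨i, hi⟩ := Finset.card_ne_zero.1 h1
        rw [ncard_cells_scal (fun i => (hb i).le) _ ⟨i, hi, hb i⟩, hcones', Fintype.card_fin]
        push_cast
      · rw [if_pos (by omega)]
        congr 1
        ring
      · rw [if_neg (by omega)]
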